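/- Let $0<\alpha\le 1$ and let $W\in C^{2,\alpha}(\mathbb R)$ be $1$-periodic with $W(0)=0$ and $W\ge c_W\,\mathrm{dist}^2(\cdot,\mathbb Z)$ for some $c_W>0$ (so that $W''(0)>0$). Let $\mathcal A=-(-\Delta)^{1/2}$ on $\mathbb R^2$ with any fixed normalisation, that is, \[ \mathcal A u(x)=\kappa\ \mathrm{P.V.}\!\int_{\mathbb R^2}\frac{u(y)-u(x)}{|y-x|^3}\,dy=\kappa\lim_{\varepsilon\to0^+}\int_{|y-x|>\varepsilon}\frac{u(y)-u(x)}{|y-x|^3}\,dy,\qquad \kappa>0 . \] Let $\tfrac12<\zeta\le1$ with $2\zeta\le 1+\alpha$ (for $W\in C^{2,1}$, in particular for $W\in C^3$, this is every $\tfrac12<\zeta\le 1$), and let $F>0$. Then there are constants $C,c,l_0>0$, not depending on $l$, such that for every $l\ge l_0$ there is a function \[ \bar u\in C^{1/2}(\mathbb R^2)\cap C^{1,1/2}_{loc}\big(B_2\setminus\overline{B_1}\big)\cap C^{1,1/2}\big(\mathbb R^2\setminus B_{3/2}\big) \] with the following properties. 1. $\bar u\equiv0$ on $B_1$, and \[ \mathcal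 A\bar u-W'(\bar u)\ \ge\ \frac1l+\frac F{l^{1+\zeta}}\qquad\text{on }\mathbb R^2\setminus B_1 . \] Here $\mathcal A\bar u(x)$ exists at every point $x$ of $\mathbb R^2\setminus B_1$; it is finite if $|x|>1$, while on $\partial B_1$ the value $+\infty$ is allowed. 2. $\bar u$ is constant on $\mathbb R^2\setminus B_{l^\zeta/3}$, and \[ \left|\lim_{|x|\to\infty}\bar u(x)-\left(1-\frac1{W''(0)\,l}\right)\right|\le\frac C{l^{2\zeta}} . \] 3. For all $x$ with $0<|x|\le l^\zeta$, \[ \bar u(x)\ \ge\ 1-\frac1{W''(0)\,l}-\frac c{|x|^2}. \] -/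

import Mathlib

open Set Filter Topology MeasureTheory
open scoped NNReal

noncomputable section

/-- Periodic multi-well potentials of class `C^{2,α}`: `W` is `1`-periodic, `W 0 = 0`, and
`W ≥ c dist(·, ℤ)²` for some `c > 0`. -/
structure IsMultiWellPotential (W : ℝ → ℝ) (α : ℝ≥0) : Prop where
  contDiff : ContDiff ℝ 2 W
  holder : ∃ K : ℝ≥0, HolderWith K α (deriv (deriv W))
  periodic : Function.Periodic W 1
  map_zero : W 0 = 0
  coercive : ∃ c : ℝ, 0 < c ∧ ∀ z : ℝ, c * Metric.infDist z (Set.range ((↑) : ℤ → ℝ)) ^ 2 ≤ W z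

/-- The truncated singular integral `∫_{|y - x| > ε} (u(y) - u(x)) / |y - x|^{n+1} dy` on `ℝⁿ`. -/
def truncatedHalfLaplacian {n : ℕ} (u : EuclideanSpace ℝ (Fin n) → ℝ) (ε : ℝ)
    (x : EuclideanSpace ℝ (Fin n)) : ℝ :=
  ∫ y in {y : EuclideanSpace ℝ (Fin n) | ε < ‖y - x‖}, (u y - u x) / ‖y - x‖ ^ (n + 1)

/-- `A u (x) = a`, where
`A u (x) = κ · P.V. ∫ (u(y) - u(x)) / |y - x|^{n+1} dy = κ · lim_{ε → 0+} ∫_{|y - x| > ε} …`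
is the operator `-(-Δ)^{1/2}` up to normalisation. The principal value is allowed to be
infinite, so the limit is taken in the extended reals. -/
def HasHalfLaplacianAt {n : ℕ} (κ : ℝ) (u : EuclideanSpace ℝ (Fin n) → ℝ)
    (x : EuclideanSpace ℝ (Fin n)) (a : EReal) : Prop :=
  Tendsto (fun ε : ℝ => ((κ * truncatedHalfLaplacian u ε x : ℝ) : EReal)) (𝓝[>] 0) (𝓝 a)

/-- `u ∈ C^{0,r}(ℝⁿ)`: bounded and globally `r`-Hölder continuous. -/
def IsHolderClass {n : ℕ} (r : ℝ≥0) (u : EuclideanSpace ℝ (Fin n) → ℝ) : Prop :=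
  (∃ B : ℝ, ∀ x, |u x| ≤ B) ∧ ∃ K : ℝ≥0, HolderWith K r u

/-- `u ∈ C^{1,r}(S)`: `u` is differentiable at the points of `S`, `u` and its derivative are bounded
on `S`, and the derivative is `r`-Hölder continuous on `S`. -/
def IsC1HolderOn {n : ℕ} (r : ℝ≥0) (u : EuclideanSpace ℝ (Fin n) → ℝ)
    (S : Set (EuclideanSpace ℝ (Fin n))) : Prop :=
  (∀ x ∈ S, DifferentiableAt ℝ u x) ∧
  (∃ B : ℝ, ∀ x ∈ S, |u x| ≤ B ∧ ‖fderiv ℝ u x‖ ≤ B) ∧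
  ∃ K : ℝ≥0, HolderOnWith K r (fderiv ℝ u) S

/-- `u ∈ C^{1,r}_loc(U)` for an open set `U`: `u ∈ C^{1,r}(K)` for all compact `K ⊆ U`. -/
def IsLocC1HolderOn {n : ℕ} (r : ℝ≥0) (u : EuclideanSpace ℝ (Fin n) → ℝ)
    (U : Set (EuclideanSpace ℝ (Fin n))) : Prop :=
  ∀ K : Set (EuclideanSpace ℝ (Fin n)), K ⊆ U → IsCompact K → IsC1HolderOn r u K

end

/-! The barrier is one minus a radial layer. Put `f s = -deriv W (-s)`, the derivative of `V s = W
(-s)`, whose wells at 0 and 1 are equally deep. Suppose w ≥ 0 equals 1 on the disc of radius 3,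
vanishes beyond radius r, lies below M P₁ (P₁ is the Poisson kernel at height 1, of order |x|⁻³ at
infinity) and is a strict supersolution: κ halfLap w ≤ f(w) - η P₁ + C/r³. Take a bump χ that is 1
on the unit disc and 0 beyond radius 2, and set u = 1 - d - w + dχ. Then u = 0 on the unit disc and
u = 1 - d beyond radius r. Where |x| ≥ 3, periodicity of W bounds A u - W'(u) below by f(w + d) -
f(w) + η P₁ - C/r³. By Hölder continuity of W'' the increment of f is W''(0) d up to a multiple of d
(w + d)^α. This error is O(d^(1+α)) where w ≤ d; elsewhere it is at most a multiple of d^α w, which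
η P₁ absorbs for small d (`mul_mul_add_rpow_le`). On |x| ≤ 3 the bump costs only O(d), which η P₁
absorbs too. With r = l^ζ/3 and d = 1/(W''(0) l) + C₁/l^(2ζ), all remaining errors are O(l^(-2ζ))
and a suitable C₁ pays for them.

To construct w, the half-Laplacian is replaced by the bounded operators (P_ε - 1)/ε, where P_ε
averages against the Poisson kernel. Monotone projected gradient descent for the layer energy,
between a bump φ and the constant 1, starts from φ and increases to a fixed point v. Energy bounds
uniform in ε and a nonlocal isoperimetric inequality (`volume_real_lt_le`) bound the area of {v >
s}. This has two consequences. Where v touches 1, the average of v at a fixed large scale is at most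
1/2, so the cap is harmless and v is a supersolution with an extra term η P₁
(`exists_layerLim_supersolution`). Moreover v is radial and almost equicontinuous, hence small far
away, and comparison with a Poisson kernel then gives cubic decay (`layerLim_le_mul_poissonKer`).

Mollifying v and taking ε small turns the Poisson quotient into the true half-Laplacian, with errors
that are small multiples of P₁ (`exists_mollify_supersolution`). Cutting off at radius r costs
O(r⁻³) because of the cubic decay (`exists_cutoff_supersolution`). -/

/-! ### The Poisson kernel of the half-space and its convolution semigroup. -/

open scoped FourierTransform RealInnerProductSpace in
/-- The characteristic function of the Cauchy density. -/
theorem integral_exp_mul_cauchy {t : ℝ} (ht : 0 < t) {r : ℝ} (hr : 0 ≤ r) :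
    ∫ a : ℝ, Complex.exp ((r * a : ℝ) * Complex.I) * ((t / Real.pi / (t ^ 2 + a ^ 2) : ℝ) : ℂ)
      = (Real.exp (-(t * r)) : ℂ) := by
  have hpi := Real.pi_pos
  set f : ℝ → ℂ := fun x => (Real.exp (-(2 * Real.pi * t) * |x|) : ℂ) with hf
  have hcont : Continuous f := by fun_prop
  have hc : -(2 * Real.pi * t) < 0 := by nlinarith [mul_pos hpi ht]
  have hpos : IntegrableOn f (Ioi 0) := by
    refine (IntegrableOn.congr_fun (integrableOn_exp_mul_Ioi hc 0).ofReal (fun x hx => ?_)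
      measurableSet_Ioi)
    simp [hf, abs_of_pos (mem_Ioi.1 hx)]
  have hneg : IntegrableOn f (Iic 0) := by
    refine (IntegrableOn.congr_fun
      (integrableOn_exp_mul_Iic (a := 2 * Real.pi * t) (by positivity) 0).ofReal (fun x hx => ?_)
      measurableSet_Iic)
    simp [hf, abs_of_nonpos (mem_Iic.1 hx)]
  have hint : Integrable f := by
    rw [← integrableOn_univ, ← Iic_union_Ioi (a := (0:ℝ))]
    exact hneg.union hpos
  -- The two-sided exponential `f` has the Cauchy density as its Fourier transform; both are
  -- integrable, so Fourier inversion at r/(2π) yields the claim.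
  have hF : 𝓕 f = fun ξ : ℝ => ((t / Real.pi / (t ^ 2 + ξ ^ 2) : ℝ) : ℂ) := by
    ext ξ
    rw [Real.fourier_real_eq_integral_exp_smul]
    set g : ℝ → ℂ := fun v => Complex.exp (((-2 * Real.pi * v * ξ : ℝ) : ℂ) * Complex.I) • f v
      with hg
    have hgi : Integrable g := by
      refine hint.norm.mono' (by fun_prop) (ae_of_all _ fun v => ?_)
      simp only [hg, norm_smul, Complex.norm_exp_ofReal_mul_I, one_mul, le_refl]
    have hsplit : ∫ v, g v = (∫ v in Iic 0, g v) + ∫ v in Ioi 0, g v := by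
      rw [← setIntegral_univ, ← Iic_union_Ioi (a := (0:ℝ)),
        setIntegral_union (Iic_disjoint_Ioi le_rfl) measurableSet_Ioi hgi.integrableOn
          hgi.integrableOn]
    have h1 : ∫ v in Iic 0, g v = ∫ v : ℝ in Iic 0,
        Complex.exp ((2 * Real.pi * t - 2 * Real.pi * ξ * Complex.I) * v) := by
      refine setIntegral_congr_fun measurableSet_Iic fun v hv => ?_
      simp only [hg, hf, abs_of_nonpos (mem_Iic.1 hv), smul_eq_mul, Complex.ofReal_exp,
        ← Complex.exp_add]
      congr 1; push_cast; ring
    have h2 : ∫ v in Ioi 0, g v = ∫ v : ℝ in Ioi 0,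
        Complex.exp ((-(2 * Real.pi * t) - 2 * Real.pi * ξ * Complex.I) * v) := by
      refine setIntegral_congr_fun measurableSet_Ioi fun v hv => ?_
      simp only [hg, hf, abs_of_pos (mem_Ioi.1 hv), smul_eq_mul, Complex.ofReal_exp,
        ← Complex.exp_add]
      congr 1; push_cast; ring
    rw [hsplit, h1, h2, integral_exp_mul_complex_Iic (by simp; positivity),
      integral_exp_mul_complex_Ioi (by simp; positivity)]
    simp only [Complex.ofReal_zero, mul_zero, Complex.exp_zero]
    have hA : (2 * Real.pi * t - 2 * Real.pi * ξ * Complex.I : ℂ) ≠ 0 := by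
      intro h; have := congrArg Complex.re h; simp at this; exact ht.ne' this
    have hB : (-(2 * Real.pi * t) - 2 * Real.pi * ξ * Complex.I : ℂ) ≠ 0 := by
      intro h; have := congrArg Complex.re h; simp at this; exact ht.ne' this
    have hC : ((t:ℂ) ^ 2 + (ξ:ℂ) ^ 2) ≠ 0 := by
      have : (0:ℝ) < t ^ 2 + ξ ^ 2 := by positivity
      exact_mod_cast this.ne'
    have hD : (Real.pi : ℂ) ≠ 0 := by exact_mod_cast hpi.ne'
    push_cast
    rw [div_add_div _ _ hA hB, div_div, div_eq_div_iff (mul_ne_zero hA hB) (mul_ne_zero hD hC)]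
    linear_combination (-4 * Real.pi ^ 2 * t * ξ ^ 2 : ℂ) * Complex.I_sq
  have hFi : Integrable (𝓕 f) := by
    rw [hF]
    refine Integrable.ofReal ?_
    have h := (integrable_inv_one_add_sq.comp_div ht.ne').const_mul (1 / (Real.pi * t))
    refine h.congr (ae_of_all _ fun x => ?_)
    change 1 / (Real.pi * t) * (1 + (x / t) ^ 2)⁻¹ = t / Real.pi / (t ^ 2 + x ^ 2)
    field_simp
  have hinv := congrFun (hcont.fourierInv_fourier_eq hint hFi) (r / (2 * Real.pi))
  rw [hF, Real.fourierInv_eq_fourier_neg, Real.fourier_real_eq_integral_exp_smul] at hinv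
  simp only [smul_eq_mul] at hinv
  have e1 : f (r / (2 * Real.pi)) = (Real.exp (-(t * r)) : ℂ) := by
    simp only [hf]
    rw [abs_of_nonneg (by positivity)]
    congr 2; field_simp
  rw [← e1, ← hinv]
  congr 1; ext a
  congr 4
  field_simp

/-- An antiderivative is b / (s² √(s² + b²)). This integrates out one coordinate of the Poisson
kernel and leaves the Cauchy density. -/
theorem integral_inv_sqrt_sq_add_sq_cube {s : ℝ} (hs : 0 < s)
    (hint : Integrable fun b : ℝ => (√(s ^ 2 + b ^ 2) ^ 3)⁻¹) :
    ∫ b : ℝ, (√(s ^ 2 + b ^ 2) ^ 3)⁻¹ = 2 / s ^ 2 := by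
  have hpos : ∀ b : ℝ, 0 < s ^ 2 + b ^ 2 := fun b => by positivity
  have hder : ∀ b : ℝ, HasDerivAt (fun b : ℝ => b / √(s ^ 2 + b ^ 2) / s ^ 2)
      ((√(s ^ 2 + b ^ 2) ^ 3)⁻¹) b := by
    intro b
    have h1 : HasDerivAt (fun b : ℝ => s ^ 2 + b ^ 2) (2 * b) b := by
      simpa using (hasDerivAt_pow 2 b).const_add (s ^ 2)
    have h2 := (((hasDerivAt_id b).div (h1.sqrt (hpos b).ne')
      (Real.sqrt_pos.2 (hpos b)).ne').div_const (s ^ 2))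
    refine h2.congr_deriv ?_
    have hq := Real.sq_sqrt (hpos b).le
    have hq0 := Real.sqrt_pos.2 (hpos b)
    simp only [id]
    field_simp
    rw [hq]; ring
  have htop : Tendsto (fun b : ℝ => b / √(s ^ 2 + b ^ 2)) atTop (𝓝 1) := by
    have h : Tendsto (fun b : ℝ => 1 / √((s / b) ^ 2 + 1)) atTop (𝓝 (1 / √(0 ^ 2 + 1))) := by
      have h0 : Tendsto (fun b : ℝ => s / b) atTop (𝓝 0) := tendsto_const_nhds.div_atTop tendsto_id
      have := (((h0.pow 2).add_const 1).sqrt)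
      exact tendsto_const_nhds.div this (by simp)
    simp only [ne_eq, OfNat.ofNat_ne_zero, not_false_eq_true, zero_pow, zero_add, Real.sqrt_one,
      div_one] at h
    refine h.congr' ?_
    filter_upwards [eventually_gt_atTop 0] with b hb
    have : s ^ 2 + b ^ 2 = b ^ 2 * ((s / b) ^ 2 + 1) := by field_simp
    rw [this, Real.sqrt_mul (by positivity), Real.sqrt_sq hb.le]
    field_simp
  have hbot : Tendsto (fun b : ℝ => b / √(s ^ 2 + b ^ 2)) atBot (𝓝 (-1)) := by
    have := (htop.comp tendsto_neg_atBot_atTop).neg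
    refine this.congr fun b => ?_
    simp [neg_div]
  rw [integral_of_hasDerivAt_of_tendsto hder hint (hbot.div_const _) (htop.div_const _)]
  ring

/-- The Poisson kernel of the half-space `ℝ² × (0, ∞)`. -/
noncomputable def poissonKer (t : ℝ) (z : EuclideanSpace ℝ (Fin 2)) : ℝ :=
  t / (2 * Real.pi) * (√(t ^ 2 + ‖z‖ ^ 2) ^ 3)⁻¹

theorem continuous_poissonKer {t : ℝ} (ht : 0 < t) : Continuous (poissonKer t) := by
  unfold poissonKer
  refine continuous_const.mul (Continuous.inv₀ (by fun_prop) fun z => ?_)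
  have : 0 < t ^ 2 + ‖z‖ ^ 2 := by positivity
  positivity

theorem poissonKer_pos {t : ℝ} (ht : 0 < t) (z : EuclideanSpace ℝ (Fin 2)) :
    0 < poissonKer t z := by
  have : 0 < t ^ 2 + ‖z‖ ^ 2 := by positivity
  have := Real.pi_pos
  unfold poissonKer
  positivity

theorem poissonKer_neg (t : ℝ) (z : EuclideanSpace ℝ (Fin 2)) :
    poissonKer t (-z) = poissonKer t z := by simp [poissonKer]

/-- Harnack inequality of the Poisson kernel under translations. -/
theorem poissonKer_add_le {t : ℝ} (ht : 0 < t) (z h : EuclideanSpace ℝ (Fin 2)) :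
    poissonKer t (z + h) ≤ (1 + ‖h‖ / t) ^ 3 * poissonKer t z := by
  have hpi := Real.pi_pos
  have hz : 0 < t ^ 2 + ‖z‖ ^ 2 := by positivity
  have hw : 0 < t ^ 2 + ‖z + h‖ ^ 2 := by positivity
  -- The root is the length of the vector (t, z). It changes by at most ‖h‖ under the translation,
  -- and it is at least t.
  have key : √(t ^ 2 + ‖z‖ ^ 2) ≤ (1 + ‖h‖ / t) * √(t ^ 2 + ‖z + h‖ ^ 2) := by
    have h1 : t ≤ √(t ^ 2 + ‖z + h‖ ^ 2) := by
      apply Real.le_sqrt_of_sq_le; nlinarith [sq_nonneg ‖z + h‖]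
    have h3 : ‖z + h‖ ≤ √(t ^ 2 + ‖z + h‖ ^ 2) := by
      apply Real.le_sqrt_of_sq_le; nlinarith [sq_nonneg t]
    have h2 : √(t ^ 2 + ‖z‖ ^ 2) ≤ √(t ^ 2 + ‖z + h‖ ^ 2) + ‖h‖ := by
      apply Real.sqrt_le_iff.2
      refine ⟨by positivity, ?_⟩
      have hn : ‖z‖ ≤ ‖z + h‖ + ‖h‖ := by
        simpa using norm_sub_le (z + h) h
      have hq := Real.sq_sqrt hw.le
      nlinarith [mul_le_mul_of_nonneg_right h3 (norm_nonneg h), norm_nonneg z, norm_nonneg h,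
        norm_nonneg (z + h)]
    refine h2.trans ?_
    have : ‖h‖ ≤ ‖h‖ / t * √(t ^ 2 + ‖z + h‖ ^ 2) := by
      rw [div_mul_eq_mul_div, le_div_iff₀ ht]; gcongr
    linarith
  unfold poissonKer
  have hs := Real.sqrt_pos.2 hz
  have hs' := Real.sqrt_pos.2 hw
  have k3 := pow_le_pow_left₀ hs.le key 3
  rw [mul_pow] at k3
  have : (√(t ^ 2 + ‖z + h‖ ^ 2) ^ 3)⁻¹ ≤ (1 + ‖h‖ / t) ^ 3 * (√(t ^ 2 + ‖z‖ ^ 2) ^ 3)⁻¹ := by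
    rw [← div_eq_mul_inv, inv_eq_one_div, div_le_div_iff₀ (by positivity) (by positivity)]
    linarith
  calc _ ≤ t / (2 * Real.pi) * ((1 + ‖h‖ / t) ^ 3 * (√(t ^ 2 + ‖z‖ ^ 2) ^ 3)⁻¹) := by gcongr
    _ = _ := by ring

theorem poissonKer_le_div {t : ℝ} (ht : 0 < t) (z : EuclideanSpace ℝ (Fin 2)) :
    poissonKer t z ≤ 1 / (2 * Real.pi * t ^ 2) := by
  have hpi := Real.pi_pos
  have h1 : t ≤ √(t ^ 2 + ‖z‖ ^ 2) := by
    apply Real.le_sqrt_of_sq_le; nlinarith [sq_nonneg ‖z‖]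
  unfold poissonKer
  calc _ ≤ t / (2 * Real.pi) * (t ^ 3)⁻¹ := by gcongr
    _ = _ := by field_simp

/-- The quotient `poissonKer t z / t` decreases in `t`. -/
theorem poissonKer_le_mul {s t : ℝ} (hs : 0 < s) (hst : s ≤ t) (z : EuclideanSpace ℝ (Fin 2)) :
    poissonKer t z ≤ t / s * poissonKer s z := by
  have hpi := Real.pi_pos
  have ht := hs.trans_le hst
  have hz : 0 < s ^ 2 + ‖z‖ ^ 2 := by positivity
  unfold poissonKer
  calc _ ≤ t / (2 * Real.pi) * (√(s ^ 2 + ‖z‖ ^ 2) ^ 3)⁻¹ := by gcongr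
    _ = _ := by field_simp

/-- On `EuclideanSpace ℝ (Fin 2)`, integrals are integrals over `ℝ × ℝ`. -/
theorem measurePreserving_toLp_prod :
    MeasurePreserving (fun p : ℝ × ℝ => (!₂[p.1, p.2] : EuclideanSpace ℝ (Fin 2))) := by
  have h := (PiLp.volume_preserving_toLp (Fin 2)).comp (volume_preserving_finTwoArrow ℝ).symm
  have e : (fun p : ℝ × ℝ => (!₂[p.1, p.2] : EuclideanSpace ℝ (Fin 2))) =
      WithLp.toLp 2 ∘ MeasurableEquiv.finTwoArrow.symm := by
    ext p i; fin_cases i <;> rfl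
  rw [e]
  exact h

theorem measurableEmbedding_toLp_prod :
    MeasurableEmbedding (fun p : ℝ × ℝ => (!₂[p.1, p.2] : EuclideanSpace ℝ (Fin 2))) := by
  have h := ((MeasurableEquiv.finTwoArrow (α := ℝ)).symm.trans
    (MeasurableEquiv.toLp 2 (Fin 2 → ℝ))).measurableEmbedding
  have e : (fun p : ℝ × ℝ => (!₂[p.1, p.2] : EuclideanSpace ℝ (Fin 2))) =
      ((MeasurableEquiv.finTwoArrow (α := ℝ)).symm.trans
        (MeasurableEquiv.toLp 2 (Fin 2 → ℝ))) := by
    ext p i; fin_cases i <;> rfl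
  rw [e]
  exact h

theorem integrable_poissonKer {t : ℝ} (ht : 0 < t) : Integrable (poissonKer t) := by
  have hpi := Real.pi_pos
  have h := (integrable_rpow_neg_one_add_norm_sq (E := EuclideanSpace ℝ (Fin 2)) (r := 3)
    (μ := volume) (by simp; norm_num))
  set m := min 1 t with hm
  have hm0 : 0 < m := lt_min one_pos ht
  refine (h.const_mul (t / (2 * Real.pi) * (m ^ 3)⁻¹)).mono'
    (continuous_poissonKer ht).aestronglyMeasurable (ae_of_all _ fun z => ?_)
  rw [Real.norm_of_nonneg (poissonKer_pos ht z).le]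
  have hz : (0:ℝ) < 1 + ‖z‖ ^ 2 := by positivity
  have e1 : ((1 + ‖z‖ ^ 2) : ℝ) ^ (-(3:ℝ) / 2) = (√(1 + ‖z‖ ^ 2) ^ 3)⁻¹ := by
    rw [Real.sqrt_eq_rpow, ← Real.rpow_natCast _ 3, ← Real.rpow_mul hz.le, ← Real.rpow_neg hz.le]
    norm_num
  have key : m * √(1 + ‖z‖ ^ 2) ≤ √(t ^ 2 + ‖z‖ ^ 2) := by
    apply Real.le_sqrt_of_sq_le
    rw [mul_pow, Real.sq_sqrt hz.le]
    have a1 : m ≤ 1 := min_le_left _ _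
    have a2 : m ≤ t := min_le_right _ _
    have b1 : m ^ 2 ≤ 1 := by nlinarith
    have b2 : m ^ 2 ≤ t ^ 2 := by nlinarith
    nlinarith [sq_nonneg ‖z‖]
  rw [e1]
  unfold poissonKer
  rw [mul_assoc, ← mul_inv, ← mul_pow]
  have := Real.sqrt_pos.2 hz
  gcongr

theorem poissonKer_toLp (t a b : ℝ) :
    poissonKer t !₂[a, b] = t / (2 * Real.pi) * (√((t ^ 2 + a ^ 2) + b ^ 2) ^ 3)⁻¹ := by
  unfold poissonKer
  rw [EuclideanSpace.norm_sq_eq]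
  simp [add_assoc]

/-- The marginal of the Poisson kernel is the Cauchy density. -/
theorem integral_exp_mul_poissonKer {t : ℝ} (ht : 0 < t) {r : ℝ} (hr : 0 ≤ r) :
    ∫ z : EuclideanSpace ℝ (Fin 2), Complex.exp ((r * z 0 : ℝ) * Complex.I) * (poissonKer t z : ℂ)
      = (Real.exp (-(t * r)) : ℂ) := by
  have hpi := Real.pi_pos
  have hint2 : Integrable (fun p : ℝ × ℝ => poissonKer t !₂[p.1, p.2]) :=
    (measurePreserving_toLp_prod.integrable_comp_emb measurableEmbedding_toLp_prod).2
      (integrable_poissonKer ht)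
  have hint3 : Integrable (fun p : ℝ × ℝ => Complex.exp ((r * p.1 : ℝ) * Complex.I) *
      (poissonKer t !₂[p.1, p.2] : ℂ)) := by
    refine hint2.norm.mono' ?_ (ae_of_all _ fun p => ?_)
    · exact (Continuous.aestronglyMeasurable (by fun_prop)).mul
        (Complex.continuous_ofReal.comp_aestronglyMeasurable hint2.aestronglyMeasurable)
    · rw [norm_mul, Complex.norm_exp_ofReal_mul_I, one_mul, Complex.norm_real]
  rw [← measurePreserving_toLp_prod.integral_comp measurableEmbedding_toLp_prod]
  simp only [Matrix.cons_val_zero]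
  rw [Measure.volume_eq_prod] at hint3 hint2 ⊢
  rw [integral_prod _ hint3, ← integral_exp_mul_cauchy ht hr]
  refine integral_congr_ae ?_
  filter_upwards [hint2.prod_right_ae] with a ha
  rw [integral_const_mul, integral_complex_ofReal]
  congr 2
  have hs : 0 < t ^ 2 + a ^ 2 := by positivity
  have hss := Real.sq_sqrt hs.le
  simp only [poissonKer_toLp] at ha ⊢
  rw [integral_const_mul, ← hss]
  rw [← hss, integrable_const_mul_iff (by simp; positivity)] at ha
  rw [integral_inv_sqrt_sq_add_sq_cube (Real.sqrt_pos.2 hs) ha, hss]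
  field_simp

/-- The probability measure with the Poisson kernel as density. -/
noncomputable def poissonMeas (t : ℝ) : Measure (EuclideanSpace ℝ (Fin 2)) :=
  volume.withDensity fun z => ENNReal.ofReal (poissonKer t z)

theorem integral_poissonMeas {F : Type*} [NormedAddCommGroup F] [NormedSpace ℝ F] {t : ℝ}
    (ht : 0 < t) (φ : EuclideanSpace ℝ (Fin 2) → F) :
    ∫ z, φ z ∂poissonMeas t = ∫ z, poissonKer t z • φ z := by
  rw [poissonMeas, integral_withDensity_eq_integral_toReal_smul
    (continuous_poissonKer ht).measurable.ennreal_ofReal (by simp)]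
  simp [ENNReal.toReal_ofReal (poissonKer_pos ht _).le]

theorem integral_poissonKer {t : ℝ} (ht : 0 < t) : ∫ z, poissonKer t z = 1 := by
  have h := integral_exp_mul_poissonKer ht le_rfl
  simp only [zero_mul, Complex.ofReal_zero, Complex.exp_zero, one_mul, mul_zero, neg_zero,
    Real.exp_zero, integral_complex_ofReal] at h
  exact_mod_cast h

theorem isProbabilityMeasure_poissonMeas {t : ℝ} (ht : 0 < t) :
    IsProbabilityMeasure (poissonMeas t) := by
  constructor
  rw [poissonMeas, withDensity_apply _ MeasurableSet.univ, setLIntegral_univ,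
    ← ofReal_integral_eq_lintegral_ofReal (integrable_poissonKer ht)
      (ae_of_all _ fun z => (poissonKer_pos ht z).le), integral_poissonKer ht, ENNReal.ofReal_one]

/-- A reflection moves ξ to the first axis, where only the Cauchy marginal matters. The exponent is
linear in t, which is the semigroup law. -/
theorem charFun_poissonMeas {t : ℝ} (ht : 0 < t) (ξ : EuclideanSpace ℝ (Fin 2)) :
    charFun (poissonMeas t) ξ = (Real.exp (-(t * ‖ξ‖)) : ℂ) := by
  set ξ' : EuclideanSpace ℝ (Fin 2) := EuclideanSpace.single 0 ‖ξ‖ with hξ'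
  have hn : ‖ξ'‖ = ‖ξ‖ := by simp [hξ']
  obtain ⟨e, he⟩ : ∃ e : EuclideanSpace ℝ (Fin 2) ≃ₗᵢ[ℝ] EuclideanSpace ℝ (Fin 2), e ξ' = ξ :=
    ⟨_, Submodule.reflection_sub hn⟩
  rw [charFun_apply, integral_poissonMeas ht, ← integral_exp_mul_poissonKer ht (norm_nonneg ξ),
    ← e.measurePreserving.integral_comp e.toHomeomorph.measurableEmbedding]
  congr 1; ext z
  have h1 : inner ℝ (e z) ξ = ‖ξ‖ * z 0 := by
    rw [← he, e.inner_map_map, hξ', EuclideanSpace.inner_single_right]; simp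
  have h2 : poissonKer t (e z) = poissonKer t z := by simp [poissonKer]
  rw [h1, h2, Complex.real_smul, mul_comm]

/-- The Poisson kernels form a convolution semigroup. -/
theorem poissonMeas_conv {s t : ℝ} (hs : 0 < s) (ht : 0 < t) :
    poissonMeas s ∗ poissonMeas t = poissonMeas (s + t) := by
  have := isProbabilityMeasure_poissonMeas hs
  have := isProbabilityMeasure_poissonMeas ht
  have := isProbabilityMeasure_poissonMeas (add_pos hs ht)
  refine Measure.ext_of_charFun ?_
  ext ξ
  rw [charFun_conv, charFun_poissonMeas hs, charFun_poissonMeas ht,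
    charFun_poissonMeas (add_pos hs ht), ← Complex.ofReal_mul, ← Real.exp_add]
  congr 2; ring

/-! ### Averages against the Poisson kernel. -/

/-- The Poisson average `∫ v (x + z) P_t(z) dz`. -/
noncomputable def poissonAvg (t : ℝ) (v : EuclideanSpace ℝ (Fin 2) → ℝ)
    (x : EuclideanSpace ℝ (Fin 2)) : ℝ :=
  ∫ z, v (x + z) ∂poissonMeas t

section poissonAvg

variable {v w : EuclideanSpace ℝ (Fin 2) → ℝ} {t B : ℝ}

theorem Measurable.integrable_of_abs_le {α : Type*} [MeasurableSpace α] {μ : Measure α}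
    [IsFiniteMeasure μ] {f : α → ℝ} (hf : Measurable f) (hb : ∀ x, |f x| ≤ B) :
    Integrable f μ :=
  (integrable_const B).mono' hf.aestronglyMeasurable (ae_of_all _ hb)

theorem integrable_poissonMeas (ht : 0 < t) (hv : Measurable v) (hb : ∀ x, |v x| ≤ B)
    (x : EuclideanSpace ℝ (Fin 2)) : Integrable (fun z => v (x + z)) (poissonMeas t) := by
  have := isProbabilityMeasure_poissonMeas ht
  exact Measurable.integrable_of_abs_le (hv.comp (measurable_const_add x)) fun z => hb _

theorem poissonAvg_eq_integral_mul_comp_add (ht : 0 < t) (x : EuclideanSpace ℝ (Fin 2)) :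
    poissonAvg t v x = ∫ z, poissonKer t z * v (x + z) := by
  simp [poissonAvg, integral_poissonMeas ht]

theorem poissonAvg_eq_integral_sub (ht : 0 < t) (x : EuclideanSpace ℝ (Fin 2)) :
    poissonAvg t v x = ∫ y, poissonKer t (y - x) * v y := by
  rw [poissonAvg_eq_integral_mul_comp_add ht,
    ← integral_add_left_eq_self (fun y => poissonKer t (y - x) * v y) x]
  simp

theorem integrable_poissonKer_mul (ht : 0 < t) (hv : Measurable v) (hb : ∀ x, |v x| ≤ B)
    (x : EuclideanSpace ℝ (Fin 2)) : Integrable fun y => poissonKer t (y - x) * v y :=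
  ((integrable_poissonKer ht).comp_sub_right x).mul_bdd (c := B) hv.aestronglyMeasurable
    (ae_of_all _ hb)

theorem poissonAvg_const (ht : 0 < t) (c : ℝ) (x : EuclideanSpace ℝ (Fin 2)) :
    poissonAvg t (fun _ => c) x = c := by
  have := isProbabilityMeasure_poissonMeas ht
  simp [poissonAvg]

theorem poissonAvg_mono {B' : ℝ} (ht : 0 < t) (hv : Measurable v) (hb : ∀ x, |v x| ≤ B)
    (hw : Measurable w) (hb' : ∀ x, |w x| ≤ B') (h : ∀ x, v x ≤ w x)
    (x : EuclideanSpace ℝ (Fin 2)) : poissonAvg t v x ≤ poissonAvg t w x :=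
  integral_mono (integrable_poissonMeas ht hv hb x) (integrable_poissonMeas ht hw hb' x)
    fun _ => h _

theorem poissonAvg_nonneg (h : ∀ x, 0 ≤ v x) (x : EuclideanSpace ℝ (Fin 2)) :
    0 ≤ poissonAvg t v x := integral_nonneg fun _ => h _

theorem poissonAvg_le {c : ℝ} (ht : 0 < t) (hv : Measurable v) (hb : ∀ x, |v x| ≤ B)
    (h : ∀ x, v x ≤ c) (x : EuclideanSpace ℝ (Fin 2)) : poissonAvg t v x ≤ c := by
  rw [← poissonAvg_const ht c x]
  exact poissonAvg_mono ht hv hb measurable_const (B' := |c|) (fun _ => le_rfl) h x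

theorem abs_poissonAvg_le (ht : 0 < t) (hb : ∀ x, |v x| ≤ B) (x : EuclideanSpace ℝ (Fin 2)) :
    |poissonAvg t v x| ≤ B := by
  have := isProbabilityMeasure_poissonMeas ht
  have h := norm_integral_le_of_norm_le_const (μ := poissonMeas t) (C := B)
    (f := fun z => v (x + z)) (ae_of_all _ fun z => hb (x + z))
  simpa [poissonAvg] using h

theorem poissonAvg_add {B' : ℝ} (ht : 0 < t) (hv : Measurable v) (hb : ∀ x, |v x| ≤ B)
    (hw : Measurable w) (hb' : ∀ x, |w x| ≤ B') (x : EuclideanSpace ℝ (Fin 2)) :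
    poissonAvg t (fun y => v y + w y) x = poissonAvg t v x + poissonAvg t w x :=
  integral_add (integrable_poissonMeas ht hv hb x) (integrable_poissonMeas ht hw hb' x)

theorem poissonAvg_sub {B' : ℝ} (ht : 0 < t) (hv : Measurable v) (hb : ∀ x, |v x| ≤ B)
    (hw : Measurable w) (hb' : ∀ x, |w x| ≤ B') (x : EuclideanSpace ℝ (Fin 2)) :
    poissonAvg t (fun y => v y - w y) x = poissonAvg t v x - poissonAvg t w x :=
  integral_sub (integrable_poissonMeas ht hv hb x) (integrable_poissonMeas ht hw hb' x)

theorem poissonAvg_const_mul (c : ℝ) (x : EuclideanSpace ℝ (Fin 2)) :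
    poissonAvg t (fun y => c * v y) x = c * poissonAvg t v x :=
  integral_const_mul _ _

theorem poissonAvg_le_integral (ht : 0 < t) (hv : Integrable v) (h0 : ∀ x, 0 ≤ v x)
    (x : EuclideanSpace ℝ (Fin 2)) :
    poissonAvg t v x ≤ 1 / (2 * Real.pi * t ^ 2) * ∫ y, v y := by
  rw [poissonAvg_eq_integral_sub ht, ← integral_const_mul]
  refine integral_mono_of_nonneg
    (ae_of_all _ fun y => mul_nonneg (poissonKer_pos ht _).le (h0 y)) (hv.const_mul _)
    (ae_of_all _ fun y => mul_le_mul_of_nonneg_right (poissonKer_le_div ht _) (h0 y))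

/-- Poisson averages of nonnegative functions satisfy a Harnack inequality. -/
theorem poissonAvg_add_le (ht : 0 < t) (hv : Measurable v) (hb : ∀ x, |v x| ≤ B)
    (h0 : ∀ x, 0 ≤ v x) (x h : EuclideanSpace ℝ (Fin 2)) :
    poissonAvg t v (x + h) ≤ (1 + ‖h‖ / t) ^ 3 * poissonAvg t v x := by
  rw [poissonAvg_eq_integral_sub ht, poissonAvg_eq_integral_sub ht, ← integral_const_mul]
  refine integral_mono (integrable_poissonKer_mul ht hv hb _)
    ((integrable_poissonKer_mul ht hv hb _).const_mul _) fun y => ?_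
  have := poissonKer_add_le ht (y - x) (-h)
  rw [norm_neg] at this
  have e : y - (x + h) = y - x + -h := by abel
  simp only [e]
  rw [← mul_assoc]
  exact mul_le_mul_of_nonneg_right this (h0 y)

/-- The Harnack inequality becomes a modulus of continuity that depends on t alone, whatever the
regularity of v. -/
theorem poissonAvg_sub_le_of_mem_Icc (ht : 0 < t) (hv : Measurable v) (h0 : ∀ x, 0 ≤ v x)
    (h1 : ∀ x, v x ≤ 1) (x h : EuclideanSpace ℝ (Fin 2)) :
    poissonAvg t v (x + h) - poissonAvg t v x ≤ (1 + ‖h‖ / t) ^ 3 - 1 := by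
  have hb : ∀ x, |v x| ≤ 1 := fun x => abs_le.2 ⟨by linarith [h0 x], h1 x⟩
  have a := poissonAvg_add_le ht hv hb h0 x h
  have b := poissonAvg_le ht hv hb h1 x
  have c : 1 ≤ (1 + ‖h‖ / t) ^ 3 := one_le_pow₀ (by simp; positivity)
  nlinarith

theorem abs_poissonAvg_sub_le_of_mem_Icc (ht : 0 < t) (hv : Measurable v) (h0 : ∀ x, 0 ≤ v x)
    (h1 : ∀ x, v x ≤ 1) (x y : EuclideanSpace ℝ (Fin 2)) :
    |poissonAvg t v x - poissonAvg t v y| ≤ (1 + ‖x - y‖ / t) ^ 3 - 1 := by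
  rw [abs_sub_le_iff]
  constructor
  · simpa using poissonAvg_sub_le_of_mem_Icc ht hv h0 h1 y (x - y)
  · rw [norm_sub_rev]
    simpa using poissonAvg_sub_le_of_mem_Icc ht hv h0 h1 x (y - x)

theorem continuous_poissonAvg_of_mem_Icc (ht : 0 < t) (hv : Measurable v) (h0 : ∀ x, 0 ≤ v x)
    (h1 : ∀ x, v x ≤ 1) : Continuous (poissonAvg t v) := by
  rw [continuous_iff_continuousAt]
  intro x
  rw [ContinuousAt, tendsto_iff_dist_tendsto_zero]
  have hc : Tendsto (fun y => (1 + ‖y - x‖ / t) ^ 3 - 1) (𝓝 x) (𝓝 ((1 + ‖x - x‖ / t) ^ 3 - 1)) :=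
    Continuous.tendsto (by fun_prop) x
  simp only [sub_self, norm_zero, zero_div, add_zero, one_pow] at hc
  exact squeeze_zero (fun _ => dist_nonneg)
    (fun y => by rw [Real.dist_eq]; exact abs_poissonAvg_sub_le_of_mem_Icc ht hv h0 h1 y x) hc

theorem continuous_poissonAvg (ht : 0 < t) (hv : Measurable v) (hb : ∀ x, |v x| ≤ B) :
    Continuous (poissonAvg t v) := by
  have hB : 0 ≤ B := (abs_nonneg _).trans (hb 0)
  -- An affine change brings the values into [0, 1]; the summand 1 keeps the denominator positive
  -- when B = 0.
  set v' : EuclideanSpace ℝ (Fin 2) → ℝ := fun x => (v x + B) / (2 * B + 1) with hv'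
  have hc : Continuous (poissonAvg t v') := by
    refine continuous_poissonAvg_of_mem_Icc ht ((hv.add_const B).div_const _) (fun x => ?_)
      (fun x => ?_)
    · have := (abs_le.1 (hb x)).1
      exact div_nonneg (by linarith) (by linarith)
    · have := (abs_le.1 (hb x)).2
      exact div_le_one_of_le₀ (by linarith) (by linarith)
  have hm' : Measurable v' := (hv.add_const B).div_const _
  have : poissonAvg t v = fun x => (2 * B + 1) * poissonAvg t v' x + -B := by
    ext x
    have e : v = fun x => (2 * B + 1) * v' x + -B := by
      ext y; simp only [hv']; field_simp; ring
    conv_lhs => rw [e]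
    rw [poissonAvg_add (v := fun x => (2 * B + 1) * v' x) (w := fun _ => -B) (B := 2 * B)
      (B' := B) ht (hm'.const_mul _) (fun y => ?_) measurable_const (fun y => ?_),
      poissonAvg_const ht, poissonAvg_const_mul]
    · have : (2 * B + 1) * v' y = v y + B := by simp only [hv']; field_simp
      simp only [this]
      have := abs_le.1 (hb y)
      exact abs_le.2 ⟨by linarith, by linarith⟩
    · rw [abs_neg, abs_of_nonneg hB]
  rw [this]
  fun_prop

theorem poissonAvg_poissonAvg {s : ℝ} (hs : 0 < s) (ht : 0 < t) (hv : Measurable v)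
    (hb : ∀ x, |v x| ≤ B) (x : EuclideanSpace ℝ (Fin 2)) :
    poissonAvg s (poissonAvg t v) x = poissonAvg (s + t) v x := by
  have := isProbabilityMeasure_poissonMeas hs
  have := isProbabilityMeasure_poissonMeas ht
  have := isProbabilityMeasure_poissonMeas (add_pos hs ht)
  conv_rhs => rw [poissonAvg, ← poissonMeas_conv hs ht]
  rw [integral_conv]
  · simp [poissonAvg, add_assoc]
  · exact Measurable.integrable_of_abs_le (hv.comp (measurable_const_add x)) fun z => hb _

theorem integrable_mul_poissonKer_prod (ht : 0 < t) (hv : Measurable v) (hb : ∀ x, |v x| ≤ B)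
    (hw : Integrable w) :
    Integrable (fun p : EuclideanSpace ℝ (Fin 2) × EuclideanSpace ℝ (Fin 2) =>
      w p.1 * v (p.1 + p.2)) (volume.prod (poissonMeas t)) := by
  have := isProbabilityMeasure_poissonMeas ht
  have h1 : Integrable (fun p : EuclideanSpace ℝ (Fin 2) × EuclideanSpace ℝ (Fin 2) => w p.1)
      (volume.prod (poissonMeas t)) := by
    simpa using hw.mul_prod (integrable_const (1:ℝ) (μ := poissonMeas t))
  exact h1.mul_bdd (c := B) (hv.comp (by fun_prop)).aestronglyMeasurable
    (ae_of_all _ fun p => hb _)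

theorem integral_mul_poissonAvg_eq (ht : 0 < t) (hv : Measurable v) (hb : ∀ x, |v x| ≤ B)
    (hw : Integrable w) :
    ∫ x, w x * poissonAvg t v x = ∫ z, (∫ x, w x * v (x + z)) ∂poissonMeas t := by
  have := isProbabilityMeasure_poissonMeas ht
  rw [← integral_integral_swap (f := fun x z => w x * v (x + z))
    (integrable_mul_poissonKer_prod ht hv hb hw)]
  simp [poissonAvg, integral_const_mul]

theorem integral_comp_neg_poissonMeas (ht : 0 < t) (φ : EuclideanSpace ℝ (Fin 2) → ℝ) :
    ∫ z, φ (-z) ∂poissonMeas t = ∫ z, φ z ∂poissonMeas t := by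
  rw [integral_poissonMeas ht, integral_poissonMeas ht,
    ← integral_neg_eq_self (fun z => poissonKer t z • φ z)]
  simp [poissonKer_neg]

/-- Poisson averaging is symmetric. -/
theorem integral_mul_poissonAvg_comm {B' : ℝ} (ht : 0 < t) (hv : Measurable v)
    (hb : ∀ x, |v x| ≤ B) (hvi : Integrable v) (hw : Measurable w) (hb' : ∀ x, |w x| ≤ B')
    (hwi : Integrable w) :
    ∫ x, w x * poissonAvg t v x = ∫ x, v x * poissonAvg t w x := by
  rw [integral_mul_poissonAvg_eq ht hv hb hwi, integral_mul_poissonAvg_eq ht hw hb' hvi,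
    ← integral_comp_neg_poissonMeas ht]
  congr 1; ext z
  rw [← integral_add_right_eq_self (fun x => w x * v (x + -z)) z]
  simp [mul_comm]

theorem integrable_poissonAvg (ht : 0 < t) (hv : Measurable v)
    (hvi : Integrable v) : Integrable (poissonAvg t v) := by
  have := isProbabilityMeasure_poissonMeas ht
  have hm : Measurable fun p : EuclideanSpace ℝ (Fin 2) × EuclideanSpace ℝ (Fin 2) =>
    v (p.1 + p.2) := hv.comp (by fun_prop)
  have h : Integrable (fun p : EuclideanSpace ℝ (Fin 2) × EuclideanSpace ℝ (Fin 2) =>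
      v (p.1 + p.2)) (volume.prod (poissonMeas t)) := by
    rw [integrable_prod_iff' hm.aestronglyMeasurable]
    refine ⟨ae_of_all _ fun z => hvi.comp_add_right z, ?_⟩
    simp only
    simp_rw [integral_add_right_eq_self (fun x => ‖v x‖)]
    exact integrable_const _
  exact h.integral_prod_left

theorem poissonAvg_comp_isometry (ht : 0 < t)
    (e : EuclideanSpace ℝ (Fin 2) ≃ₗᵢ[ℝ] EuclideanSpace ℝ (Fin 2))
    (h : ∀ x, v (e x) = v x) (x : EuclideanSpace ℝ (Fin 2)) :
    poissonAvg t v (e x) = poissonAvg t v x := by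
  rw [poissonAvg_eq_integral_mul_comp_add ht, poissonAvg_eq_integral_mul_comp_add ht,
    ← e.measurePreserving.integral_comp e.toHomeomorph.measurableEmbedding]
  congr 1; ext z
  rw [← map_add, h]
  simp [poissonKer]

end poissonAvg

theorem abs_poissonKer_le {r : ℝ} (hr : 0 < r) (x : EuclideanSpace ℝ (Fin 2)) :
    |poissonKer r x| ≤ 1 / (2 * Real.pi * r ^ 2) := by
  rw [abs_of_pos (poissonKer_pos hr x)]
  exact poissonKer_le_div hr x

/-- The semigroup law is available for averages of bounded functions. Symmetry of averaging
transfers it to the kernels tested against smooth functions, and continuity upgrades equality almost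
everywhere to equality. -/
theorem poissonAvg_poissonKer {s r : ℝ} (hs : 0 < s) (hr : 0 < r)
    (x : EuclideanSpace ℝ (Fin 2)) : poissonAvg s (poissonKer r) x = poissonKer (r + s) x := by
  have hrm := (continuous_poissonKer hr).measurable
  have hc : Continuous (poissonAvg s (poissonKer r)) :=
    continuous_poissonAvg hs hrm (abs_poissonKer_le hr)
  refine congrFun ((hc.ae_eq_iff_eq volume (continuous_poissonKer (add_pos hr hs))).1 ?_) x
  refine ae_eq_of_integral_contDiff_smul_eq hc.locallyIntegrable
    (continuous_poissonKer (add_pos hr hs)).locallyIntegrable fun φ hφ hφc => ?_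
  have hφi := hφ.continuous.integrable_of_hasCompactSupport (μ := volume) hφc
  obtain ⟨B, hB⟩ := hφc.exists_bound_of_continuous hφ.continuous
  have hm := hφ.continuous.measurable
  simp only [smul_eq_mul]
  rw [integral_mul_poissonAvg_comm hs hrm (abs_poissonKer_le hr) (integrable_poissonKer hr) hm hB
    hφi]
  have e1 := poissonAvg_eq_integral_mul_comp_add (v := poissonAvg s φ) hr 0
  have e2 := poissonAvg_eq_integral_mul_comp_add (v := φ) (add_pos hr hs) 0
  simp only [zero_add] at e1 e2
  rw [← e1, poissonAvg_poissonAvg hr hs hm hB, e2]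
  simp [mul_comm]

/-- Poisson kernels are supersolutions with a small factor. -/
theorem poissonAvg_poissonKer_le {s r : ℝ} (hs : 0 < s) (hr : 0 < r)
    (x : EuclideanSpace ℝ (Fin 2)) :
    poissonAvg s (poissonKer r) x ≤ (1 + s / r) * poissonKer r x := by
  rw [poissonAvg_poissonKer hs hr]
  refine (poissonKer_le_mul hr (by linarith) x).trans_eq ?_
  field_simp

/-! ### The half-Laplacian as an integral of second differences, and its Poisson approximation. -/

/-- The symmetric second difference `w (x + z) + w (x - z) - 2 w x`. -/
def secondDiff (w : EuclideanSpace ℝ (Fin 2) → ℝ) (x z : EuclideanSpace ℝ (Fin 2)) : ℝ :=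
  w (x + z) + w (x - z) - 2 * w x

/-- The integral `∫ (w (x + z) + w (x - z) - 2 w x) / (2 |z|³) dz`, which is the principal value
`P.V. ∫ (w y - w x) / |y - x|³ dy` for regular `w`. -/
noncomputable def halfLap (w : EuclideanSpace ℝ (Fin 2) → ℝ) (x : EuclideanSpace ℝ (Fin 2)) : ℝ :=
  ∫ z, secondDiff w x z / (2 * ‖z‖ ^ 3)

theorem measurable_secondDiff {w : EuclideanSpace ℝ (Fin 2) → ℝ} (hw : Measurable w)
    (x : EuclideanSpace ℝ (Fin 2)) : Measurable (secondDiff w x) := by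
  unfold secondDiff
  exact ((hw.comp (by fun_prop)).add (hw.comp (by fun_prop))).sub_const _

/-- In polar coordinates the integrand is constant near 0 and of order r⁻² at infinity. This is the
majorant for every half-Laplacian below. -/
theorem integrable_min_sq_one_div_cube :
    Integrable fun z : EuclideanSpace ℝ (Fin 2) => min (‖z‖ ^ 2) 1 / (2 * ‖z‖ ^ 3) := by
  rw [integrable_fun_norm_addHaar volume (f := fun r : ℝ => min (r ^ 2) 1 / (2 * r ^ 3))]
  simp only [finrank_euclideanSpace, Fintype.card_fin, Nat.add_one_sub_one, pow_one, smul_eq_mul]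
  rw [← Ioc_union_Ioi_eq_Ioi (zero_le_one' ℝ)]
  refine IntegrableOn.union ?_ ?_
  · refine IntegrableOn.congr_fun (f := fun _ => (1 / 2 : ℝ)) (by simp) (fun r hr => ?_)
      measurableSet_Ioc
    have h0 : 0 < r := hr.1
    have : r ^ 2 ≤ 1 := pow_le_one₀ h0.le hr.2
    simp only [min_eq_left this]
    field_simp
  · refine IntegrableOn.congr_fun (f := fun r : ℝ => r ^ (-2 : ℝ) / 2)
      ((integrableOn_Ioi_rpow_of_lt (by norm_num) one_pos).div_const _) (fun r hr => ?_)
      measurableSet_Ioi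
    have h1 : 1 < r := hr
    have h0 : 0 < r := by linarith
    have : 1 ≤ r ^ 2 := one_le_pow₀ h1.le
    simp only [min_eq_right this]
    rw [Real.rpow_neg h0.le]
    norm_cast
    field_simp

theorem integrable_secondDiff_div {w : EuclideanSpace ℝ (Fin 2) → ℝ} (hw : Measurable w)
    {x : EuclideanSpace ℝ (Fin 2)} {C : ℝ} (h : ∀ z, |secondDiff w x z| ≤ C * min (‖z‖ ^ 2) 1) :
    Integrable fun z => secondDiff w x z / (2 * ‖z‖ ^ 3) := by
  refine (integrable_min_sq_one_div_cube.const_mul C).mono'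
    ((measurable_secondDiff hw x).div (by fun_prop)).aestronglyMeasurable
    (ae_of_all _ fun z => ?_)
  rw [Real.norm_eq_abs, abs_div, abs_of_nonneg (by positivity : (0:ℝ) ≤ 2 * ‖z‖ ^ 3),
    ← mul_div_assoc]
  exact div_le_div_of_nonneg_right (h z) (by positivity)

theorem abs_halfLap_le {w : EuclideanSpace ℝ (Fin 2) → ℝ}
    {x : EuclideanSpace ℝ (Fin 2)} {C : ℝ} (h : ∀ z, |secondDiff w x z| ≤ C * min (‖z‖ ^ 2) 1) :
    |halfLap w x| ≤ C * ∫ z : EuclideanSpace ℝ (Fin 2), min (‖z‖ ^ 2) 1 / (2 * ‖z‖ ^ 3) := by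
  rw [← integral_const_mul]
  refine norm_integral_le_of_norm_le (f := fun z => secondDiff w x z / (2 * ‖z‖ ^ 3))
    (integrable_min_sq_one_div_cube.const_mul C) (ae_of_all _ fun z => ?_)
  rw [Real.norm_eq_abs, abs_div, abs_of_nonneg (by positivity : (0:ℝ) ≤ 2 * ‖z‖ ^ 3),
    ← mul_div_assoc]
  exact div_le_div_of_nonneg_right (h z) (by positivity)

theorem halfLap_add {v w : EuclideanSpace ℝ (Fin 2) → ℝ} (hv : Measurable v) (hw : Measurable w)
    {x : EuclideanSpace ℝ (Fin 2)} {C D : ℝ}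
    (h : ∀ z, |secondDiff v x z| ≤ C * min (‖z‖ ^ 2) 1)
    (h' : ∀ z, |secondDiff w x z| ≤ D * min (‖z‖ ^ 2) 1) :
    halfLap (fun y => v y + w y) x = halfLap v x + halfLap w x := by
  unfold halfLap
  rw [← integral_add (integrable_secondDiff_div hv h) (integrable_secondDiff_div hw h')]
  congr 1; ext z
  simp only [secondDiff]
  ring

theorem halfLap_const_mul (v : EuclideanSpace ℝ (Fin 2) → ℝ) (c : ℝ)
    (x : EuclideanSpace ℝ (Fin 2)) : halfLap (fun y => c * v y) x = c * halfLap v x := by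
  unfold halfLap
  rw [← integral_const_mul]
  congr 1; ext z
  simp only [secondDiff]
  ring

theorem halfLap_const_sub (v : EuclideanSpace ℝ (Fin 2) → ℝ) (c : ℝ)
    (x : EuclideanSpace ℝ (Fin 2)) : halfLap (fun y => c - v y) x = - halfLap v x := by
  unfold halfLap
  rw [← integral_neg]
  congr 1; ext z
  simp only [secondDiff]
  ring

theorem halfLap_nonneg_of_eq_zero {v : EuclideanSpace ℝ (Fin 2) → ℝ} (h0 : ∀ y, 0 ≤ v y)
    {x : EuclideanSpace ℝ (Fin 2)} (hx : v x = 0) : 0 ≤ halfLap v x := by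
  refine integral_nonneg fun z => div_nonneg ?_ (by positivity)
  have h1 := h0 (x + z)
  have h2 := h0 (x - z)
  simp only [secondDiff, hx]
  linarith

/-- The truncated region is symmetric, so the integrand may be averaged with its reflection under z
↦ -z, which cancels the odd part. -/
theorem truncatedHalfLaplacian_eq {w : EuclideanSpace ℝ (Fin 2) → ℝ} (hw : Measurable w)
    {B : ℝ} (hB : ∀ x, |w x| ≤ B) {ε : ℝ} (hε : 0 < ε) (x : EuclideanSpace ℝ (Fin 2)) :
    truncatedHalfLaplacian w ε x =
      ∫ z, {z : EuclideanSpace ℝ (Fin 2) | ε < ‖z‖}.indicator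
        (fun z => secondDiff w x z / (2 * ‖z‖ ^ 3)) z := by
  set S := {z : EuclideanSpace ℝ (Fin 2) | ε < ‖z‖} with hS
  have hSm : MeasurableSet S := measurableSet_lt measurable_const measurable_norm
  have hSx : MeasurableSet {y : EuclideanSpace ℝ (Fin 2) | ε < ‖y - x‖} :=
    measurableSet_lt measurable_const (by fun_prop)
  set F : EuclideanSpace ℝ (Fin 2) → ℝ := S.indicator fun z => (w (x + z) - w x) / ‖z‖ ^ 3 with hF
  have hFint : Integrable F := by
    set m := min (ε ^ 2) 1
    have hm : 0 < m := lt_min (by positivity) one_pos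
    refine (integrable_min_sq_one_div_cube.const_mul (4 * B / m)).mono'
      ((((hw.comp (measurable_const_add x)).sub_const _).div (by fun_prop)).indicator
        hSm).aestronglyMeasurable (ae_of_all _ fun z => ?_)
    have hB0 : 0 ≤ B := (abs_nonneg _).trans (hB 0)
    by_cases hz : z ∈ S
    · rw [hF, indicator_of_mem hz, Real.norm_eq_abs, abs_div,
        abs_of_nonneg (by positivity : 0 ≤ ‖z‖ ^ 3)]
      have h1 : |w (x + z) - w x| ≤ 2 * B := by
        have := abs_sub (w (x + z)) (w x)
        linarith [hB (x + z), hB x]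
      have h2 : m ≤ min (‖z‖ ^ 2) 1 := by
        refine min_le_min_right _ ?_
        have : ε < ‖z‖ := hz
        gcongr
      have hz0 : 0 < ‖z‖ := hε.trans hz
      calc |w (x + z) - w x| / ‖z‖ ^ 3 ≤ 2 * B / ‖z‖ ^ 3 := by gcongr
        _ = 4 * B / m * (m / (2 * ‖z‖ ^ 3)) := by field_simp; ring
        _ ≤ _ := by gcongr
    · rw [hF, indicator_of_notMem hz, norm_zero]
      positivity
  have h1 : truncatedHalfLaplacian w ε x = ∫ z, F z := by
    rw [truncatedHalfLaplacian, ← integral_indicator hSx, ← integral_add_left_eq_self _ x]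
    congr 1; ext z
    by_cases hz : ε < ‖z‖
    · rw [hF, indicator_of_mem (show x + z ∈ {y | ε < ‖y - x‖} by simpa using hz),
        indicator_of_mem (show z ∈ S from hz)]
      simp
    · rw [hF, indicator_of_notMem (show x + z ∉ {y | ε < ‖y - x‖} by simpa using hz),
        indicator_of_notMem (show z ∉ S from hz)]
  have h2 : ∫ z, F z = ∫ z, F (-z) := (integral_neg_eq_self F volume).symm
  have h3 : ∫ z, F z = (1 / 2) * ((∫ z, F z) + ∫ z, F (-z)) := by rw [← h2]; ring
  rw [h1, h3, ← integral_add hFint hFint.comp_neg, ← integral_const_mul]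
  congr 1; ext z
  by_cases hz : ε < ‖z‖
  · rw [hF, indicator_of_mem (show z ∈ S from hz),
      indicator_of_mem (show -z ∈ S by simpa [hS] using hz), indicator_of_mem (show z ∈ S from hz)]
    simp only [secondDiff, norm_neg, ← sub_eq_add_neg]
    have : 0 < ‖z‖ := hε.trans hz
    field_simp; ring
  · rw [hF, indicator_of_notMem (show z ∉ S from hz),
      indicator_of_notMem (show -z ∉ S by simpa [hS] using hz),
      indicator_of_notMem (show z ∉ S from hz)]
    simp

theorem hasHalfLaplacianAt_of_secondDiff_le {w : EuclideanSpace ℝ (Fin 2) → ℝ} (hw : Measurable w)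
    {B : ℝ} (hB : ∀ x, |w x| ≤ B) {x : EuclideanSpace ℝ (Fin 2)} {C : ℝ}
    (h : ∀ z, |secondDiff w x z| ≤ C * min (‖z‖ ^ 2) 1) (κ : ℝ) :
    HasHalfLaplacianAt κ w x ((κ * halfLap w x : ℝ) : EReal) := by
  refine (continuous_coe_real_ereal.tendsto _).comp (Tendsto.const_mul κ ?_)
  have hint := integrable_secondDiff_div hw h
  have h0 : Tendsto (fun ε : ℝ => ∫ z, {z : EuclideanSpace ℝ (Fin 2) | ε < ‖z‖}.indicator
        (fun z => secondDiff w x z / (2 * ‖z‖ ^ 3)) z) (𝓝[>] 0) (𝓝 (halfLap w x)) := by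
    refine tendsto_integral_filter_of_dominated_convergence
      (fun z => ‖secondDiff w x z / (2 * ‖z‖ ^ 3)‖) ?_ ?_ hint.norm ?_
    · refine Eventually.of_forall fun ε => hint.aestronglyMeasurable.indicator
        (measurableSet_lt measurable_const measurable_norm)
    · exact Eventually.of_forall fun ε => ae_of_all _ fun z => norm_indicator_le_norm_self _ _
    · refine ae_of_all _ fun z => ?_
      by_cases hz : z = 0
      · subst hz
        refine tendsto_const_nhds.congr fun ε => ?_
        by_cases hε : (0 : EuclideanSpace ℝ (Fin 2)) ∈ {z : EuclideanSpace ℝ (Fin 2) | ε < ‖z‖}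
        · rw [indicator_of_mem hε]
        · rw [indicator_of_notMem hε]; simp
      · refine tendsto_const_nhds.congr' ?_
        have : ∀ᶠ ε : ℝ in 𝓝[>] 0, ε < ‖z‖ :=
          mem_nhdsWithin_of_mem_nhds (Iio_mem_nhds (norm_pos_iff.2 hz))
        filter_upwards [this] with ε hε
        rw [indicator_of_mem (show z ∈ {z : EuclideanSpace ℝ (Fin 2) | ε < ‖z‖} from hε)]
  refine h0.congr' ?_
  filter_upwards [self_mem_nhdsWithin] with ε hε
  exact (truncatedHalfLaplacian_eq hw hB hε x).symm

/-- The Poisson difference quotient as a regularised half-Laplacian. -/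
theorem poissonAvg_sub_self_eq {w : EuclideanSpace ℝ (Fin 2) → ℝ} (hw : Measurable w)
    {B : ℝ} (hB : ∀ x, |w x| ≤ B) {ε : ℝ} (hε : 0 < ε) (x : EuclideanSpace ℝ (Fin 2)) :
    2 * Real.pi / ε * (poissonAvg ε w x - w x) =
      ∫ z, secondDiff w x z / (2 * √(ε ^ 2 + ‖z‖ ^ 2) ^ 3) := by
  have := isProbabilityMeasure_poissonMeas hε
  have h1 : poissonAvg ε w x = ∫ z, w (x - z) ∂poissonMeas ε := by
    rw [poissonAvg, ← integral_comp_neg_poissonMeas hε]; simp [sub_eq_add_neg]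
  have hi1 := integrable_poissonMeas hε hw hB x
  have hi2 : Integrable (fun z => w (x - z)) (poissonMeas ε) :=
    Measurable.integrable_of_abs_le (hw.comp (measurable_const_sub x)) fun z => hB _
  have h2 : poissonAvg ε w x - w x = ∫ z, secondDiff w x z / 2 ∂poissonMeas ε := by
    unfold secondDiff
    have hi12 : Integrable (fun z => w (x + z) + w (x - z)) (poissonMeas ε) := hi1.add hi2
    rw [integral_div, integral_sub hi12 (integrable_const _), integral_add hi1 hi2, ← h1]
    simp [poissonAvg]; ring
  rw [h2, integral_poissonMeas hε, ← integral_const_mul]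
  congr 1; ext z
  have hpi := Real.pi_pos
  have : 0 < √(ε ^ 2 + ‖z‖ ^ 2) := Real.sqrt_pos.2 (by positivity)
  simp only [poissonKer, smul_eq_mul]
  field_simp

theorem inv_cube_sub_le {ε n : ℝ} (hn : 1 ≤ n) :
    1 / n ^ 3 - 1 / √(ε ^ 2 + n ^ 2) ^ 3 ≤ 3 / 2 * ε ^ 2 * (1 / n ^ 3) := by
  have hn0 : 0 < n := by linarith
  set s := √(ε ^ 2 + n ^ 2) with hs
  have hss : s ^ 2 = ε ^ 2 + n ^ 2 := Real.sq_sqrt (by positivity)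
  have hs0 : 0 < s := Real.sqrt_pos.2 (by positivity)
  have hsn : n ≤ s := Real.le_sqrt_of_sq_le (by nlinarith [sq_nonneg ε])
  have key : (s ^ 3 - n ^ 3) * 2 ≤ 3 * ε ^ 2 * s ^ 3 := by
    have e1 : ε ^ 2 = (s - n) * (s + n) := by linear_combination -hss
    rw [e1]
    have a : 0 ≤ s - n := by linarith
    have b : 2 * (s ^ 2 + s * n + n ^ 2) ≤ 3 * (s + n) * s ^ 3 := by
      have s1 : 1 ≤ s := hn.trans hsn
      have : s ^ 2 ≤ s ^ 3 := by nlinarith [sq_nonneg s]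
      have h3 : 2 * (s ^ 2 + s * n + n ^ 2) ≤ 6 * s ^ 2 := by nlinarith
      nlinarith [mul_nonneg hn0.le (sq_nonneg s)]
    nlinarith [mul_le_mul_of_nonneg_left b a]
  rw [div_sub_div _ _ (by positivity) (by positivity), mul_one_div,
    div_le_div_iff₀ (by positivity) (by positivity)]
  nlinarith [mul_le_mul_of_nonneg_right key (by positivity : (0:ℝ) ≤ n ^ 3 * n ^ 3), pow_pos hn0 3]

theorem one_div_cube_le_poissonKer {z : EuclideanSpace ℝ (Fin 2)} (hz : 1 ≤ ‖z‖) :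
    1 / ‖z‖ ^ 3 ≤ 6 * Real.pi * poissonKer 1 z := by
  have hpi := Real.pi_pos
  set s := √(1 ^ 2 + ‖z‖ ^ 2) with hs
  have hss : s ^ 2 = 1 ^ 2 + ‖z‖ ^ 2 := Real.sq_sqrt (by positivity)
  have hs0 : 0 < s := Real.sqrt_pos.2 (by positivity)
  have hz0 : 0 < ‖z‖ := by linarith
  -- The factor 1.42 exceeds √2, and its cube is below 3.
  have h1 : s ≤ 1.42 * ‖z‖ := by
    refine abs_le_of_sq_le_sq' ?_ (by positivity) |>.2
    rw [hss]; nlinarith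
  have h3 : s ^ 3 ≤ 3 * ‖z‖ ^ 3 := by
    calc s ^ 3 ≤ (1.42 * ‖z‖) ^ 3 := by gcongr
      _ = 2.863288 * ‖z‖ ^ 3 := by ring
      _ ≤ _ := by gcongr; norm_num
  have e : 6 * Real.pi * poissonKer 1 z = 3 / s ^ 3 := by
    unfold poissonKer; rw [← hs]; field_simp; ring
  rw [e, div_le_div_iff₀ (by positivity) (by positivity)]
  linarith

/-- The modulus that controls the convergence of the Poisson difference quotients. -/
noncomputable def poissonErr (ε : ℝ) : ℝ :=
  ∫ z : EuclideanSpace ℝ (Fin 2),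
    min (‖z‖ ^ 2) 1 / (2 * ‖z‖ ^ 3) - min (‖z‖ ^ 2) 1 / (2 * √(ε ^ 2 + ‖z‖ ^ 2) ^ 3)

theorem sqrt_cube_inv_le {ε n : ℝ} (hn : 0 < n) : 1 / √(ε ^ 2 + n ^ 2) ^ 3 ≤ 1 / n ^ 3 := by
  have hsn : n ≤ √(ε ^ 2 + n ^ 2) := Real.le_sqrt_of_sq_le (by nlinarith [sq_nonneg ε])
  gcongr

theorem abs_min_div_sqrt_le (ε : ℝ) (z : EuclideanSpace ℝ (Fin 2)) :
    ‖min (‖z‖ ^ 2) 1 / (2 * √(ε ^ 2 + ‖z‖ ^ 2) ^ 3)‖ ≤ min (‖z‖ ^ 2) 1 / (2 * ‖z‖ ^ 3) := by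
  have h0 : 0 ≤ min (‖z‖ ^ 2) 1 := by positivity
  rw [Real.norm_of_nonneg (by positivity)]
  by_cases hz : z = 0
  · simp [hz]
  · have hz0 : 0 < ‖z‖ := norm_pos_iff.2 hz
    have := mul_le_mul_of_nonneg_left (sqrt_cube_inv_le (ε := ε) hz0)
      (by positivity : 0 ≤ min (‖z‖ ^ 2) 1 / 2)
    calc _ = min (‖z‖ ^ 2) 1 / 2 * (1 / √(ε ^ 2 + ‖z‖ ^ 2) ^ 3) := by ring
      _ ≤ _ := this
      _ = _ := by ring

theorem measurable_min_div_sqrt (ε : ℝ) : Measurable fun z : EuclideanSpace ℝ (Fin 2) =>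
    min (‖z‖ ^ 2) 1 / (2 * √(ε ^ 2 + ‖z‖ ^ 2) ^ 3) := by fun_prop

theorem integrable_min_div_sqrt (ε : ℝ) : Integrable fun z : EuclideanSpace ℝ (Fin 2) =>
    min (‖z‖ ^ 2) 1 / (2 * √(ε ^ 2 + ‖z‖ ^ 2) ^ 3) :=
  integrable_min_sq_one_div_cube.mono' (measurable_min_div_sqrt ε).aestronglyMeasurable
    (ae_of_all _ (abs_min_div_sqrt_le ε))

theorem tendsto_poissonErr : Tendsto poissonErr (𝓝[>] 0) (𝓝 0) := by
  have h : Tendsto (fun ε : ℝ => ∫ z : EuclideanSpace ℝ (Fin 2),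
      min (‖z‖ ^ 2) 1 / (2 * √(ε ^ 2 + ‖z‖ ^ 2) ^ 3)) (𝓝[>] 0)
      (𝓝 (∫ z : EuclideanSpace ℝ (Fin 2), min (‖z‖ ^ 2) 1 / (2 * ‖z‖ ^ 3))) := by
    refine tendsto_integral_filter_of_dominated_convergence
      (fun z => min (‖z‖ ^ 2) 1 / (2 * ‖z‖ ^ 3))
      (Eventually.of_forall fun ε => (measurable_min_div_sqrt ε).aestronglyMeasurable)
      (Eventually.of_forall fun ε => ae_of_all _ (abs_min_div_sqrt_le ε))
      integrable_min_sq_one_div_cube (ae_of_all _ fun z => ?_)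
    by_cases hz : z = 0
    · simp [hz]
    · have hz0 : 0 < ‖z‖ := norm_pos_iff.2 hz
      have : Tendsto (fun ε : ℝ => min (‖z‖ ^ 2) 1 / (2 * √(ε ^ 2 + ‖z‖ ^ 2) ^ 3)) (𝓝 0)
          (𝓝 (min (‖z‖ ^ 2) 1 / (2 * √(0 ^ 2 + ‖z‖ ^ 2) ^ 3))) := by
        refine tendsto_const_nhds.div (Continuous.tendsto (by fun_prop) 0) ?_
        have : 0 < √(0 ^ 2 + ‖z‖ ^ 2) := Real.sqrt_pos.2 (by positivity)
        positivity
      rw [zero_pow two_ne_zero, zero_add, Real.sqrt_sq hz0.le] at this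
      exact this.mono_left nhdsWithin_le_nhds
  have h2 := (tendsto_const_nhds (x := ∫ z : EuclideanSpace ℝ (Fin 2),
    min (‖z‖ ^ 2) 1 / (2 * ‖z‖ ^ 3)) (f := 𝓝[>] (0:ℝ))).sub h
  rw [sub_self] at h2
  refine h2.congr fun ε => ?_
  rw [poissonErr, integral_sub integrable_min_sq_one_div_cube (integrable_min_div_sqrt ε)]

/-- Quantitative convergence of the Poisson difference quotients to the half-Laplacian. -/
theorem halfLap_le_poissonAvg_add {w : EuclideanSpace ℝ (Fin 2) → ℝ} (hw : Measurable w)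
    {M C : ℝ} (h0 : ∀ x, 0 ≤ w x) (hM : ∀ x, w x ≤ M * poissonKer 1 x)
    {x : EuclideanSpace ℝ (Fin 2)}
    (h : ∀ z, |secondDiff w x z| ≤ C * min (‖z‖ ^ 2) 1)
    (hx : ∀ z, ‖z‖ ≤ 1 → |secondDiff w x z| ≤ C * poissonKer 1 x * ‖z‖ ^ 2)
    {ε : ℝ} (hε : 0 < ε) :
    halfLap w x ≤ 2 * Real.pi / ε * (poissonAvg ε w x - w x) +
      (C * poissonErr ε + 27 * Real.pi * M * ε ^ 2) * poissonKer 1 x := by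
  have hpi := Real.pi_pos
  have hM0 : 0 ≤ M := by
    have := (h0 0).trans (hM 0)
    exact nonneg_of_mul_nonneg_left this (poissonKer_pos one_pos _)
  have hB : ∀ x, |w x| ≤ M * (1 / (2 * Real.pi * 1 ^ 2)) := fun x => by
    rw [abs_of_nonneg (h0 x)]
    exact (hM x).trans (mul_le_mul_of_nonneg_left (poissonKer_le_div one_pos x) hM0)
  have hC0 : 0 ≤ C := by
    have := (abs_nonneg _).trans (h (EuclideanSpace.single 0 1))
    simpa using this
  set p := poissonKer 1 with hp
  have hpp : ∀ z, 0 < p z := poissonKer_pos one_pos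
  -- This function dominates the contribution of ‖z‖ > 1. Its integral is at most 6 P₁(x), because
  -- P₁ convolved with itself is P₂ ≤ 2 P₁; hence 27 = 6 · 9/2 in the error term.
  set a : EuclideanSpace ℝ (Fin 2) → ℝ := fun z => p z * (p (x + z) + p (x - z) + 2 * p x) with ha
  have hpi1 : Integrable p := integrable_poissonKer one_pos
  have hpm : Measurable p := (continuous_poissonKer one_pos).measurable
  have hi1 : Integrable fun z => p z * p (x + z) := by
    refine hpi1.mul_bdd (c := 1 / (2 * Real.pi * 1 ^ 2))
      (hpm.comp (measurable_const_add x)).aestronglyMeasurable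
      (ae_of_all _ fun z => abs_poissonKer_le one_pos _)
  have hi2 : Integrable fun z => p z * p (x - z) := by
    refine hpi1.mul_bdd (c := 1 / (2 * Real.pi * 1 ^ 2))
      (hpm.comp (measurable_const_sub x)).aestronglyMeasurable
      (ae_of_all _ fun z => abs_poissonKer_le one_pos _)
  have hi3 : Integrable fun z => p z * (2 * p x) := hpi1.mul_const _
  have hai : Integrable a := by
    refine ((hi1.add hi2).add hi3).congr (ae_of_all _ fun z => ?_)
    simp only [ha, Pi.add_apply]; ring
  have hv1 : ∫ z, p z * p (x + z) ≤ 2 * p x := by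
    rw [← poissonAvg_eq_integral_mul_comp_add one_pos]
    refine (poissonAvg_poissonKer_le one_pos one_pos x).trans_eq (by norm_num [hp])
  have hv2 : ∫ z, p z * p (x - z) ≤ 2 * p x := by
    rw [← integral_neg_eq_self]
    refine le_trans (le_of_eq ?_) hv1
    congr 1; ext z; simp [hp, poissonKer_neg]
  have hv3 : ∫ z, p z * (2 * p x) = 2 * p x := by
    rw [integral_mul_const, hp, integral_poissonKer one_pos, one_mul]
  have hav : ∫ z, a z ≤ 6 * p x := by
    have : ∫ z, a z = (∫ z, p z * p (x + z)) + (∫ z, p z * p (x - z)) + ∫ z, p z * (2 * p x) := by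
      have hi12 : Integrable fun z => p z * p (x + z) + p z * p (x - z) := hi1.add hi2
      rw [← integral_add hi1 hi2, ← integral_add hi12 hi3]
      congr 1; ext z; simp only [ha]; ring
    rw [this, hv3]; linarith
  have hint1 := integrable_secondDiff_div hw h
  have hint2 : Integrable fun z => secondDiff w x z / (2 * √(ε ^ 2 + ‖z‖ ^ 2) ^ 3) := by
    refine hint1.norm.mono' ((measurable_secondDiff hw x).div
      (by fun_prop)).aestronglyMeasurable (ae_of_all _ fun z => ?_)
    by_cases hz : z = 0
    · simp [hz, secondDiff]; ring_nf; simp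
    · have hz0 : 0 < ‖z‖ := norm_pos_iff.2 hz
      have hsn : ‖z‖ ≤ √(ε ^ 2 + ‖z‖ ^ 2) := Real.le_sqrt_of_sq_le (by nlinarith [sq_nonneg ε])
      simp only [Real.norm_eq_abs, abs_div]
      rw [abs_of_nonneg (by positivity : (0:ℝ) ≤ 2 * ‖z‖ ^ 3),
        abs_of_nonneg (by positivity : (0:ℝ) ≤ 2 * √(ε ^ 2 + ‖z‖ ^ 2) ^ 3)]
      gcongr
  have hbound : ∀ z, secondDiff w x z / (2 * ‖z‖ ^ 3) -
      secondDiff w x z / (2 * √(ε ^ 2 + ‖z‖ ^ 2) ^ 3) ≤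
      C * p x * (min (‖z‖ ^ 2) 1 / (2 * ‖z‖ ^ 3) -
        min (‖z‖ ^ 2) 1 / (2 * √(ε ^ 2 + ‖z‖ ^ 2) ^ 3)) + 9 / 2 * Real.pi * M * ε ^ 2 * a z := by
    intro z
    have ha0 : 0 ≤ a z := by
      have := hpp z; have := hpp (x + z); have := hpp (x - z); have := hpp x
      simp only [ha]; positivity
    by_cases hz : z = 0
    · subst hz
      simp only [norm_zero, ne_eq, OfNat.ofNat_ne_zero, not_false_eq_true, zero_pow, mul_zero,
        div_zero, zero_sub, add_zero]
      have e : secondDiff w x 0 = 0 := by simp [secondDiff]; ring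
      rw [e, min_eq_left zero_le_one]
      simp only [zero_div, neg_zero, mul_zero, zero_add]
      positivity
    have hz0 : 0 < ‖z‖ := norm_pos_iff.2 hz
    set N := 1 / ‖z‖ ^ 3 - 1 / √(ε ^ 2 + ‖z‖ ^ 2) ^ 3 with hN
    have hN0 : 0 ≤ N := sub_nonneg.2 (sqrt_cube_inv_le hz0)
    have e1 : secondDiff w x z / (2 * ‖z‖ ^ 3) -
      secondDiff w x z / (2 * √(ε ^ 2 + ‖z‖ ^ 2) ^ 3) = secondDiff w x z * N / 2 := by
      rw [hN]; ring
    have e2 : min (‖z‖ ^ 2) 1 / (2 * ‖z‖ ^ 3) -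
        min (‖z‖ ^ 2) 1 / (2 * √(ε ^ 2 + ‖z‖ ^ 2) ^ 3) = min (‖z‖ ^ 2) 1 * N / 2 := by
      rw [hN]; ring
    rw [e1, e2]
    -- For small z the second difference is quadratic with a coefficient proportional to P₁(x). For
    -- large z the two kernels differ by O(ε²) P₁(z), and the decay of w bounds the second
    -- difference. Both errors are thus proportional to P₁(x), which the source term can absorb.
    rcases le_or_gt ‖z‖ 1 with h1 | h1
    · have hm : min (‖z‖ ^ 2) 1 = ‖z‖ ^ 2 := min_eq_left (pow_le_one₀ hz0.le h1)
      rw [hm]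
      have := mul_le_mul_of_nonneg_right ((le_abs_self _).trans (hx z h1)) hN0
      have h9 : 0 ≤ 9 / 2 * Real.pi * M * ε ^ 2 * a z := by positivity
      nlinarith
    · have hNb : N ≤ 3 / 2 * ε ^ 2 * (6 * Real.pi * p z) :=
        (inv_cube_sub_le h1.le).trans
          (mul_le_mul_of_nonneg_left (one_div_cube_le_poissonKer h1.le) (by positivity))
      have hs : secondDiff w x z ≤ M * (p (x + z) + p (x - z) + 2 * p x) := by
        have a1 := hM (x + z); have a2 := hM (x - z); have a3 := h0 x
        have a4 := mul_nonneg hM0 (hpp x).le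
        simp only [secondDiff]; nlinarith
      have hq : 0 ≤ M * (p (x + z) + p (x - z) + 2 * p x) := by
        have := hpp (x + z); have := hpp (x - z); have := hpp x
        positivity
      have hm0 : 0 ≤ C * p x * (min (‖z‖ ^ 2) 1 * N / 2) := by
        have := hpp x; positivity
      have : secondDiff w x z * N ≤ M * (p (x + z) + p (x - z) + 2 * p x) *
          (3 / 2 * ε ^ 2 * (6 * Real.pi * p z)) :=
        (mul_le_mul_of_nonneg_right hs hN0).trans (mul_le_mul_of_nonneg_left hNb hq)
      have e3 : M * (p (x + z) + p (x - z) + 2 * p x) * (3 / 2 * ε ^ 2 * (6 * Real.pi * p z)) =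
          2 * (9 / 2 * Real.pi * M * ε ^ 2 * a z) := by simp only [ha]; ring
      linarith
  have hIe : Integrable fun z : EuclideanSpace ℝ (Fin 2) => min (‖z‖ ^ 2) 1 / (2 * ‖z‖ ^ 3) -
        min (‖z‖ ^ 2) 1 / (2 * √(ε ^ 2 + ‖z‖ ^ 2) ^ 3) :=
    integrable_min_sq_one_div_cube.sub (integrable_min_div_sqrt ε)
  have hfin := integral_mono (hint1.sub hint2)
    ((hIe.const_mul (C * p x)).add (hai.const_mul (9 / 2 * Real.pi * M * ε ^ 2))) hbound
  simp only [Pi.add_apply, Pi.sub_apply] at hfin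
  rw [integral_sub hint1 hint2, integral_add (hIe.const_mul (C * p x))
    (hai.const_mul (9 / 2 * Real.pi * M * ε ^ 2)), integral_const_mul, integral_const_mul] at hfin
  rw [poissonAvg_sub_self_eq hw hB hε, halfLap]
  have := mul_le_mul_of_nonneg_left hav (by positivity : 0 ≤ 9 / 2 * Real.pi * M * ε ^ 2)
  unfold poissonErr
  nlinarith

/-- The regularised kernel lies below the singular one, so the bound does not depend on ε. -/
theorem abs_poissonAvg_sub_self_le {w : EuclideanSpace ℝ (Fin 2) → ℝ} (hw : Measurable w)
    {B : ℝ} (hB : ∀ x, |w x| ≤ B) {x : EuclideanSpace ℝ (Fin 2)} {C : ℝ}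
    (h : ∀ z, |secondDiff w x z| ≤ C * min (‖z‖ ^ 2) 1) {ε : ℝ} (hε : 0 < ε) :
    |2 * Real.pi / ε * (poissonAvg ε w x - w x)| ≤
      C * ∫ z : EuclideanSpace ℝ (Fin 2), min (‖z‖ ^ 2) 1 / (2 * ‖z‖ ^ 3) := by
  have hC0 : 0 ≤ C := by
    have := (abs_nonneg _).trans (h (EuclideanSpace.single 0 1))
    simpa using this
  rw [poissonAvg_sub_self_eq hw hB hε, ← integral_const_mul]
  refine norm_integral_le_of_norm_le
    (f := fun z => secondDiff w x z / (2 * √(ε ^ 2 + ‖z‖ ^ 2) ^ 3))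
    (integrable_min_sq_one_div_cube.const_mul C) (ae_of_all _ fun z => ?_)
  refine le_trans ?_ (mul_le_mul_of_nonneg_left (abs_min_div_sqrt_le ε z) hC0)
  rw [Real.norm_eq_abs, Real.norm_eq_abs, abs_div, abs_div,
    abs_of_nonneg (by positivity : (0:ℝ) ≤ min (‖z‖ ^ 2) 1), ← mul_div_assoc]
  exact div_le_div_of_nonneg_right (h z) (abs_nonneg _)

/-- Second differences of compactly supported `C²` functions. -/
theorem exists_secondDiff_le_of_hasCompactSupport {f : EuclideanSpace ℝ (Fin 2) → ℝ}
    (hf : ContDiff ℝ 2 f) (hc : HasCompactSupport f) :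
    ∃ C : ℝ, 0 ≤ C ∧ ∀ x z, |secondDiff f x z| ≤ C * min (‖z‖ ^ 2) 1 := by
  obtain ⟨L, hL⟩ := ContDiff.lipschitzWith_of_hasCompactSupport (hc.fderiv (𝕜 := ℝ))
    (hf.fderiv_right (m := 1) (by norm_num)) (by simp)
  obtain ⟨B, hB⟩ := hc.exists_bound_of_continuous hf.continuous
  have hB0 : 0 ≤ B := (norm_nonneg _).trans (hB 0)
  have key : ∀ x z, |secondDiff f x z| ≤ 2 * L * ‖z‖ ^ 2 := by
    intro x z
    -- The derivative of s ↦ f(x + sz) + f(x - sz) is a difference of gradients at distance 2s‖z‖,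
    -- applied to z; Lipschitz continuity of the gradient makes it O(‖z‖²).
    have hd : ∀ s ∈ Icc (0:ℝ) 1, HasDerivWithinAt (fun s : ℝ => f (x + s • z) + f (x - s • z))
        (fderiv ℝ f (x + s • z) z + fderiv ℝ f (x - s • z) (-z)) (Icc 0 1) s := by
      intro s _
      have hdf := hf.differentiable (by norm_num)
      have h1 : HasDerivAt (fun s : ℝ => x + s • z) z s := by
        simpa using ((hasDerivAt_id s).smul_const z).const_add x
      have h2 : HasDerivAt (fun s : ℝ => x - s • z) (-z) s := by
        simpa using ((hasDerivAt_id s).smul_const z).const_sub x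
      exact (((hdf _).hasFDerivAt.comp_hasDerivAt s h1).add
        ((hdf _).hasFDerivAt.comp_hasDerivAt s h2)).hasDerivWithinAt
    have hb : ∀ s ∈ Ico (0:ℝ) 1,
        ‖fderiv ℝ f (x + s • z) z + fderiv ℝ f (x - s • z) (-z)‖ ≤ 2 * L * ‖z‖ ^ 2 := by
      intro s hs
      have e : fderiv ℝ f (x + s • z) z + fderiv ℝ f (x - s • z) (-z) =
        (fderiv ℝ f (x + s • z) - fderiv ℝ f (x - s • z)) z := by simp [sub_eq_add_neg]
      rw [e]
      refine (ContinuousLinearMap.le_opNorm _ _).trans ?_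
      have h1 := hL.dist_le_mul (x + s • z) (x - s • z)
      rw [dist_eq_norm, dist_eq_norm] at h1
      have e2 : x + s • z - (x - s • z) = (2 * s) • z := by module
      rw [e2, norm_smul, Real.norm_of_nonneg (by linarith [hs.1])] at h1
      have h3 : 2 * s * ‖z‖ ≤ 2 * ‖z‖ := by nlinarith [norm_nonneg z, hs.2]
      calc _ ≤ (L * (2 * s * ‖z‖)) * ‖z‖ := by gcongr
        _ ≤ (L * (2 * ‖z‖)) * ‖z‖ := by gcongr
        _ = _ := by ring
    have := norm_image_sub_le_of_norm_deriv_le_segment_01' hd hb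
    simp only [one_smul, zero_smul, add_zero, sub_zero, Real.norm_eq_abs] at this
    convert this using 2
    simp only [secondDiff]; ring
  refine ⟨2 * L + 4 * B, by positivity, fun x z => ?_⟩
  rcases le_total (‖z‖ ^ 2) 1 with h | h
  · rw [min_eq_left h]
    refine (key x z).trans ?_
    gcongr; linarith
  · rw [min_eq_right h]
    have h1 := abs_le.1 (hB (x + z)); have h2 := abs_le.1 (hB (x - z)); have h3 := abs_le.1 (hB x)
    have : (0:ℝ) ≤ L := L.2
    refine abs_le.2 ⟨?_, ?_⟩ <;> simp only [secondDiff] <;>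
      linarith [h1.1, h1.2, h2.1, h2.2, h3.1, h3.2]

/-! ### Quadratic forms of the Poisson difference quotients. -/

section quadraticForm

variable {v : EuclideanSpace ℝ (Fin 2) → ℝ} {t : ℝ}

theorem integrable_mul_comp_add {B : ℝ} (hv : Measurable v) (hb : ∀ x, |v x| ≤ B)
    (hvi : Integrable v) (z : EuclideanSpace ℝ (Fin 2)) : Integrable fun x => v x * v (x + z) :=
  hvi.mul_bdd (c := B) (hv.comp (measurable_add_const z)).aestronglyMeasurable
    (ae_of_all _ fun _ => hb _)

theorem integrable_sq_of_bdd {B : ℝ} (hv : Measurable v) (hb : ∀ x, |v x| ≤ B)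
    (hvi : Integrable v) : Integrable fun x => v x ^ 2 := by
  simpa [sq] using integrable_mul_comp_add hv hb hvi 0

theorem integral_sq_sub_comp_add_eq {B : ℝ} (hv : Measurable v) (hb : ∀ x, |v x| ≤ B)
    (hvi : Integrable v) (z : EuclideanSpace ℝ (Fin 2)) :
    ∫ x, (v (x + z) - v x) ^ 2 = 2 * (∫ x, v x ^ 2) - 2 * ∫ x, v x * v (x + z) := by
  have h2 := integrable_sq_of_bdd hv hb hvi
  have h3 := h2.comp_add_right z
  have h4 := (integrable_mul_comp_add hv hb hvi z).const_mul 2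
  have h5 : Integrable fun x => v (x + z) ^ 2 + v x ^ 2 := h3.add h2
  have e : (fun x => (v (x + z) - v x) ^ 2) =
      fun x => (v (x + z) ^ 2 + v x ^ 2) - 2 * (v x * v (x + z)) := by
    ext x; ring
  rw [e, integral_sub h5 h4, integral_add h3 h2,
    integral_add_right_eq_self (fun x => v x ^ 2), integral_const_mul]
  ring

theorem measurable_integral_mul_comp_add (hv : Measurable v) :
    Measurable fun z => ∫ x, v x * v (x + z) := by
  have : Measurable fun p : EuclideanSpace ℝ (Fin 2) × EuclideanSpace ℝ (Fin 2) =>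
      v p.2 * v (p.2 + p.1) := (hv.comp measurable_snd).mul (hv.comp (by fun_prop))
  exact this.stronglyMeasurable.integral_prod_right.measurable

/-- The quadratic form of the Poisson difference quotient as a double integral. -/
theorem integral_sq_sub_integral_mul_poissonAvg (ht : 0 < t) {B : ℝ} (hv : Measurable v)
    (hb : ∀ x, |v x| ≤ B) (hvi : Integrable v) :
    (∫ x, v x ^ 2) - ∫ x, v x * poissonAvg t v x =
      1 / 2 * ∫ z, (∫ x, (v (x + z) - v x) ^ 2) ∂poissonMeas t := by
  have := isProbabilityMeasure_poissonMeas ht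
  have hr := (integrable_mul_poissonKer_prod ht hv hb hvi).integral_prod_right
  simp only [integral_sq_sub_comp_add_eq hv hb hvi]
  rw [integral_sub (integrable_const _) (hr.const_mul 2), integral_const, probReal_univ, one_smul,
    integral_const_mul (2:ℝ), integral_mul_poissonAvg_eq ht hv hb hvi]
  ring

theorem integral_sq_sub_integral_mul_poissonAvg_nonneg (ht : 0 < t) {B : ℝ} (hv : Measurable v)
    (hb : ∀ x, |v x| ≤ B) (hvi : Integrable v) :
    0 ≤ (∫ x, v x ^ 2) - ∫ x, v x * poissonAvg t v x := by
  rw [integral_sq_sub_integral_mul_poissonAvg ht hv hb hvi]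
  have : 0 ≤ ∫ z, (∫ x, (v (x + z) - v x) ^ 2) ∂poissonMeas t :=
    integral_nonneg fun z => integral_nonneg fun x => sq_nonneg _
  linarith

/-- The quadratic forms decrease under contractions and, after division by the scale, in the
scale. -/
theorem quadraticForm_comp_le {s B : ℝ} (hs : 0 < s) (hst : s ≤ t) (hv : Measurable v)
    (hb : ∀ x, |v x| ≤ B) (hvi : Integrable v) {ψ : EuclideanSpace ℝ (Fin 2) → ℝ}
    (hψ : Measurable ψ) (hψb : ∀ x, |ψ x| ≤ |v x|)
    (hψv : ∀ x y, |ψ x - ψ y| ≤ |v x - v y|) :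
    (∫ x, ψ x ^ 2) - ∫ x, ψ x * poissonAvg t ψ x ≤
      t / s * ((∫ x, v x ^ 2) - ∫ x, v x * poissonAvg s v x) := by
  have ht := hs.trans_le hst
  have hψi : Integrable ψ := hvi.mono hψ.aestronglyMeasurable (ae_of_all _ hψb)
  have hψB : ∀ x, |ψ x| ≤ B := fun x => (hψb x).trans (hb x)
  rw [integral_sq_sub_integral_mul_poissonAvg ht hψ hψB hψi,
    integral_sq_sub_integral_mul_poissonAvg hs hv hb hvi,
    integral_poissonMeas ht, integral_poissonMeas hs]
  have hB0 : 0 ≤ B := (abs_nonneg _).trans (hb 0)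
  have hmeas : ∀ u : EuclideanSpace ℝ (Fin 2) → ℝ, Measurable u → (∀ x, |u x| ≤ B) →
      Integrable u → ∀ r : ℝ, 0 < r →
      Integrable fun z => poissonKer r z • ∫ x, (u (x + z) - u x) ^ 2 := by
    intro u hu hub hui r hr
    refine (integrable_poissonKer hr).mul_bdd (c := 4 * ∫ x, u x ^ 2) ?_ (ae_of_all _ fun z => ?_)
    · simp only [integral_sq_sub_comp_add_eq hu hub hui]
      exact (((measurable_integral_mul_comp_add hu).const_mul 2).const_sub _).aestronglyMeasurable
    · have h2 := integrable_sq_of_bdd hu hub hui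
      rw [Real.norm_of_nonneg (integral_nonneg fun x => sq_nonneg _)]
      have h3 : Integrable fun x => 2 * u (x + z) ^ 2 + 2 * u x ^ 2 :=
        ((h2.comp_add_right z).const_mul 2).add (h2.const_mul 2)
      calc ∫ x, (u (x + z) - u x) ^ 2 ≤ ∫ x, (2 * u (x + z) ^ 2 + 2 * u x ^ 2) := by
            refine integral_mono_of_nonneg (ae_of_all _ fun x => sq_nonneg _) h3
              (ae_of_all _ fun x => ?_)
            simp only
            nlinarith [sq_nonneg (u (x + z) + u x)]
        _ = _ := by
            rw [integral_add ((h2.comp_add_right z).const_mul 2) (h2.const_mul 2),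
              integral_const_mul, integral_const_mul,
              integral_add_right_eq_self (fun x => u x ^ 2)]
            ring
  have hle : ∫ z, poissonKer t z • (∫ x, (ψ (x + z) - ψ x) ^ 2) ≤
      t / s * ∫ z, poissonKer s z • ∫ x, (v (x + z) - v x) ^ 2 := by
    rw [← integral_const_mul]
    refine integral_mono (hmeas ψ hψ hψB hψi t ht) ((hmeas v hv hb hvi s hs).const_mul _)
      fun z => ?_
    simp only [smul_eq_mul]
    rw [← mul_assoc]
    have h2 := integrable_sq_of_bdd hv hb hvi
    have hi : Integrable fun x => (v (x + z) - v x) ^ 2 := by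
      have h4 := (integrable_mul_comp_add hv hb hvi z).const_mul 2
      refine (((h2.comp_add_right z).add h2).sub h4).congr (ae_of_all _ fun x => ?_)
      simp only [Pi.add_apply, Pi.sub_apply]; ring
    refine mul_le_mul (poissonKer_le_mul hs hst z) ?_ (integral_nonneg fun x => sq_nonneg _)
      (mul_nonneg (by positivity) (poissonKer_pos hs z).le)
    exact integral_mono_of_nonneg (ae_of_all _ fun x => sq_nonneg _) hi
      (ae_of_all _ fun x => sq_le_sq.2 (hψv _ _))
  linarith

end quadraticForm

/-! ### Layer potentials and the nonlocal isoperimetric estimate. -/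

/-- A potential `V` with derivative `f` and wells of equal depth at `0` and `1`. -/
structure IsLayerPotential (V f : ℝ → ℝ) (Λ c : ℝ) : Prop where
  hasDerivAt : ∀ s, HasDerivAt V (f s) s
  lipschitz : ∀ a b, |f a - f b| ≤ Λ * |a - b|
  deriv_zero : f 0 = 0
  deriv_one : f 1 = 0
  map_zero : V 0 = 0
  pos_lip : 0 < Λ
  pos_coer : 0 < c
  coercive : ∀ s ∈ Icc (0:ℝ) 1, c * min s (1 - s) ^ 2 ≤ V s

namespace IsLayerPotential

variable {V f : ℝ → ℝ} {Λ c : ℝ} (hV : IsLayerPotential V f Λ c)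
include hV

theorem continuous_deriv : Continuous f := by
  have : LipschitzWith Λ.toNNReal f := LipschitzWith.of_dist_le_mul fun a b => by
    rw [Real.coe_toNNReal _ hV.pos_lip.le]; exact hV.lipschitz a b
  exact this.continuous

theorem continuous : Continuous V :=
  continuous_iff_continuousAt.2 fun s => (hV.hasDerivAt s).continuousAt

theorem nonneg {s : ℝ} (hs : s ∈ Icc (0:ℝ) 1) : 0 ≤ V s :=
  (mul_nonneg hV.pos_coer.le (sq_nonneg _)).trans (hV.coercive s hs)

theorem monotone_sub : Monotone fun s => Λ * s - f s := by
  intro a b hab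
  have := (abs_le.1 (hV.lipschitz b a)).2
  rw [abs_of_nonneg (sub_nonneg.2 hab)] at this
  simp only
  linarith

theorem sub_le {a b : ℝ} (hab : a ≤ b) : V b - V a ≤ f a * (b - a) + Λ * (b - a) ^ 2 := by
  rcases hab.eq_or_lt with rfl | h
  · simp
  obtain ⟨ξ, hξ, he⟩ := exists_hasDerivAt_eq_slope V f h hV.continuous.continuousOn
    fun x _ => hV.hasDerivAt x
  have hba : 0 < b - a := by linarith
  rw [eq_div_iff hba.ne'] at he
  have h1 := (abs_le.1 (hV.lipschitz ξ a)).2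
  rw [abs_of_pos (by linarith [hξ.1])] at h1
  have h2 : f ξ ≤ f a + Λ * (b - a) := by nlinarith [hV.pos_lip, hξ.2]
  nlinarith

theorem le_sq {s : ℝ} (hs : 0 ≤ s) : V s ≤ Λ * s ^ 2 := by
  have := hV.sub_le hs
  rw [hV.map_zero, hV.deriv_zero] at this
  linarith

theorem integrable_comp {v : EuclideanSpace ℝ (Fin 2) → ℝ} (hv : Measurable v)
    (h0 : ∀ x, 0 ≤ v x) (h1 : ∀ x, v x ≤ 1) (hvi : Integrable v) :
    Integrable fun x => V (v x) := by
  have hb : ∀ x, |v x| ≤ 1 := fun x => abs_le.2 ⟨by linarith [h0 x], h1 x⟩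
  refine ((integrable_sq_of_bdd hv hb hvi).const_mul Λ).mono'
    (hV.continuous.measurable.comp hv).aestronglyMeasurable (ae_of_all _ fun x => ?_)
  rw [Real.norm_of_nonneg (hV.nonneg ⟨h0 x, h1 x⟩)]
  exact hV.le_sq (h0 x)

/-- A nonlocal isoperimetric estimate: bounded energy bounds the measure of the set where the
phase `0` is left. -/
theorem volume_real_lt_le {v : EuclideanSpace ℝ (Fin 2) → ℝ} (hv : Measurable v)
    (h0 : ∀ x, 0 ≤ v x) (h1 : ∀ x, v x ≤ 1) (hvi : Integrable v) {ε k N s : ℝ} (hε : 0 < ε)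
    (hε1 : ε ≤ 1) (hk : 0 < k)
    (hN1 : k / ε / 2 * ((∫ x, v x ^ 2) - ∫ x, v x * poissonAvg ε v x) ≤ N)
    (hN2 : ∫ x, V (v x) ≤ N) (hs : 0 < s) (hs4 : s ≤ 1 / 4) :
    volume.real {x | s < v x} ≤ 4 * (N / (c * s ^ 2)) + 4 * (8 * N / k) + 16 * (8 * N / k) ^ 2 := by
  have hc := hV.pos_coer
  have hb : ∀ x, |v x| ≤ 1 := fun x => abs_le.2 ⟨by linarith [h0 x], h1 x⟩
  have hfin : ∀ r : ℝ, 0 < r → volume {x | r < v x} ≠ ⊤ := fun r hr =>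
    (hvi.measure_gt_lt_top hr).ne
  have hN0 : 0 ≤ N := (integral_nonneg fun x => hV.nonneg ⟨h0 x, h1 x⟩).trans hN2
  set m := volume.real {x | s < v x} with hm
  have hm0 : 0 ≤ m := measureReal_nonneg
  -- Since 4m ≤ h², averaging at scale h spreads the mass of ψ, which is at most m, down to height
  -- at most 1/8.
  set h := 1 + 2 * √m with hh
  have hsq : √m ^ 2 = m := Real.sq_sqrt hm0
  have hsq0 := Real.sqrt_nonneg m
  have hh1 : 1 ≤ h := by linarith
  have hpi := Real.pi_gt_three
  -- Truncation is a contraction, so it does not increase the form; ψ lives on the set of measure m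
  -- and is at least 1/2 where v > 3/4.
  set ψ : EuclideanSpace ℝ (Fin 2) → ℝ := fun x => max (v x - s) 0 with hψ
  have hψm : Measurable ψ := (hv.sub_const s).max measurable_const
  have hψ0 : ∀ x, 0 ≤ ψ x := fun x => le_max_right _ _
  have hψv : ∀ x, ψ x ≤ v x := fun x => max_le (by linarith) (h0 x)
  have hψi : Integrable ψ := hvi.mono' hψm.aestronglyMeasurable (ae_of_all _ fun x => by
    rw [Real.norm_of_nonneg (hψ0 x)]; exact hψv x)
  have hform := quadraticForm_comp_le hε (hε1.trans hh1) hv hb hvi hψm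
    (fun x => by rw [abs_of_nonneg (hψ0 x), abs_of_nonneg (h0 x)]; exact hψv x)
    (fun x y => by
      have := abs_max_sub_max_le_abs (v x - s) (v y - s) 0
      simpa using this)
  have hψint : ∫ x, ψ x ≤ m := by
    have hms : MeasurableSet {x | s < v x} := measurableSet_lt measurable_const hv
    rw [hm, ← integral_indicator_one hms]
    refine integral_mono hψi ((integrable_indicator_iff hms).2
      (integrableOn_const (hfin s hs))) fun x => ?_
    by_cases hx : s < v x
    · rw [indicator_of_mem (show x ∈ {x | s < v x} from hx)]
      exact (hψv x).trans (h1 x)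
    · rw [indicator_of_notMem (show x ∉ {x | s < v x} from hx)]
      simp only [hψ]; rw [max_eq_right (by linarith)]
  have hψint0 : 0 ≤ ∫ x, ψ x := integral_nonneg hψ0
  have hP : ∫ x, ψ x * poissonAvg h ψ x ≤ m / 8 := by
    have hh0 : 0 < h := by linarith
    have hpt : ∀ x, ψ x * poissonAvg h ψ x ≤ ψ x * (1 / 8) := by
      intro x
      refine mul_le_mul_of_nonneg_left ((poissonAvg_le_integral hh0 hψi hψ0 x).trans ?_) (hψ0 x)
      have : 4 * m ≤ h ^ 2 := by rw [hh]; nlinarith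
      rw [one_div_mul_eq_div, div_le_div_iff₀ (by positivity) (by norm_num)]
      nlinarith [sq_nonneg h]
    calc _ ≤ ∫ x, ψ x * (1 / 8) := integral_mono_of_nonneg
            (ae_of_all _ fun x => mul_nonneg (hψ0 x) (poissonAvg_nonneg hψ0 x))
            (hψi.mul_const _) (ae_of_all _ hpt)
      _ = (∫ x, ψ x) * (1 / 8) := integral_mul_const _ _
      _ ≤ m / 8 := by linarith
  have hA : 1 / 4 * volume.real {x | 3 / 4 < v x} ≤ ∫ x, ψ x ^ 2 := by
    have hψ2 := integrable_sq_of_bdd hψm (B := 1) (fun x => by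
      rw [abs_of_nonneg (hψ0 x)]; exact (hψv x).trans (h1 x)) hψi
    have := mul_meas_ge_le_integral_of_nonneg (ae_of_all _ fun x => sq_nonneg (ψ x)) hψ2 (1 / 4)
    refine le_trans (mul_le_mul_of_nonneg_left (measureReal_mono (fun x hx => ?_) ?_)
      (by norm_num)) this
    · have hx' : 3 / 4 < v x := hx
      have : 1 / 2 ≤ ψ x := le_max_of_le_left (by linarith)
      change 1 / 4 ≤ ψ x ^ 2
      nlinarith
    · exact (hψ2.measure_ge_lt_top (by norm_num)).ne
  have hD : c * s ^ 2 * volume.real {x | s < v x ∧ v x ≤ 3 / 4} ≤ N := by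
    have hVi := hV.integrable_comp hv h0 h1 hvi
    have := mul_meas_ge_le_integral_of_nonneg
      (ae_of_all _ fun x => hV.nonneg ⟨h0 x, h1 x⟩) hVi (c * s ^ 2)
    refine le_trans (mul_le_mul_of_nonneg_left (measureReal_mono (fun x hx => ?_) ?_)
      (by positivity)) (this.trans hN2)
    · obtain ⟨hx1, hx2⟩ := hx
      refine le_trans ?_ (hV.coercive _ ⟨h0 x, h1 x⟩)
      have : s ≤ min (v x) (1 - v x) := le_min hx1.le (by linarith)
      gcongr
    · exact (hVi.measure_ge_lt_top (by positivity)).ne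
  have hsum : m ≤ volume.real {x | s < v x ∧ v x ≤ 3 / 4} + volume.real {x | 3 / 4 < v x} := by
    refine le_trans (measureReal_mono (fun x hx => ?_) ?_) (measureReal_union_le _ _)
    · rcases le_or_gt (v x) (3 / 4) with h | h
      · exact Or.inl ⟨hx, h⟩
      · exact Or.inr h
    · refine (measure_union_lt_top ((measure_mono fun x hx => hx.1).trans_lt
        (hvi.measure_gt_lt_top hs)) (hvi.measure_gt_lt_top (by norm_num))).ne
  -- Passing from scale ε to scale h multiplies the form by at most h/ε, so its contribution is
  -- O(N(1 + √m)), sublinear in m. This is what closes the estimate.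
  have hQ : (∫ x, ψ x ^ 2) ≤ 2 * N / k * h + m / 8 := by
    have e1 : h / ε * ((∫ x, v x ^ 2) - ∫ x, v x * poissonAvg ε v x) =
        2 / k * h * (k / ε / 2 * ((∫ x, v x ^ 2) - ∫ x, v x * poissonAvg ε v x)) := by
      field_simp
    have e2 : 2 / k * h * (k / ε / 2 * ((∫ x, v x ^ 2) - ∫ x, v x * poissonAvg ε v x)) ≤
        2 / k * h * N := by
      have : 0 < h := by linarith
      gcongr
    have e3 : 2 / k * h * N = 2 * N / k * h := by ring
    linarith
  set α := N / (c * s ^ 2) with hα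
  set β := 8 * N / k with hβ
  have hD' : volume.real {x | s < v x ∧ v x ≤ 3 / 4} ≤ α := by
    rw [hα, le_div_iff₀ (by positivity)]; linarith
  have e4 : 2 * N / k * h = β / 4 * (1 + 2 * √m) := by rw [hβ, hh]; ring
  have hβ0 : 0 ≤ β := by positivity
  -- The inequalities combine to m/2 ≤ α + β + 2β√m, and the square absorbs the root.
  nlinarith [sq_nonneg (√m - 4 * β)]

end IsLayerPotential

/-! ### Monotone projected descent for the layer energy. -/

/-- One step of the projected gradient descent for the layer energy, in the order interval
`[φ, 1]`. -/
noncomputable def layerStep (f : ℝ → ℝ) (Λ q η ε : ℝ) (φ v : EuclideanSpace ℝ (Fin 2) → ℝ)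
    (x : EuclideanSpace ℝ (Fin 2)) : ℝ :=
  min 1 (max (φ x)
    ((Λ * v x - f (v x) + q * poissonAvg ε v x + η * poissonKer 1 x) / (Λ + q)))

/-- The energy whose gradient descent is `layerStep`. -/
noncomputable def layerEnergy (V : ℝ → ℝ) (q η ε : ℝ) (v : EuclideanSpace ℝ (Fin 2) → ℝ) : ℝ :=
  q / 2 * ((∫ x, v x ^ 2) - ∫ x, v x * poissonAvg ε v x) + (∫ x, V (v x)) -
    η * ∫ x, poissonKer 1 x * v x

/-- The functions between `φ` and `1` on which the descent takes place. -/
structure IsLayerState (φ v : EuclideanSpace ℝ (Fin 2) → ℝ) : Prop where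
  continuous : Continuous v
  nonneg : ∀ x, 0 ≤ v x
  le_one : ∀ x, v x ≤ 1
  integrable : Integrable v
  isometry : ∀ (e : EuclideanSpace ℝ (Fin 2) ≃ₗᵢ[ℝ] EuclideanSpace ℝ (Fin 2)) x, v (e x) = v x
  obstacle_le : ∀ x, φ x ≤ v x

namespace IsLayerState

variable {φ v w : EuclideanSpace ℝ (Fin 2) → ℝ} (h : IsLayerState φ v)
include h

theorem measurable : Measurable v := h.continuous.measurable

theorem abs_le_one (x : EuclideanSpace ℝ (Fin 2)) : |v x| ≤ 1 :=
  abs_le.2 ⟨by linarith [h.nonneg x], h.le_one x⟩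

theorem integrable_mul_poissonAvg {t : ℝ} (ht : 0 < t) (hw : IsLayerState φ w) :
    Integrable fun x => v x * poissonAvg t w x :=
  h.integrable.mul_bdd (c := 1)
    (continuous_poissonAvg ht hw.measurable hw.abs_le_one).aestronglyMeasurable
    (ae_of_all _ fun x => abs_poissonAvg_le ht hw.abs_le_one x)

theorem integrable_poissonKer_mul : Integrable fun x => poissonKer 1 x * v x :=
  (integrable_poissonKer one_pos).mul_bdd (c := 1) h.continuous.aestronglyMeasurable
    (ae_of_all _ h.abs_le_one)

theorem integral_poissonKer_mul_le_one : ∫ x, poissonKer 1 x * v x ≤ 1 := by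
  refine le_trans ?_ (integral_poissonKer one_pos).le
  refine integral_mono h.integrable_poissonKer_mul (integrable_poissonKer one_pos) fun x => ?_
  have := poissonKer_pos one_pos x
  simp only
  nlinarith [h.le_one x]

end IsLayerState

namespace IsLayerPotential

variable {V f : ℝ → ℝ} {Λ c : ℝ} (hV : IsLayerPotential V f Λ c)
variable {φ v w : EuclideanSpace ℝ (Fin 2) → ℝ} {q η ε : ℝ}
include hV

theorem isLayerState_layerStep (hq : 0 < q) (hη : 0 ≤ η) (hε : 0 < ε) (hφ : IsLayerState φ φ)
    (hv : IsLayerState φ v) : IsLayerState φ (layerStep f Λ q η ε φ v) := by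
  have hΛ := hV.pos_lip
  have hPc := continuous_poissonAvg hε hv.measurable hv.abs_le_one
  have hcont : Continuous (layerStep f Λ q η ε φ v) := by
    unfold layerStep
    have h1 := hV.continuous_deriv.comp hv.continuous
    have h2 := continuous_poissonKer one_pos
    have h3 := hφ.continuous
    have h4 := hv.continuous
    exact continuous_const.min (h3.max ((((h4.const_mul Λ).sub h1).add (hPc.const_mul q)).add
      (h2.const_mul η) |>.div_const _))
  have hG0 : ∀ x, 0 ≤ (Λ * v x - f (v x) + q * poissonAvg ε v x + η * poissonKer 1 x) / (Λ + q) := by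
    intro x
    have h1 := hV.monotone_sub (hv.nonneg x)
    simp only [mul_zero, hV.deriv_zero, sub_zero] at h1
    have h2 := poissonAvg_nonneg (t := ε) hv.nonneg x
    have h3 := (poissonKer_pos one_pos x).le
    refine div_nonneg ?_ (by linarith)
    have := mul_nonneg hq.le h2
    have := mul_nonneg hη h3
    linarith
  have h0 : ∀ x, 0 ≤ layerStep f Λ q η ε φ v x := fun x =>
    le_min zero_le_one (le_max_of_le_right (hG0 x))
  refine ⟨hcont, h0, fun x => min_le_left _ _, ?_, fun e x => ?_, fun x =>
    le_min (hφ.le_one x) (le_max_left _ _)⟩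
  · have hGi : Integrable fun x =>
        (Λ * v x - f (v x) + q * poissonAvg ε v x + η * poissonKer 1 x) / (Λ + q) := by
      have hfi : Integrable fun x => f (v x) := by
        refine (hv.integrable.const_mul Λ).mono'
          (hV.continuous_deriv.comp hv.continuous).aestronglyMeasurable (ae_of_all _ fun x => ?_)
        have := hV.lipschitz (v x) 0
        rw [hV.deriv_zero, sub_zero, sub_zero, abs_of_nonneg (hv.nonneg x)] at this
        exact this
      exact ((((hv.integrable.const_mul Λ).sub hfi).add
        ((integrable_poissonAvg hε hv.measurable hv.integrable).const_mul q)).add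
        ((integrable_poissonKer one_pos).const_mul η)).div_const _
    refine (hφ.integrable.add hGi).mono' hcont.aestronglyMeasurable (ae_of_all _ fun x => ?_)
    rw [Real.norm_of_nonneg (h0 x)]
    refine (min_le_right _ _).trans (max_le ?_ ?_)
    · simpa using hG0 x
    · simpa using hφ.nonneg x
  · have : poissonKer 1 (e x) = poissonKer 1 x := by simp [poissonKer]
    simp only [layerStep, hφ.isometry, hv.isometry, this,
      poissonAvg_comp_isometry hε e (hv.isometry e)]

/-- The division by Λ + q makes the step order preserving: Λs - f(s) is nondecreasing because f is
Λ-Lipschitz, and the Poisson average is monotone. -/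
theorem layerStep_mono (hq : 0 < q) (hε : 0 < ε) (hv : IsLayerState φ v)
    (hw : IsLayerState φ w) (h : ∀ x, v x ≤ w x) (x : EuclideanSpace ℝ (Fin 2)) :
    layerStep f Λ q η ε φ v x ≤ layerStep f Λ q η ε φ w x := by
  have hΛ := hV.pos_lip
  have h1 := hV.monotone_sub (h x)
  have h2 := poissonAvg_mono hε hv.measurable hv.abs_le_one hw.measurable hw.abs_le_one h x
  simp only at h1
  unfold layerStep
  gcongr

/-- With g = w - v ≥ 0, the definition of the step and the quadratic upper bound for V make the
energy change at most -(q/2)∫g², once the cross term ∫ g P_ε g is discarded; that term enters with a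
favourable sign. -/
theorem layerEnergy_layerStep_le (hq : 0 < q) (hη : 0 ≤ η) (hε : 0 < ε) (hφ : IsLayerState φ φ)
    (hv : IsLayerState φ v) (hle : ∀ x, v x ≤ layerStep f Λ q η ε φ v x) :
    layerEnergy V q η ε (layerStep f Λ q η ε φ v) ≤ layerEnergy V q η ε v := by
  have hw := hV.isLayerState_layerStep hq hη hε hφ hv
  set w := layerStep f Λ q η ε φ v with hwdef
  have hΛ := hV.pos_lip
  have hw2 := integrable_sq_of_bdd hw.measurable hw.abs_le_one hw.integrable
  have hv2 := integrable_sq_of_bdd hv.measurable hv.abs_le_one hv.integrable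
  have hwPv := hw.integrable_mul_poissonAvg hε hv
  have hvPv := hv.integrable_mul_poissonAvg hε hv
  have hwPw := hw.integrable_mul_poissonAvg hε hw
  have hvPw := hv.integrable_mul_poissonAvg hε hw
  have hVw := hV.integrable_comp hw.measurable hw.nonneg hw.le_one hw.integrable
  have hVv := hV.integrable_comp hv.measurable hv.nonneg hv.le_one hv.integrable
  have hgw := hw.integrable_poissonKer_mul
  have hgv := hv.integrable_poissonKer_mul
  have hsymm : ∫ x, v x * poissonAvg ε w x = ∫ x, w x * poissonAvg ε v x :=
    integral_mul_poissonAvg_comm hε hw.measurable hw.abs_le_one hw.integrable hv.measurable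
      hv.abs_le_one hv.integrable
  -- This is ∫ (w - v) P_ε(w - v) ≥ 0, which holds because the step increases v.
  have hcross : (∫ x, w x * poissonAvg ε v x) - ∫ x, v x * poissonAvg ε v x ≤
      (∫ x, w x * poissonAvg ε w x) - ∫ x, v x * poissonAvg ε w x := by
    rw [← integral_sub hwPv hvPv, ← integral_sub hwPw hvPw]
    refine integral_mono (hwPv.sub hvPv) (hwPw.sub hvPw) fun x => ?_
    have h2 := poissonAvg_mono hε hv.measurable hv.abs_le_one hw.measurable hw.abs_le_one hle x
    have h3 := hle x
    simp only
    nlinarith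
  have hpt : ∀ x, q / 2 * w x ^ 2 - q / 2 * v x ^ 2 - (q * (w x * poissonAvg ε v x) -
      q * (v x * poissonAvg ε v x)) + (V (w x) - V (v x)) -
      (η * (poissonKer 1 x * w x) - η * (poissonKer 1 x * v x)) ≤ 0 := by
    intro x
    have hd := hle x
    rcases hd.eq_or_lt with he | hlt
    · rw [← he]; simp
    have h1 := hV.sub_le hd
    -- Where the step strictly exceeds v ≥ φ, the lower obstacle is inactive, and the cap at 1 only
    -- lowers the value.
    have h2 : w x ≤ (Λ * v x - f (v x) + q * poissonAvg ε v x + η * poissonKer 1 x) / (Λ + q) := by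
      have h3 : w x ≤ _ := min_le_right _ _
      rcases le_max_iff.1 h3 with h4 | h4
      · exact absurd (h4.trans (hv.obstacle_le x)) (not_le.2 hlt)
      · exact h4
    rw [le_div_iff₀ (by linarith)] at h2
    have hd' : 0 < w x - v x := sub_pos.2 hlt
    nlinarith [mul_le_mul_of_nonneg_left h2 hd'.le, mul_pos hq (mul_pos hd' hd')]
  have hi := integral_nonpos (μ := volume) hpt
  have i1 : Integrable fun x => q / 2 * w x ^ 2 - q / 2 * v x ^ 2 :=
    (hw2.const_mul _).sub (hv2.const_mul _)
  have i2 : Integrable fun x => q * (w x * poissonAvg ε v x) - q * (v x * poissonAvg ε v x) :=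
    (hwPv.const_mul _).sub (hvPv.const_mul _)
  have i3 : Integrable fun x => V (w x) - V (v x) := hVw.sub hVv
  have i4 : Integrable fun x => η * (poissonKer 1 x * w x) - η * (poissonKer 1 x * v x) :=
    (hgw.const_mul _).sub (hgv.const_mul _)
  have i12 : Integrable fun x => q / 2 * w x ^ 2 - q / 2 * v x ^ 2 - (q * (w x * poissonAvg ε v x) -
      q * (v x * poissonAvg ε v x)) := i1.sub i2
  have i123 : Integrable fun x => q / 2 * w x ^ 2 - q / 2 * v x ^ 2 - (q * (w x * poissonAvg ε v x) -
      q * (v x * poissonAvg ε v x)) + (V (w x) - V (v x)) := i12.add i3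
  rw [integral_sub i123 i4, integral_add i12 i3, integral_sub i1 i2,
    integral_sub (hw2.const_mul _) (hv2.const_mul _),
    integral_sub (hwPv.const_mul _) (hvPv.const_mul _), integral_sub hVw hVv,
    integral_sub (hgw.const_mul _) (hgv.const_mul _)] at hi
  simp only [integral_const_mul] at hi
  unfold layerEnergy
  rw [hsymm] at hcross
  nlinarith

/-- The sequence of the descent. -/
noncomputable def _root_.layerSeq (f : ℝ → ℝ) (Λ q η ε : ℝ) (φ : EuclideanSpace ℝ (Fin 2) → ℝ) :
    ℕ → EuclideanSpace ℝ (Fin 2) → ℝ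
  | 0 => φ
  | n + 1 => layerStep f Λ q η ε φ (layerSeq f Λ q η ε φ n)

theorem isLayerState_layerSeq (hq : 0 < q) (hη : 0 ≤ η) (hε : 0 < ε) (hφ : IsLayerState φ φ)
    (n : ℕ) : IsLayerState φ (layerSeq f Λ q η ε φ n) := by
  induction n with
  | zero => exact hφ
  | succ n ih => exact hV.isLayerState_layerStep hq hη hε hφ ih

theorem layerSeq_le_succ (hq : 0 < q) (hη : 0 ≤ η) (hε : 0 < ε) (hφ : IsLayerState φ φ)
    (n : ℕ) (x : EuclideanSpace ℝ (Fin 2)) :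
    layerSeq f Λ q η ε φ n x ≤ layerSeq f Λ q η ε φ (n + 1) x := by
  induction n generalizing x with
  | zero => exact (hV.isLayerState_layerSeq hq hη hε hφ 1).obstacle_le x
  | succ n ih =>
    exact hV.layerStep_mono hq hε (hV.isLayerState_layerSeq hq hη hε hφ n)
      (hV.isLayerState_layerSeq hq hη hε hφ (n + 1)) ih x

theorem layerEnergy_layerSeq_le (hq : 0 < q) (hη : 0 ≤ η) (hε : 0 < ε) (hφ : IsLayerState φ φ)
    (n : ℕ) : layerEnergy V q η ε (layerSeq f Λ q η ε φ n) ≤ layerEnergy V q η ε φ := by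
  induction n with
  | zero => exact le_rfl
  | succ n ih =>
    exact (hV.layerEnergy_layerStep_le hq hη hε hφ (hV.isLayerState_layerSeq hq hη hε hφ n)
      (hV.layerSeq_le_succ hq hη hε hφ n)).trans ih

/-- The pointwise limit of the descent. -/
noncomputable def _root_.layerLim (f : ℝ → ℝ) (Λ q η ε : ℝ) (φ : EuclideanSpace ℝ (Fin 2) → ℝ)
    (x : EuclideanSpace ℝ (Fin 2)) : ℝ := ⨆ n, layerSeq f Λ q η ε φ n x

theorem bddAbove_layerSeq (hq : 0 < q) (hη : 0 ≤ η) (hε : 0 < ε) (hφ : IsLayerState φ φ)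
    (x : EuclideanSpace ℝ (Fin 2)) : BddAbove (range fun n => layerSeq f Λ q η ε φ n x) :=
  ⟨1, by rintro _ ⟨n, rfl⟩; exact (hV.isLayerState_layerSeq hq hη hε hφ n).le_one x⟩

theorem tendsto_layerSeq (hq : 0 < q) (hη : 0 ≤ η) (hε : 0 < ε) (hφ : IsLayerState φ φ)
    (x : EuclideanSpace ℝ (Fin 2)) :
    Tendsto (fun n => layerSeq f Λ q η ε φ n x) atTop (𝓝 (layerLim f Λ q η ε φ x)) :=
  tendsto_atTop_ciSup (monotone_nat_of_le_succ fun n => hV.layerSeq_le_succ hq hη hε hφ n x)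
    (hV.bddAbove_layerSeq hq hη hε hφ x)

theorem layerSeq_le_layerLim (hq : 0 < q) (hη : 0 ≤ η) (hε : 0 < ε) (hφ : IsLayerState φ φ)
    (n : ℕ) (x : EuclideanSpace ℝ (Fin 2)) : layerSeq f Λ q η ε φ n x ≤ layerLim f Λ q η ε φ x :=
  le_ciSup (hV.bddAbove_layerSeq hq hη hε hφ x) n

theorem measurable_layerLim (hq : 0 < q) (hη : 0 ≤ η) (hε : 0 < ε) (hφ : IsLayerState φ φ) :
    Measurable (layerLim f Λ q η ε φ) :=
  measurable_of_tendsto_metrizable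
    (fun n => (hV.isLayerState_layerSeq hq hη hε hφ n).measurable)
    (tendsto_pi_nhds.2 fun x => hV.tendsto_layerSeq hq hη hε hφ x)

theorem obstacle_le_layerLim (hq : 0 < q) (hη : 0 ≤ η) (hε : 0 < ε) (hφ : IsLayerState φ φ)
    (x : EuclideanSpace ℝ (Fin 2)) : φ x ≤ layerLim f Λ q η ε φ x :=
  hV.layerSeq_le_layerLim hq hη hε hφ 0 x

theorem layerLim_le_one (hq : 0 < q) (hη : 0 ≤ η) (hε : 0 < ε) (hφ : IsLayerState φ φ)
    (x : EuclideanSpace ℝ (Fin 2)) : layerLim f Λ q η ε φ x ≤ 1 :=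
  ciSup_le fun n => (hV.isLayerState_layerSeq hq hη hε hφ n).le_one x

theorem layerLim_isometry (hq : 0 < q) (hη : 0 ≤ η) (hε : 0 < ε) (hφ : IsLayerState φ φ)
    (e : EuclideanSpace ℝ (Fin 2) ≃ₗᵢ[ℝ] EuclideanSpace ℝ (Fin 2))
    (x : EuclideanSpace ℝ (Fin 2)) : layerLim f Λ q η ε φ (e x) = layerLim f Λ q η ε φ x := by
  simp only [layerLim, (hV.isLayerState_layerSeq hq hη hε hφ _).isometry]

/-- The limit of the descent is a fixed point. -/
theorem layerStep_layerLim (hq : 0 < q) (hη : 0 ≤ η) (hε : 0 < ε) (hφ : IsLayerState φ φ)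
    (x : EuclideanSpace ℝ (Fin 2)) :
    layerStep f Λ q η ε φ (layerLim f Λ q η ε φ) x = layerLim f Λ q η ε φ x := by
  have := isProbabilityMeasure_poissonMeas hε
  have hT := hV.tendsto_layerSeq hq hη hε hφ
  have hP : Tendsto (fun n => poissonAvg ε (layerSeq f Λ q η ε φ n) x) atTop
      (𝓝 (poissonAvg ε (layerLim f Λ q η ε φ) x)) := by
    refine tendsto_integral_of_dominated_convergence (fun _ => 1)
      (fun n => ((hV.isLayerState_layerSeq hq hη hε hφ n).measurable.comp
        (measurable_const_add x)).aestronglyMeasurable) (integrable_const _)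
      (fun n => ae_of_all _ fun z => (hV.isLayerState_layerSeq hq hη hε hφ n).abs_le_one _)
      (ae_of_all _ fun z => hT _)
  have hf := (hV.continuous_deriv.tendsto _).comp (hT x)
  have hlim : Tendsto (fun n => layerSeq f Λ q η ε φ (n + 1) x) atTop
      (𝓝 (layerStep f Λ q η ε φ (layerLim f Λ q η ε φ) x)) := by
    refine tendsto_const_nhds.min (tendsto_const_nhds.max ?_)
    exact (((((hT x).const_mul Λ).sub hf).add (hP.const_mul q)).add_const _).div_const _
  exact tendsto_nhds_unique hlim ((tendsto_add_atTop_iff_nat 1).2 (hT x))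

/-- The measure bound along the descent passes to the limit. -/
theorem volume_real_lt_layerLim_le (hq : 0 < q) (hη : 0 ≤ η) (hε : 0 < ε)
    (hφ : IsLayerState φ φ) {s m : ℝ} (hs : 0 < s)
    (hm : ∀ n, volume.real {x | s < layerSeq f Λ q η ε φ n x} ≤ m) :
    volume {x | s < layerLim f Λ q η ε φ x} ≤ ENNReal.ofReal m := by
  have hU : {x | s < layerLim f Λ q η ε φ x} = ⋃ n, {x | s < layerSeq f Λ q η ε φ n x} := by
    ext x
    rw [mem_iUnion]
    constructor
    · intro hx
      exact exists_lt_of_lt_ciSup (show s < ⨆ n, layerSeq f Λ q η ε φ n x from hx)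
    · rintro ⟨n, hn⟩
      exact lt_of_lt_of_le (show s < layerSeq f Λ q η ε φ n x from hn)
        (hV.layerSeq_le_layerLim hq hη hε hφ n x)
  rw [hU, Monotone.measure_iUnion]
  · refine iSup_le fun n => ?_
    rw [← ENNReal.ofReal_toReal
      ((hV.isLayerState_layerSeq hq hη hε hφ n).integrable.measure_gt_lt_top hs).ne]
    exact ENNReal.ofReal_le_ofReal (hm n)
  · exact monotone_nat_of_le_succ fun n x hx =>
      lt_of_lt_of_le (show s < layerSeq f Λ q η ε φ n x from hx)
        (hV.layerSeq_le_succ hq hη hε hφ n x)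

end IsLayerPotential

/-! ### The radial obstacle and comparison tools. -/

/-- A smooth radial cutoff, equal to `1` for `‖x‖ ≤ 5` and to `0` for `‖x‖ ≥ 8`. -/
noncomputable def radialBump (x : EuclideanSpace ℝ (Fin 2)) : ℝ :=
  Real.smoothTransition (2 - ‖x‖ ^ 2 / 25)

theorem contDiff_radialBump : ContDiff ℝ 2 radialBump :=
  Real.smoothTransition.contDiff.comp
    (contDiff_const.sub ((contDiff_norm_sq ℝ).div_const _))

theorem radialBump_eq_one {x : EuclideanSpace ℝ (Fin 2)} (hx : ‖x‖ ≤ 5) : radialBump x = 1 := by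
  refine Real.smoothTransition.one_of_one_le ?_
  nlinarith [norm_nonneg x]

theorem radialBump_eq_zero {x : EuclideanSpace ℝ (Fin 2)} (hx : 8 ≤ ‖x‖) : radialBump x = 0 := by
  refine Real.smoothTransition.zero_of_nonpos ?_
  nlinarith [norm_nonneg x]

theorem hasCompactSupport_radialBump : HasCompactSupport radialBump :=
  HasCompactSupport.intro (isCompact_closedBall 0 8) fun x hx => by
    refine radialBump_eq_zero ?_
    simp only [Metric.mem_closedBall, dist_zero_right, not_le] at hx
    exact hx.le

theorem isLayerState_radialBump : IsLayerState radialBump radialBump where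
  continuous := contDiff_radialBump.continuous
  nonneg _ := Real.smoothTransition.nonneg _
  le_one _ := Real.smoothTransition.le_one _
  integrable := contDiff_radialBump.continuous.integrable_of_hasCompactSupport
    hasCompactSupport_radialBump
  isometry e x := by simp [radialBump]
  obstacle_le _ := le_rfl

/-- Applied to 1 - v, this carries a deficit from a large fixed scale down to scale ε, with the
factor that matches the difference quotient. -/
theorem poissonAvg_le_div_mul {w : EuclideanSpace ℝ (Fin 2) → ℝ} {s t B : ℝ} (hs : 0 < s)
    (hst : s ≤ t) (hw : Measurable w) (hb : ∀ x, |w x| ≤ B) (h0 : ∀ x, 0 ≤ w x)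
    (x : EuclideanSpace ℝ (Fin 2)) : poissonAvg t w x ≤ t / s * poissonAvg s w x := by
  rw [poissonAvg_eq_integral_sub (hs.trans_le hst), poissonAvg_eq_integral_sub hs,
    ← integral_const_mul]
  refine integral_mono (integrable_poissonKer_mul (hs.trans_le hst) hw hb x)
    ((integrable_poissonKer_mul hs hw hb x).const_mul _) fun y => ?_
  simp only
  rw [← mul_assoc]
  exact mul_le_mul_of_nonneg_right (poissonKer_le_mul hs hst _) (h0 y)

theorem poissonKer_le_one {x : EuclideanSpace ℝ (Fin 2)} : poissonKer 1 x ≤ 1 := by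
  refine (poissonKer_le_div one_pos x).trans ?_
  have := Real.pi_gt_three
  rw [div_le_one (by positivity)]
  linarith

theorem poissonKer_one_le {R : ℝ} (hR : 1 ≤ R) (x : EuclideanSpace ℝ (Fin 2)) :
    poissonKer 1 x ≤ R ^ 2 * poissonKer R x := by
  have hpi := Real.pi_pos
  have h1 : √(R ^ 2 + ‖x‖ ^ 2) ≤ R * √(1 ^ 2 + ‖x‖ ^ 2) := by
    rw [Real.sqrt_le_left (by positivity), mul_pow, Real.sq_sqrt (by positivity)]
    nlinarith [sq_nonneg ‖x‖, mul_nonneg (sq_nonneg ‖x‖) (by nlinarith : 0 ≤ R ^ 2 - 1)]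
  have hp : 0 < √(R ^ 2 + ‖x‖ ^ 2) := Real.sqrt_pos.2 (by positivity)
  have hp1 : 0 < √(1 ^ 2 + ‖x‖ ^ 2) := Real.sqrt_pos.2 (by positivity)
  have h3 : √(R ^ 2 + ‖x‖ ^ 2) ^ 3 ≤ R ^ 3 * √(1 ^ 2 + ‖x‖ ^ 2) ^ 3 := by
    rw [← mul_pow]; gcongr
  unfold poissonKer
  have e : R ^ 2 * (R / (2 * Real.pi) * (√(R ^ 2 + ‖x‖ ^ 2) ^ 3)⁻¹) =
      R ^ 3 / (2 * Real.pi * √(R ^ 2 + ‖x‖ ^ 2) ^ 3) := by field_simp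
  have e' : 1 / (2 * Real.pi) * (√(1 ^ 2 + ‖x‖ ^ 2) ^ 3)⁻¹ =
      1 / (2 * Real.pi * √(1 ^ 2 + ‖x‖ ^ 2) ^ 3) := by field_simp
  rw [e, e', div_le_div_iff₀ (by positivity) (by positivity)]
  nlinarith

/-- A radial function that exceeds a level at one point and is almost continuous exceeds half the
level on an annulus. -/
theorem norm_le_of_volume_lt_le {v : EuclideanSpace ℝ (Fin 2) → ℝ}
    (hiso : ∀ (e : EuclideanSpace ℝ (Fin 2) ≃ₗᵢ[ℝ] EuclideanSpace ℝ (Fin 2)) x, v (e x) = v x)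
    {s r m : ℝ} (hs : 0 < s) (hr : 0 < r) (hr1 : r ≤ 1) (hm : 0 ≤ m)
    (hmod : ∀ x y, ‖x - y‖ ≤ r → |v x - v y| ≤ s / 4)
    (hvol : volume {x | s / 2 < v x} ≤ ENNReal.ofReal m) {x : EuclideanSpace ℝ (Fin 2)}
    (hx : m / r + 1 < ‖x‖) : v x ≤ s := by
  by_contra! hvx
  have hpi := Real.pi_gt_three
  set ρ := ‖x‖ with hρ
  have hmr : 0 ≤ m / r := by positivity
  have hρ1 : 1 < ρ := by linarith
  -- By radial symmetry the value v x is taken on the whole circle through x, and the modulus keeps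
  -- v above s/2 on an annulus of width r. The area π r (2ρ - r) exceeds m, contradicting the volume
  -- bound.
  have hsub : Metric.ball (0 : EuclideanSpace ℝ (Fin 2)) ρ \ Metric.ball 0 (ρ - r) ⊆
      {x | s / 2 < v x} := by
    rintro y ⟨hy1, hy2⟩
    simp only [Metric.mem_ball, dist_zero_right, not_lt] at hy1 hy2
    by_cases hy0 : ‖y‖ = 0
    · have hr1' : ρ = r := by linarith
      linarith
    have hypos : 0 < ‖y‖ := lt_of_le_of_ne (norm_nonneg y) (Ne.symm hy0)
    set y' := (ρ / ‖y‖) • y with hy'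
    have hn : ‖y'‖ = ‖x‖ := by
      rw [hy', norm_smul, Real.norm_of_nonneg (by positivity), ← hρ]; field_simp
    have hvy' : v y' = v x := by
      have := hiso (Submodule.reflection (ℝ ∙ (y' - x))ᗮ) y'
      rw [Submodule.reflection_sub hn] at this
      exact this.symm
    have hd : ‖y' - y‖ ≤ r := by
      have : y' - y = (ρ / ‖y‖ - 1) • y := by rw [hy']; module
      rw [this, norm_smul, Real.norm_of_nonneg]
      · have : (ρ / ‖y‖ - 1) * ‖y‖ = ρ - ‖y‖ := by field_simp
        rw [this]; linarith
      · rw [sub_nonneg, one_le_div hypos]; exact hy1.le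
    have := (abs_le.1 (hmod y' y hd)).2
    change s / 2 < v y
    linarith
  have hvol2 := (measure_mono hsub).trans hvol
  rw [measure_sdiff (Metric.ball_subset_ball (by linarith)) measurableSet_ball.nullMeasurableSet
    measure_ball_lt_top.ne, EuclideanSpace.volume_ball_fin_two,
    EuclideanSpace.volume_ball_fin_two] at hvol2
  have e1 : ENNReal.ofReal ρ ^ 2 * ENNReal.ofReal Real.pi -
      ENNReal.ofReal (ρ - r) ^ 2 * ENNReal.ofReal Real.pi =
      ENNReal.ofReal (ρ ^ 2 * Real.pi - (ρ - r) ^ 2 * Real.pi) := by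
    rw [← ENNReal.ofReal_pow (by linarith), ← ENNReal.ofReal_pow (by linarith),
      ← ENNReal.ofReal_mul (by positivity), ← ENNReal.ofReal_mul (by positivity),
      ENNReal.ofReal_sub _ (by positivity)]
  rw [e1, ENNReal.ofReal_le_ofReal_iff hm] at hvol2
  have h2 : m < r * (ρ - 1) := by
    rw [mul_comm, ← div_lt_iff₀ hr]; linarith
  have h3 : r * (ρ - 1) ≤ r * (2 * ρ - r) := mul_le_mul_of_nonneg_left (by linarith) hr.le
  have h4 : r * (2 * ρ - r) * 1 ≤ r * (2 * ρ - r) * Real.pi :=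
    mul_le_mul_of_nonneg_left (by linarith) (mul_nonneg hr.le (by linarith))
  have h5 : ρ ^ 2 * Real.pi - (ρ - r) ^ 2 * Real.pi = r * (2 * ρ - r) * Real.pi := by ring
  linarith

/-- The difference quotient of the fixed function φ is bounded uniformly in ε, and the source term
only lowers the energy. -/
theorem exists_layerEnergy_le (V : ℝ → ℝ) {φ : EuclideanSpace ℝ (Fin 2) → ℝ} {k : ℝ}
    (hk : 0 < k) (hφ : IsLayerState φ φ) {C : ℝ}
    (hC : ∀ x z, |secondDiff φ x z| ≤ C * min (‖z‖ ^ 2) 1) :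
    ∃ N : ℝ, ∀ ε η : ℝ, 0 < ε → 0 ≤ η → layerEnergy V (k / ε) η ε φ ≤ N := by
  have hpi := Real.pi_pos
  set D := C * ∫ z : EuclideanSpace ℝ (Fin 2), min (‖z‖ ^ 2) 1 / (2 * ‖z‖ ^ 3) with hD
  refine ⟨k / (4 * Real.pi) * (D * ∫ x, φ x) + ∫ x, V (φ x), fun ε η hε hη => ?_⟩
  have h1 : 0 ≤ η * ∫ x, poissonKer 1 x * φ x := mul_nonneg hη
    (integral_nonneg fun x => mul_nonneg (poissonKer_pos one_pos x).le (hφ.nonneg x))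
  have i1 := integrable_sq_of_bdd hφ.measurable hφ.abs_le_one hφ.integrable
  have i2 := hφ.integrable_mul_poissonAvg hε hφ
  have h2 : 2 * Real.pi / ε * ((∫ x, φ x ^ 2) - ∫ x, φ x * poissonAvg ε φ x) ≤ D * ∫ x, φ x := by
    rw [← integral_sub i1 i2, ← integral_const_mul, ← integral_const_mul]
    refine integral_mono ((i1.sub i2).const_mul _) (hφ.integrable.const_mul _) fun x => ?_
    have := (abs_le.1 (abs_poissonAvg_sub_self_le hφ.measurable hφ.abs_le_one (hC x) hε)).1
    have h3 := hφ.nonneg x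
    simp only
    rw [← hD] at this
    nlinarith
  have e : k / ε / 2 * ((∫ x, φ x ^ 2) - ∫ x, φ x * poissonAvg ε φ x) =
      k / (4 * Real.pi) * (2 * Real.pi / ε * ((∫ x, φ x ^ 2) - ∫ x, φ x * poissonAvg ε φ x)) := by
    field_simp; ring
  have h4 := mul_le_mul_of_nonneg_left h2 (by positivity : 0 ≤ k / (4 * Real.pi))
  unfold layerEnergy
  linarith

/-! ### Estimates for the limit of the descent, uniform in ε. -/

namespace IsLayerPotential

variable {V f : ℝ → ℝ} {Λ c : ℝ} (hV : IsLayerPotential V f Λ c)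
variable {φ : EuclideanSpace ℝ (Fin 2) → ℝ} {k η ε : ℝ}
include hV

/-- The energy never exceeds its initial value and the source contributes at most 1, so the form and
the potential part are both bounded independently of ε, η and the iteration; the isoperimetric
estimate then applies. -/
theorem exists_volume_lt_layerLim_le (hk : 0 < k) (hφ : IsLayerState φ φ) {C : ℝ}
    (hC : ∀ x z, |secondDiff φ x z| ≤ C * min (‖z‖ ^ 2) 1) {s : ℝ} (hs : 0 < s)
    (hs4 : s ≤ 1 / 4) :
    ∃ m : ℝ, 0 ≤ m ∧ ∀ ε η : ℝ, 0 < ε → ε ≤ 1 → 0 ≤ η → η ≤ 1 →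
      volume {x | s < layerLim f Λ (k / ε) η ε φ x} ≤ ENNReal.ofReal m := by
  obtain ⟨N₀, hN₀⟩ := exists_layerEnergy_le V hk hφ hC
  set N := N₀ + 1
  have main : ∀ ε η : ℝ, 0 < ε → ε ≤ 1 → 0 ≤ η → η ≤ 1 → ∀ n,
      volume.real {x | s < layerSeq f Λ (k / ε) η ε φ n x} ≤
        4 * (N / (c * s ^ 2)) + 4 * (8 * N / k) + 16 * (8 * N / k) ^ 2 := by
    intro ε η hε hε1 hη hη1 n
    have hq : 0 < k / ε := by positivity
    have hv := hV.isLayerState_layerSeq hq hη hε hφ n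
    have hE := (hV.layerEnergy_layerSeq_le hq hη hε hφ n).trans (hN₀ ε η hε hη)
    set v := layerSeq f Λ (k / ε) η ε φ n
    have h1 := hv.integral_poissonKer_mul_le_one
    have h10 : 0 ≤ ∫ x, poissonKer 1 x * v x :=
      integral_nonneg fun x => mul_nonneg (poissonKer_pos one_pos x).le (hv.nonneg x)
    have h2 := mul_nonneg (by positivity : 0 ≤ k / ε / 2)
      (integral_sq_sub_integral_mul_poissonAvg_nonneg hε hv.measurable hv.abs_le_one hv.integrable)
    have h3 : 0 ≤ ∫ x, V (v x) := integral_nonneg fun x => hV.nonneg ⟨hv.nonneg x, hv.le_one x⟩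
    have h4 : η * ∫ x, poissonKer 1 x * v x ≤ 1 := by nlinarith
    unfold layerEnergy at hE
    exact hV.volume_real_lt_le hv.measurable hv.nonneg hv.le_one hv.integrable hε hε1 hk
      (by linarith) (by linarith) hs hs4
  refine ⟨_, (measureReal_nonneg).trans (main 1 0 one_pos le_rfl le_rfl zero_le_one 0),
    fun ε η hε hε1 hη hη1 => ?_⟩
  exact hV.volume_real_lt_layerLim_le (by positivity) hη hε hφ hs (main ε η hε hε1 hη hη1)

theorem layerLim_nonneg {q : ℝ} (hq : 0 < q) (hη : 0 ≤ η) (hε : 0 < ε) (hφ : IsLayerState φ φ)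
    (x : EuclideanSpace ℝ (Fin 2)) : 0 ≤ layerLim f Λ q η ε φ x :=
  (hφ.nonneg x).trans (hV.obstacle_le_layerLim hq hη hε hφ x)

/-- Below the cap only the lower obstacle can act, and it can only push the fixed point above the
unconstrained step. -/
theorem le_of_layerLim_lt_one {q : ℝ} (hq : 0 < q) (hη : 0 ≤ η) (hε : 0 < ε)
    (hφ : IsLayerState φ φ) {x : EuclideanSpace ℝ (Fin 2)}
    (hx : layerLim f Λ q η ε φ x < 1) :
    q * (poissonAvg ε (layerLim f Λ q η ε φ) x - layerLim f Λ q η ε φ x) ≤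
      f (layerLim f Λ q η ε φ x) - η * poissonKer 1 x := by
  have hΛ := hV.pos_lip
  have hfix := hV.layerStep_layerLim hq hη hε hφ x
  set v := layerLim f Λ q η ε φ
  unfold layerStep at hfix
  have h1 : (Λ * v x - f (v x) + q * poissonAvg ε v x + η * poissonKer 1 x) / (Λ + q) ≤ v x := by
    rcases min_choice (1 : ℝ) (max (φ x)
      ((Λ * v x - f (v x) + q * poissonAvg ε v x + η * poissonKer 1 x) / (Λ + q))) with h | h
    · linarith
    · rw [h] at hfix; exact (le_max_right (φ x) _).trans hfix.le
  rw [div_le_iff₀ (by linarith)] at h1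
  linarith

/-- Off the lower obstacle only the cap can act, and it can only push the fixed point below the
unconstrained step. -/
theorem ge_of_lt_layerLim {q : ℝ} (hq : 0 < q) (hη : 0 ≤ η) (hε : 0 < ε)
    (hφ : IsLayerState φ φ) {x : EuclideanSpace ℝ (Fin 2)}
    (hx : φ x < layerLim f Λ q η ε φ x) :
    f (layerLim f Λ q η ε φ x) - η * poissonKer 1 x ≤
      q * (poissonAvg ε (layerLim f Λ q η ε φ) x - layerLim f Λ q η ε φ x) := by
  have hΛ := hV.pos_lip
  have hfix := hV.layerStep_layerLim hq hη hε hφ x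
  set v := layerLim f Λ q η ε φ
  unfold layerStep at hfix
  have h1 : v x ≤ (Λ * v x - f (v x) + q * poissonAvg ε v x + η * poissonKer 1 x) / (Λ + q) := by
    have h2 := hfix.ge
    replace h2 := le_trans h2 (min_le_right _ _)
    exact (le_max_iff.1 h2).resolve_left (not_le.2 hx)
  rw [le_div_iff₀ (by linarith)] at h1
  linarith

/-- The limit of the descent is a supersolution, uniformly in the scale. -/
theorem exists_layerLim_supersolution (hk : 0 < k) (hφ : IsLayerState φ φ) {C : ℝ}
    (hC : ∀ x z, |secondDiff φ x z| ≤ C * min (‖z‖ ^ 2) 1) :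
    ∃ η : ℝ, 0 < η ∧ η ≤ 1 ∧ ∀ ε : ℝ, 0 < ε → ε ≤ 1 → ∀ x,
      k / ε * (poissonAvg ε (layerLim f Λ (k / ε) η ε φ) x - layerLim f Λ (k / ε) η ε φ x) ≤
        f (layerLim f Λ (k / ε) η ε φ x) - η * poissonKer 1 x := by
  obtain ⟨m, hm0, hm⟩ := hV.exists_volume_lt_layerLim_le hk hφ hC (s := 1 / 4) (by norm_num) le_rfl
  -- Since m ≤ h², the set {v > 1/4} has weight at most 1/(2π) ≤ 1/4 in an average at scale h, which
  -- therefore does not exceed 1/2.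
  set h := 1 + √m with hh
  have hsq : √m ^ 2 = m := Real.sq_sqrt hm0
  have hsq0 := Real.sqrt_nonneg m
  have hh1 : 1 ≤ h := by linarith
  have hh0 : 0 < h := by linarith
  have hpi := Real.pi_gt_three
  refine ⟨min 1 (k / (2 * h)), lt_min one_pos (by positivity), min_le_left _ _,
    fun ε hε hε1 x => ?_⟩
  have hη0 : 0 < min 1 (k / (2 * h)) := lt_min one_pos (by positivity)
  have hη1 : min 1 (k / (2 * h)) ≤ 1 := min_le_left _ _
  have hη2 : min 1 (k / (2 * h)) ≤ k / (2 * h) := min_le_right _ _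
  set η := min 1 (k / (2 * h))
  have hq : 0 < k / ε := by positivity
  -- Only contact with the cap is delicate. There f(1) = 0, so the nonlocal term must beat the
  -- source. The deficit 1 - P_h v ≥ 1/2 gives (k/ε)(1 - P_ε v) ≥ k/(2h), which is at least η.
  rcases (hV.layerLim_le_one hq hη0.le hε hφ x).lt_or_eq with hx | hx
  · exact hV.le_of_layerLim_lt_one hq hη0.le hε hφ hx
  have hvm := hV.measurable_layerLim hq hη0.le hε hφ
  have hv1 := hV.layerLim_le_one hq hη0.le hε hφ
  have hv0 := hV.layerLim_nonneg hq hη0.le hε hφ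
  have hvol := hm ε η hε hε1 hη0.le hη1
  set v := layerLim f Λ (k / ε) η ε φ
  have hvb : ∀ x, |v x| ≤ 1 := fun x => abs_le.2 ⟨by linarith [hv0 x], hv1 x⟩
  have hAm : MeasurableSet {x | 1 / 4 < v x} := measurableSet_lt measurable_const hvm
  have hfin : volume {x | 1 / 4 < v x} ≠ ⊤ := (hvol.trans_lt ENNReal.ofReal_lt_top).ne
  set χ : EuclideanSpace ℝ (Fin 2) → ℝ := {x | 1 / 4 < v x}.indicator 1 with hχ
  have hχm : Measurable χ := measurable_one.indicator hAm
  have hχ0 : ∀ y, 0 ≤ χ y := fun y => indicator_nonneg (fun _ _ => zero_le_one) y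
  have hχ1 : ∀ y, |χ y| ≤ 1 := fun y => by
    rw [abs_of_nonneg (hχ0 y)]
    exact indicator_le_self' (f := (1 : EuclideanSpace ℝ (Fin 2) → ℝ)) (fun _ _ => zero_le_one) y
  have hχi : Integrable χ := (integrable_indicator_iff hAm).2 (integrableOn_const hfin)
  have hχint : ∫ y, χ y ≤ m := by
    rw [hχ, integral_indicator_one hAm]
    exact ENNReal.toReal_le_of_le_ofReal hm0 hvol
  have hP : poissonAvg h v x ≤ 1 / 2 := by
    have h1 : poissonAvg h v x ≤ poissonAvg h (fun y => 1 / 4 + χ y) x := by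
      refine poissonAvg_mono (B' := 2) hh0 hvm hvb (hχm.const_add _) (fun y => ?_) (fun y => ?_) x
      · rw [abs_of_nonneg (by linarith [hχ0 y])]
        linarith [(abs_le.1 (hχ1 y)).2]
      · by_cases hy : 1 / 4 < v y
        · rw [hχ, indicator_of_mem (show y ∈ {x | 1 / 4 < v x} from hy)]
          simp only [Pi.one_apply]; linarith [hv1 y]
        · linarith [hχ0 y]
    rw [poissonAvg_add (v := fun _ => 1 / 4) (B := 1 / 4) hh0 measurable_const
      (fun _ => by norm_num) hχm hχ1, poissonAvg_const hh0] at h1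
    have h2 := poissonAvg_le_integral hh0 hχi hχ0 x
    have h3 : 1 / (2 * Real.pi * h ^ 2) * ∫ y, χ y ≤ 1 / 4 := by
      rw [one_div_mul_eq_div, div_le_iff₀ (by positivity)]
      have : m ≤ h ^ 2 := by rw [hh]; nlinarith
      nlinarith [sq_nonneg h]
    linarith
  have hmono := poissonAvg_le_div_mul (w := fun y => 1 - v y) hε (hε1.trans hh1)
    (measurable_const.sub hvm) (B := 1)
    (fun y => abs_le.2 ⟨by linarith [hv1 y], by linarith [hv0 y]⟩) (fun y => by linarith [hv1 y]) x
  rw [poissonAvg_sub (v := fun _ => 1) (B := 1) hh0 measurable_const (by simp) hvm hvb,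
    poissonAvg_sub (v := fun _ => 1) (B := 1) hε measurable_const (by simp) hvm hvb,
    poissonAvg_const hh0, poissonAvg_const hε] at hmono
  rw [hx, hV.deriv_one]
  have h5 : k / (2 * h) ≤ k / ε * (1 - poissonAvg ε v x) := by
    have e : k / ε * (1 - poissonAvg ε v x) = k / h * (h / ε * (1 - poissonAvg ε v x)) := by
      field_simp
    rw [e]
    have : k / (2 * h) = k / h * (1 / 2) := by field_simp
    rw [this]
    gcongr
    linarith
  have h6 : η * poissonKer 1 x ≤ η := by
    have := poissonKer_le_one (x := x)
    nlinarith
  linarith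

/-- The supersolution property bounds the quotient above. Below, either the obstacle is inactive and
the opposite inequality holds, or v touches φ, and v ≥ φ bounds its quotient below by that of the
smooth obstacle. -/
theorem abs_layerLim_le {C : ℝ} (hk : 0 < k) (hη : 0 ≤ η) (hη1 : η ≤ 1) (hε : 0 < ε)
    (hφ : IsLayerState φ φ) (hC : ∀ x z, |secondDiff φ x z| ≤ C * min (‖z‖ ^ 2) 1)
    {x : EuclideanSpace ℝ (Fin 2)}
    (hsup : k / ε * (poissonAvg ε (layerLim f Λ (k / ε) η ε φ) x - layerLim f Λ (k / ε) η ε φ x) ≤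
        f (layerLim f Λ (k / ε) η ε φ x) - η * poissonKer 1 x) :
    |k / ε * (poissonAvg ε (layerLim f Λ (k / ε) η ε φ) x - layerLim f Λ (k / ε) η ε φ x)| ≤
      Λ + 1 + k / (2 * Real.pi) *
        (C * ∫ z : EuclideanSpace ℝ (Fin 2), min (‖z‖ ^ 2) 1 / (2 * ‖z‖ ^ 3)) := by
  have hpi := Real.pi_pos
  have hq : 0 < k / ε := by positivity
  have hvm := hV.measurable_layerLim hq hη hε hφ
  have hv1 := hV.layerLim_le_one hq hη hε hφ
  have hv0 := hV.layerLim_nonneg hq hη hε hφ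
  have hvφ := hV.obstacle_le_layerLim hq hη hε hφ
  have hge := fun h => hV.ge_of_lt_layerLim hq hη hε hφ (x := x) h
  set v := layerLim f Λ (k / ε) η ε φ
  have hvb : ∀ x, |v x| ≤ 1 := fun x => abs_le.2 ⟨by linarith [hv0 x], hv1 x⟩
  have hfb : |f (v x)| ≤ Λ := by
    have := hV.lipschitz (v x) 0
    rw [hV.deriv_zero, sub_zero, sub_zero] at this
    have hΛ := hV.pos_lip
    nlinarith [hvb x]
  have hg : 0 ≤ η * poissonKer 1 x ∧ η * poissonKer 1 x ≤ 1 := by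
    have h1 := poissonKer_le_one (x := x)
    have h2 := poissonKer_pos one_pos x
    constructor
    · positivity
    · nlinarith
  set D := C * ∫ z : EuclideanSpace ℝ (Fin 2), min (‖z‖ ^ 2) 1 / (2 * ‖z‖ ^ 3) with hD
  have hDb := abs_poissonAvg_sub_self_le hφ.measurable hφ.abs_le_one (hC x) hε
  rw [← hD] at hDb
  have hD0 : 0 ≤ D := (abs_nonneg _).trans hDb
  have hkD : 0 ≤ k / (2 * Real.pi) * D := by positivity
  have hf := abs_le.1 hfb
  refine abs_le.2 ⟨?_, by linarith⟩
  rcases (hvφ x).eq_or_lt with h | h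
  · have h1 := poissonAvg_mono hε hφ.measurable hφ.abs_le_one hvm hvb hvφ x
    have h2 := (abs_le.1 hDb).1
    have e : k / ε * (poissonAvg ε φ x - φ x) =
        k / (2 * Real.pi) * (2 * Real.pi / ε * (poissonAvg ε φ x - φ x)) := by field_simp
    have h3 : k / (2 * Real.pi) * (-D) ≤ k / ε * (poissonAvg ε φ x - φ x) := by
      rw [e]; gcongr
    have h4 : k / ε * (poissonAvg ε φ x - φ x) ≤ k / ε * (poissonAvg ε v x - v x) := by
      rw [← h]; gcongr
    have := hV.pos_lip
    linarith
  · have := hge h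
    linarith

end IsLayerPotential

/-- The semigroup law telescopes the steps of length ε, and each step changes the average by at most
εD. -/
theorem abs_sub_poissonAvg_nsmul_le {v : EuclideanSpace ℝ (Fin 2) → ℝ} {B D ε : ℝ} (hε : 0 < ε)
    (hv : Measurable v) (hb : ∀ x, |v x| ≤ B) (hD : ∀ x, |poissonAvg ε v x - v x| ≤ ε * D)
    (n : ℕ) (x : EuclideanSpace ℝ (Fin 2)) :
    |poissonAvg ((n + 1) * ε) v x - v x| ≤ (n + 1) * ε * D := by
  induction n with
  | zero => simpa using hD x
  | succ n ih =>
    have hn : 0 < ((n:ℝ) + 1) * ε := by positivity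
    have hPm := (continuous_poissonAvg hε hv hb).measurable
    have e : poissonAvg (((n + 1 : ℕ) + 1) * ε) v x =
        poissonAvg ((n + 1) * ε) (poissonAvg ε v) x := by
      rw [poissonAvg_poissonAvg hn hε hv hb]; push_cast; congr 1; ring
    have h1 : |poissonAvg ((n + 1) * ε) (poissonAvg ε v) x - poissonAvg ((n + 1) * ε) v x| ≤
        ε * D := by
      rw [← poissonAvg_sub hn hPm (fun y => abs_poissonAvg_le hε hb y) hv hb]
      exact abs_poissonAvg_le hn hD x
    rw [e]
    push_cast
    rw [abs_le] at *
    constructor <;> nlinarith [h1.1, h1.2, ih.1, ih.2]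

/-- Bounded functions with bounded Poisson difference quotients are uniformly almost continuous. -/
theorem exists_forall_abs_sub_le {D ω : ℝ} (hD : 0 < D) (hω : 0 < ω) :
    ∃ r ε₀ : ℝ, 0 < r ∧ 0 < ε₀ ∧ ∀ ε, 0 < ε → ε ≤ ε₀ →
      ∀ v : EuclideanSpace ℝ (Fin 2) → ℝ, Measurable v → (∀ x, 0 ≤ v x) → (∀ x, v x ≤ 1) →
        (∀ x, |poissonAvg ε v x - v x| ≤ ε * D) →
        ∀ x y, ‖x - y‖ ≤ r → |v x - v y| ≤ ω := by
  -- Some multiple t of ε lies in [T, 2T]. Replacing v by P_t v costs at most 2TD = ω/4 at each of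
  -- the two points, and (1 + a)³ - 1 ≤ 7a ≤ ω/2 bounds the oscillation of P_t v.
  set T := ω / (8 * D) with hT
  have hT0 : 0 < T := by positivity
  refine ⟨T * min 1 (ω / 14), T, by positivity, hT0, fun ε hε hεT v hv h0 h1 hvD x y hxy => ?_⟩
  have hb : ∀ x, |v x| ≤ 1 := fun x => abs_le.2 ⟨by linarith [h0 x], h1 x⟩
  set n := ⌊T / ε⌋₊ with hn
  have hn1 : T ≤ (n + 1) * ε := by
    have := (Nat.lt_floor_add_one (T / ε)).le
    rwa [div_le_iff₀ hε] at this
  have hn2 : (n + 1) * ε ≤ 2 * T := by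
    have := Nat.floor_le (by positivity : 0 ≤ T / ε)
    rw [le_div_iff₀ hε] at this
    linarith
  have hxn := abs_sub_poissonAvg_nsmul_le hε hv hb hvD n x
  have hyn := abs_sub_poissonAvg_nsmul_le hε hv hb hvD n y
  set t := ((n:ℝ) + 1) * ε
  have ht0 : 0 < t := hT0.trans_le hn1
  have hP := abs_poissonAvg_sub_le_of_mem_Icc ht0 hv h0 h1 x y
  have ha : ‖x - y‖ / t ≤ min 1 (ω / 14) := by
    rw [div_le_iff₀ ht0, mul_comm]
    refine hxy.trans ?_
    gcongr
  have ha1 := ha.trans (min_le_left _ _)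
  have ha2 := ha.trans (min_le_right _ _)
  have ha0 : 0 ≤ ‖x - y‖ / t := by positivity
  set a := ‖x - y‖ / t
  have h3 : (1 + a) ^ 3 - 1 ≤ ω / 2 := by
    nlinarith [mul_nonneg ha0 ha0, mul_nonneg ha0 (sub_nonneg.2 ha1),
      mul_nonneg (mul_nonneg ha0 ha0) (sub_nonneg.2 ha1)]
  have h4 : t * D ≤ ω / 4 := by
    calc t * D ≤ 2 * T * D := by gcongr
      _ = ω / 4 := by rw [hT]; field_simp; ring
  rw [abs_le] at *
  constructor <;> linarith [hxn.1, hxn.2, hyn.1, hyn.2, hP.1, hP.2]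

namespace IsLayerPotential

variable {V f : ℝ → ℝ} {Λ c : ℝ} (hV : IsLayerPotential V f Λ c)
variable {φ : EuclideanSpace ℝ (Fin 2) → ℝ} {k η ε : ℝ}
include hV

/-- Decay of the limit of the descent by comparison with a Poisson kernel. -/
theorem layerLim_le_mul_poissonKer (hk : 0 < k) (hη : 0 ≤ η) (hη1 : η ≤ 1) (hε : 0 < ε)
    (hφ : IsLayerState φ φ) {b s R R' M : ℝ} (hb : 0 < b)
    (hfb : ∀ a, 0 ≤ a → a ≤ s → b * a ≤ f a)
    (hφR : ∀ x, R < ‖x‖ → φ x = 0) (hvR : ∀ x, R < ‖x‖ → layerLim f Λ (k / ε) η ε φ x ≤ s)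
    (hR' : 1 ≤ R') (hkR : k / R' ≤ b / 2) (hM1 : ∀ x, ‖x‖ ≤ R → 1 ≤ M * poissonKer R' x)
    (hM2 : 2 * R' ^ 2 / b ≤ M) (x : EuclideanSpace ℝ (Fin 2)) :
    layerLim f Λ (k / ε) η ε φ x ≤ M * poissonKer R' x := by
  have hq : 0 < k / ε := by positivity
  have hR0 : 0 < R' := by linarith
  have hM0 : 0 < M := lt_of_lt_of_le (by positivity) hM2
  have hvm := hV.measurable_layerLim hq hη hε hφ
  have hv1 := hV.layerLim_le_one hq hη hε hφ
  have hv0 := hV.layerLim_nonneg hq hη hε hφ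
  have hge := fun x h => hV.ge_of_lt_layerLim hq hη hε hφ (x := x) h
  set v := layerLim f Λ (k / ε) η ε φ
  have hvb : ∀ x, |v x| ≤ 1 := fun x => abs_le.2 ⟨by linarith [hv0 x], hv1 x⟩
  set z : EuclideanSpace ℝ (Fin 2) → ℝ := fun x => v x - M * poissonKer R' x with hz
  have hpm : Measurable fun x => M * poissonKer R' x :=
    (continuous_poissonKer hR0).measurable.const_mul M
  have hpb : ∀ x, |M * poissonKer R' x| ≤ M * (1 / (2 * Real.pi * R' ^ 2)) := fun x => by
    rw [abs_mul, abs_of_pos hM0]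
    exact mul_le_mul_of_nonneg_left (abs_poissonKer_le hR0 x) hM0.le
  have hzm : Measurable z := hvm.sub hpm
  have hzb : ∀ x, |z x| ≤ 1 + M * (1 / (2 * Real.pi * R' ^ 2)) := fun x =>
    (abs_sub _ _).trans (add_le_add (hvb x) (hpb x))
  -- The decay rate b is split in two: one half absorbs the quotient of the comparison kernel, at
  -- most k/R' times the kernel, and the other half absorbs the source.
  have key : ∀ x, 0 < z x → b * z x ≤ k / ε * (poissonAvg ε z x - z x) := by
    intro x hx
    have hxR : R < ‖x‖ := by
      by_contra! h
      have := hM1 x h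
      have := hv1 x
      simp only [hz] at hx
      linarith
    have hp := poissonKer_pos hR0 x
    have hvx : 0 < v x := by
      simp only [hz] at hx
      have : 0 < M * poissonKer R' x := by positivity
      linarith
    have h1 := hge x (by rw [hφR x hxR]; exact hvx)
    have h2 := hfb (v x) (hv0 x) (hvR x hxR)
    have h3 := poissonAvg_poissonKer_le hε hR0 x
    have h4 : poissonAvg ε z x = poissonAvg ε v x - M * poissonAvg ε (poissonKer R') x := by
      rw [hz, poissonAvg_sub hε hvm hvb hpm hpb, poissonAvg_const_mul]
    have h5 : k / ε * (M * (poissonAvg ε (poissonKer R') x - poissonKer R' x)) ≤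
        b / 2 * (M * poissonKer R' x) := by
      have : k / ε * (M * (poissonAvg ε (poissonKer R') x - poissonKer R' x)) ≤
          k / ε * (M * (ε / R' * poissonKer R' x)) := by
        gcongr; linarith
      refine this.trans ?_
      have e : k / ε * (M * (ε / R' * poissonKer R' x)) = k / R' * (M * poissonKer R' x) := by
        field_simp
      rw [e]; gcongr
    have h6 : η * poissonKer 1 x ≤ b / 2 * (M * poissonKer R' x) := by
      have a1 := poissonKer_one_le hR' x
      have a2 := poissonKer_pos one_pos x
      rw [div_le_iff₀ hb] at hM2
      nlinarith
    rw [h4]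
    simp only [hz]
    nlinarith
  by_contra! hcon
  have hbdd : BddAbove (range z) := ⟨_, by rintro _ ⟨y, rfl⟩; exact (le_abs_self _).trans (hzb y)⟩
  set m := ⨆ y, z y with hm
  have hzx : 0 < z x := by simp only [hz]; linarith
  have hm0 : 0 < m := hzx.trans_le (le_ciSup hbdd x)
  -- The supremum need not be attained. A point above this fraction of it suffices, since there (k/ε
  -- + b) z ≤ (k/ε) P_ε z ≤ (k/ε) m.
  have hlt : m * (k / ε / (k / ε + b)) < m := by
    have : k / ε / (k / ε + b) < 1 := by rw [div_lt_one (by positivity)]; linarith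
    nlinarith
  obtain ⟨y, hy⟩ := exists_lt_of_lt_ciSup hlt
  have hy0 : 0 < z y := lt_of_le_of_lt (by positivity) hy
  have h1 := key y hy0
  have h2 := poissonAvg_le hε hzm hzb (fun y => le_ciSup hbdd y) y
  rw [← mul_div_assoc, div_lt_iff₀ (by positivity)] at hy
  nlinarith [mul_le_mul_of_nonneg_left h2 hq.le]

/-- Supersolutions of the regularised layer problem, with constants that do not depend on the
regularisation. -/
theorem exists_supersolution (hk : 0 < k) {b s : ℝ} (hb : 0 < b) (hs : 0 < s) (hs4 : s ≤ 1 / 4)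
    (hfb : ∀ a, 0 ≤ a → a ≤ s → b * a ≤ f a) :
    ∃ η M : ℝ, 0 < η ∧ 0 < M ∧ ∀ ω, 0 < ω → ∃ r ε₀ : ℝ, 0 < r ∧ 0 < ε₀ ∧ ∀ ε, 0 < ε → ε ≤ ε₀ →
      ∃ v : EuclideanSpace ℝ (Fin 2) → ℝ, Measurable v ∧ (∀ x, 0 ≤ v x) ∧ (∀ x, v x ≤ 1) ∧
        (∀ x, ‖x‖ ≤ 5 → v x = 1) ∧ (∀ x, v x ≤ M * poissonKer 1 x) ∧
        (∀ x, k / ε * (poissonAvg ε v x - v x) ≤ f (v x) - η * poissonKer 1 x) ∧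
        ∀ x y, ‖x - y‖ ≤ r → |v x - v y| ≤ ω := by
  have hpi := Real.pi_pos
  have hφ := isLayerState_radialBump
  obtain ⟨C, hC0, hC⟩ := exists_secondDiff_le_of_hasCompactSupport contDiff_radialBump
    hasCompactSupport_radialBump
  obtain ⟨η, hη, hη1, hsup⟩ := hV.exists_layerLim_supersolution hk hφ hC
  set D := (Λ + 1 + k / (2 * Real.pi) *
        (C * ∫ z : EuclideanSpace ℝ (Fin 2), min (‖z‖ ^ 2) 1 / (2 * ‖z‖ ^ 3))) / k with hD
  have hD0 : 0 < D := by
    have : 0 ≤ ∫ z : EuclideanSpace ℝ (Fin 2), min (‖z‖ ^ 2) 1 / (2 * ‖z‖ ^ 3) :=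
      integral_nonneg fun z => by positivity
    have := hV.pos_lip
    positivity
  have hvD : ∀ ε, 0 < ε → ε ≤ 1 → ∀ x, |poissonAvg ε (layerLim f Λ (k / ε) η ε radialBump) x -
      layerLim f Λ (k / ε) η ε radialBump x| ≤ ε * D := by
    intro ε hε hε1 x
    have := hV.abs_layerLim_le hk hη.le hη1 hε hφ hC (hsup ε hε hε1 x)
    rw [abs_mul, abs_of_pos (by positivity : 0 < k / ε)] at this
    rw [hD, mul_div_assoc', le_div_iff₀ hk]
    rw [div_mul_eq_mul_div, div_le_iff₀ hε] at this
    linarith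
  obtain ⟨m, hm0, hm⟩ := hV.exists_volume_lt_layerLim_le hk hφ hC (s := s / 2) (by linarith)
    (by linarith)
  obtain ⟨r₁, ε₁, hr₁, hε₁, hmod₁⟩ := exists_forall_abs_sub_le hD0 (show 0 < s / 4 by linarith)
  set r₂ := min r₁ 1
  have hr₂ : 0 < r₂ := lt_min hr₁ one_pos
  -- Beyond R the obstacle vanishes and the annulus estimate applies.
  set R := m / r₂ + 8 with hR
  have hmr : 0 ≤ m / r₂ := by positivity
  set R' := 1 + 2 * k / b with hR'
  have hR'1 : 1 ≤ R' := by rw [hR']; have : 0 < 2 * k / b := by positivity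
                           linarith
  have hR'0 : 0 < R' := by linarith
  have hkR : k / R' ≤ b / 2 := by
    rw [div_le_iff₀ hR'0, hR']
    have : b / 2 * (1 + 2 * k / b) = b / 2 + k := by field_simp
    rw [this]; linarith
  set p₀ := R' / (2 * Real.pi) * (√(R' ^ 2 + R ^ 2) ^ 3)⁻¹ with hp₀
  have hp₀0 : 0 < p₀ := by
    have : 0 < √(R' ^ 2 + R ^ 2) := Real.sqrt_pos.2 (by positivity)
    positivity
  set M := 1 / p₀ + 2 * R' ^ 2 / b with hM
  have hM0 : 0 < M := by positivity
  have hM1 : ∀ x : EuclideanSpace ℝ (Fin 2), ‖x‖ ≤ R → 1 ≤ M * poissonKer R' x := by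
    intro x hx
    have h1 : p₀ ≤ poissonKer R' x := by
      have : 0 < √(R' ^ 2 + ‖x‖ ^ 2) := Real.sqrt_pos.2 (by positivity)
      rw [hp₀]; unfold poissonKer; gcongr
    have h2 : 1 / p₀ ≤ M := by
      rw [hM]; have : 0 < 2 * R' ^ 2 / b := by positivity
      linarith
    calc 1 = 1 / p₀ * p₀ := by field_simp
      _ ≤ M * poissonKer R' x := by gcongr
  have hM2 : 2 * R' ^ 2 / b ≤ M := by
    rw [hM]; have : 0 < 1 / p₀ := by positivity
    linarith
  refine ⟨η, M * R', hη, by positivity, fun ω hω => ?_⟩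
  obtain ⟨r, ε₂, hr, hε₂, hmod₂⟩ := exists_forall_abs_sub_le hD0 hω
  refine ⟨r, min 1 (min ε₁ ε₂), hr, lt_min one_pos (lt_min hε₁ hε₂), fun ε hε hεle => ?_⟩
  have hε1 : ε ≤ 1 := hεle.trans (min_le_left _ _)
  have hεε₁ : ε ≤ ε₁ := hεle.trans ((min_le_right _ _).trans (min_le_left _ _))
  have hεε₂ : ε ≤ ε₂ := hεle.trans ((min_le_right _ _).trans (min_le_right _ _))
  have hq : 0 < k / ε := by positivity
  have hvm := hV.measurable_layerLim hq hη.le hε hφ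
  have hv1 := hV.layerLim_le_one hq hη.le hε hφ
  have hv0 := hV.layerLim_nonneg hq hη.le hε hφ
  have hvφ := hV.obstacle_le_layerLim hq hη.le hε hφ
  have hvs : ∀ x, R < ‖x‖ → layerLim f Λ (k / ε) η ε radialBump x ≤ s := by
    intro x hx
    refine norm_le_of_volume_lt_le (hV.layerLim_isometry hq hη.le hε hφ) hs hr₂ (min_le_right _ _)
      hm0 (fun x y hxy => ?_) (hm ε η hε hε1 hη.le hη1) (by rw [hR] at hx; linarith)
    exact hmod₁ ε hε hεε₁ _ hvm hv0 hv1 (hvD ε hε hε1) x y (hxy.trans (min_le_left _ _))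
  refine ⟨layerLim f Λ (k / ε) η ε radialBump, hvm, hv0, hv1, fun x hx => ?_, fun x => ?_,
    hsup ε hε hε1, hmod₂ ε hε hεε₂ _ hvm hv0 hv1 (hvD ε hε hε1)⟩
  · refine le_antisymm (hv1 x) ?_
    have := hvφ x
    rwa [radialBump_eq_one hx] at this
  · refine (hV.layerLim_le_mul_poissonKer hk hη.le hη1 hε hφ hb hfb
      (fun x hx => radialBump_eq_zero (by rw [hR] at hx; linarith)) hvs hR'1 hkR hM1 hM2 x).trans ?_
    rw [mul_assoc]
    refine mul_le_mul_of_nonneg_left ?_ hM0.le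
    simpa using poissonKer_le_mul one_pos hR'1 x

end IsLayerPotential

/-! ### Mollification. -/

/-- The average of `v` against a normalised smooth bump function. -/
noncomputable def mollify (ρ : ContDiffBump (0 : EuclideanSpace ℝ (Fin 2)))
    (v : EuclideanSpace ℝ (Fin 2) → ℝ) (x : EuclideanSpace ℝ (Fin 2)) : ℝ :=
  ∫ y, ρ.normed volume y * v (x - y)

section mollify

variable {ρ : ContDiffBump (0 : EuclideanSpace ℝ (Fin 2))} {v w : EuclideanSpace ℝ (Fin 2) → ℝ}
  {a B : ℝ} {x : EuclideanSpace ℝ (Fin 2)}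

theorem ContDiffBump.normed_eq_zero {y : EuclideanSpace ℝ (Fin 2)} (hy : ρ.rOut ≤ ‖y‖) :
    ρ.normed volume y = 0 := by
  by_contra h
  have : y ∈ Function.support (ρ.normed volume) := h
  rw [ρ.support_normed_eq, mem_ball_zero_iff] at this
  linarith

theorem integrable_normed_mul (hv : Measurable v) (hb : ∀ x, |v x| ≤ B)
    (x : EuclideanSpace ℝ (Fin 2)) :
    Integrable fun y => ρ.normed volume y * v (x - y) := by
  refine (ρ.integrable_normed (μ := volume).mul_const B).mono'
    (ρ.continuous_normed.measurable.mul (hv.comp (by fun_prop))).aestronglyMeasurable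
    (ae_of_all _ fun y => ?_)
  rw [norm_mul, Real.norm_of_nonneg (ρ.nonneg_normed y)]
  exact mul_le_mul_of_nonneg_left (hb _) (ρ.nonneg_normed y)

theorem mollify_const (c : ℝ) : mollify ρ (fun _ => c) x = c := by
  unfold mollify
  rw [integral_mul_const, ρ.integral_normed, one_mul]

theorem mollify_mono (hv : Measurable v) (hb : ∀ x, |v x| ≤ B) {D : ℝ} (hw : Measurable w)
    (hd : ∀ x, |w x| ≤ D) (h : ∀ y, ‖y - x‖ ≤ ρ.rOut → v y ≤ w y) :
    mollify ρ v x ≤ mollify ρ w x := by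
  refine integral_mono (integrable_normed_mul hv hb x) (integrable_normed_mul hw hd x) fun y => ?_
  rcases le_or_gt ρ.rOut ‖y‖ with hy | hy
  · simp [ContDiffBump.normed_eq_zero hy]
  · exact mul_le_mul_of_nonneg_left (h _ (by simpa using hy.le)) (ρ.nonneg_normed y)

theorem mollify_congr (h : ∀ y, ‖y - x‖ ≤ ρ.rOut → v y = w y) :
    mollify ρ v x = mollify ρ w x := by
  unfold mollify
  congr 1; ext y
  rcases le_or_gt ρ.rOut ‖y‖ with hy | hy
  · simp [ContDiffBump.normed_eq_zero hy]
  · rw [h _ (by simpa using hy.le)]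

theorem mollify_eq_const (h : ∀ y, ‖y - x‖ ≤ ρ.rOut → v y = a) : mollify ρ v x = a :=
  (mollify_congr h).trans (mollify_const a)

theorem mollify_le (hv : Measurable v) (hb : ∀ x, |v x| ≤ B)
    (h : ∀ y, ‖y - x‖ ≤ ρ.rOut → v y ≤ a) : mollify ρ v x ≤ a :=
  (mollify_mono hv hb measurable_const (fun _ => le_rfl) h).trans_eq (mollify_const a)

theorem le_mollify (hv : Measurable v) (hb : ∀ x, |v x| ≤ B)
    (h : ∀ y, ‖y - x‖ ≤ ρ.rOut → a ≤ v y) : a ≤ mollify ρ v x :=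
  (mollify_const a).symm.trans_le (mollify_mono measurable_const (fun _ => le_rfl) hv hb h)

theorem abs_mollify_le (hv : Measurable v) (hb : ∀ x, |v x| ≤ B)
    (h : ∀ y, ‖y - x‖ ≤ ρ.rOut → |v y| ≤ a) : |mollify ρ v x| ≤ a :=
  abs_le.2 ⟨le_mollify hv hb fun y hy => (abs_le.1 (h y hy)).1,
    mollify_le hv hb fun y hy => (abs_le.1 (h y hy)).2⟩

theorem mollify_add (hv : Measurable v) (hb : ∀ x, |v x| ≤ B) {D : ℝ} (hw : Measurable w)
    (hd : ∀ x, |w x| ≤ D) :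
    mollify ρ (fun y => v y + w y) x = mollify ρ v x + mollify ρ w x := by
  unfold mollify
  rw [← integral_add (integrable_normed_mul hv hb x) (integrable_normed_mul hw hd x)]
  simp only [mul_add]

theorem mollify_const_mul (c : ℝ) : mollify ρ (fun y => c * v y) x = c * mollify ρ v x := by
  unfold mollify
  rw [← integral_const_mul]
  congr 1; ext y; ring

theorem mollify_sub (hv : Measurable v) (hb : ∀ x, |v x| ≤ B) {D : ℝ} (hw : Measurable w)
    (hd : ∀ x, |w x| ≤ D) :
    mollify ρ (fun y => v y - w y) x = mollify ρ v x - mollify ρ w x := by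
  unfold mollify
  rw [← integral_sub (integrable_normed_mul hv hb x) (integrable_normed_mul hw hd x)]
  simp only [mul_sub]

theorem contDiff_mollify (hv : Measurable v) (hb : ∀ x, |v x| ≤ B) {n : ℕ∞} :
    ContDiff ℝ n (mollify ρ v) := by
  have hl : LocallyIntegrable v volume :=
    (locallyIntegrable_const (B : ℝ)).mono hv.aestronglyMeasurable
      (ae_of_all _ fun x => (hb x).trans (le_abs_self B))
  exact ρ.hasCompactSupport_normed.contDiff_convolution_left (ContinuousLinearMap.lsmul ℝ ℝ)
    (ρ.contDiff_normed (n := n)) hl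

theorem measurable_mollify (hv : Measurable v) (hb : ∀ x, |v x| ≤ B) :
    Measurable (mollify ρ v) :=
  (contDiff_mollify hv hb (n := 0)).continuous.measurable

theorem poissonAvg_mollify (hv : Measurable v) (hb : ∀ x, |v x| ≤ B) {t : ℝ} (ht : 0 < t) :
    poissonAvg t (mollify ρ v) x = mollify ρ (poissonAvg t v) x := by
  rw [poissonAvg_eq_integral_mul_comp_add ht]
  unfold mollify
  simp_rw [poissonAvg_eq_integral_mul_comp_add ht, ← integral_const_mul]
  rw [integral_integral_swap]
  · congr 1; ext y
    congr 1; ext z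
    rw [show x + z - y = x - y + z by abel]; ring
  · have hB : 0 ≤ B := (abs_nonneg _).trans (hb 0)
    refine (((integrable_poissonKer ht).mul_prod
      (ρ.integrable_normed (μ := volume))).mul_const B).mono' ?_ (ae_of_all _ fun p => ?_)
    · refine Measurable.aestronglyMeasurable ?_
      exact ((continuous_poissonKer ht).measurable.comp measurable_fst).mul
        ((ρ.continuous_normed.measurable.comp measurable_snd).mul
          (hv.comp ((measurable_fst.const_add x).sub measurable_snd)))
    · have h1 := (poissonKer_pos ht p.1).le
      have h2 : 0 ≤ ρ.normed volume p.2 := ρ.nonneg_normed p.2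
      simp only [Function.uncurry_def]
      rw [norm_mul, norm_mul, Real.norm_of_nonneg h1, Real.norm_of_nonneg h2, ← mul_assoc]
      exact mul_le_mul_of_nonneg_left (hb _) (mul_nonneg h1 h2)

theorem secondDiff_mollify (hv : Measurable v) (hb : ∀ x, |v x| ≤ B)
    (z : EuclideanSpace ℝ (Fin 2)) :
    secondDiff (mollify ρ v) x z = ∫ y, secondDiff (ρ.normed volume) y z * v (x - y) := by
  have h : ∀ z, mollify ρ v (x + z) = ∫ y, ρ.normed volume (y + z) * v (x - y) := by
    intro z
    unfold mollify
    rw [← integral_add_right_eq_self _ z]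
    simp only [add_sub_add_right_eq_sub]
  have hi : ∀ z, Integrable fun y => ρ.normed volume (y + z) * v (x - y) := by
    intro z
    have := (integrable_normed_mul (ρ := ρ) hv hb (x + z)).comp_add_right z
    simpa only [add_sub_add_right_eq_sub] using this
  unfold secondDiff
  rw [sub_eq_add_neg x z, h, h, show mollify ρ v x = ∫ y, ρ.normed volume y * v (x - y) from rfl,
    ← integral_add (hi z) (hi (-z)), ← integral_const_mul,
    ← integral_sub (f := fun y => ρ.normed volume (y + z) * v (x - y) +
      ρ.normed volume (y + -z) * v (x - y)) ((hi z).add (hi (-z)))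
      ((integrable_normed_mul hv hb x).const_mul 2)]
  congr 1; ext y
  simp only [sub_eq_add_neg]
  ring

/-- The second difference is moved onto the bump. In the first bound only values of v within
distance 2 of x enter (bump radius plus ‖z‖), so decay of v is inherited by the second differences.
-/
theorem exists_secondDiff_mollify_le (ρ : ContDiffBump (0 : EuclideanSpace ℝ (Fin 2)))
    (hρ : ρ.rOut ≤ 1) : ∃ D : ℝ, 0 ≤ D ∧
      (∀ v : EuclideanSpace ℝ (Fin 2) → ℝ, Measurable v → ∀ B, (∀ x, |v x| ≤ B) → ∀ x m,
        (∀ y, ‖y - x‖ ≤ 2 → |v y| ≤ m) → ∀ z, ‖z‖ ≤ 1 →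
          |secondDiff (mollify ρ v) x z| ≤ D * m * ‖z‖ ^ 2) ∧
      ∀ v : EuclideanSpace ℝ (Fin 2) → ℝ, Measurable v → ∀ m, (∀ x, |v x| ≤ m) → ∀ x z,
        |secondDiff (mollify ρ v) x z| ≤ D * m * min (‖z‖ ^ 2) 1 := by
  obtain ⟨C, hC0, hC⟩ := exists_secondDiff_le_of_hasCompactSupport
    (ρ.contDiff_normed (μ := volume) (n := 2)) ρ.hasCompactSupport_normed
  set V := volume.real (Metric.closedBall (0 : EuclideanSpace ℝ (Fin 2)) 2)
  have key : ∀ v : EuclideanSpace ℝ (Fin 2) → ℝ, Measurable v → ∀ B, (∀ x, |v x| ≤ B) → ∀ x m,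
        (∀ y, ‖y - x‖ ≤ 2 → |v y| ≤ m) → ∀ z, ‖z‖ ≤ 1 →
          |secondDiff (mollify ρ v) x z| ≤ C * V * m * ‖z‖ ^ 2 := by
    intro v hv B hb x m hm z hz
    have hm0 : 0 ≤ m := (abs_nonneg _).trans (hm x (by simp))
    rw [secondDiff_mollify hv hb]
    have h1 : ∫ y, (Metric.closedBall (0 : EuclideanSpace ℝ (Fin 2)) 2).indicator
        (fun _ => C * ‖z‖ ^ 2 * m) y = C * V * m * ‖z‖ ^ 2 := by
      rw [integral_indicator_const _ Metric.isClosed_closedBall.measurableSet, smul_eq_mul]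
      ring
    rw [← h1]
    have hint : Integrable ((Metric.closedBall (0 : EuclideanSpace ℝ (Fin 2)) 2).indicator
        fun _ => C * ‖z‖ ^ 2 * m) :=
      (integrableOn_const measure_closedBall_lt_top.ne).integrable_indicator
        Metric.isClosed_closedBall.measurableSet
    refine norm_integral_le_of_norm_le
      (f := fun y => secondDiff (ρ.normed volume) y z * v (x - y)) hint (ae_of_all _ fun y => ?_)
    by_cases hy : y ∈ Metric.closedBall (0 : EuclideanSpace ℝ (Fin 2)) 2
    · rw [indicator_of_mem hy, norm_mul]
      rw [mem_closedBall_zero_iff] at hy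
      refine mul_le_mul ((hC y z).trans ?_) (hm _ (by simpa using hy)) (norm_nonneg _)
        (by positivity)
      exact mul_le_mul_of_nonneg_left (min_le_left _ _) hC0
    · rw [indicator_of_notMem hy]
      rw [mem_closedBall_zero_iff, not_le] at hy
      have e1 := norm_sub_norm_le y (-z)
      have e2 := norm_sub_norm_le y z
      rw [norm_neg, sub_neg_eq_add] at e1
      have : secondDiff (ρ.normed volume) y z = 0 := by
        unfold secondDiff
        rw [ContDiffBump.normed_eq_zero (by linarith), ContDiffBump.normed_eq_zero (by linarith),
          ContDiffBump.normed_eq_zero (by linarith)]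
        ring
      simp [this]
  have hV : 0 ≤ V := measureReal_nonneg
  refine ⟨C * V + 4, by positivity, fun v hv B hb x m hm z hz => ?_, fun v hv m hm x z => ?_⟩
  · have hm0 : 0 ≤ m := (abs_nonneg _).trans (hm x (by simp))
    refine (key v hv B hb x m hm z hz).trans ?_
    gcongr
    linarith
  · have hm0 : 0 ≤ m := (abs_nonneg _).trans (hm x)
    rcases le_total ‖z‖ 1 with hz | hz
    · rw [min_eq_left (pow_le_one₀ (norm_nonneg _) hz)]
      refine (key v hv m hm x m (fun y _ => hm y) z hz).trans ?_
      gcongr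
      linarith
    · rw [min_eq_right (one_le_pow₀ hz)]
      have h : ∀ x, |mollify ρ v x| ≤ m := fun x => abs_mollify_le hv hm fun y _ => hm y
      have h1 := abs_le.1 (h (x + z))
      have h2 := abs_le.1 (h (x - z))
      have h3 := abs_le.1 (h x)
      have h4 : 0 ≤ C * V * m := by positivity
      unfold secondDiff
      rw [abs_le]
      constructor <;> nlinarith

theorem mollify_poissonKer_le (hρ : ρ.rOut ≤ 1) :
    mollify ρ (poissonKer 1) x ≤ 8 * poissonKer 1 x := by
  refine mollify_le (continuous_poissonKer one_pos).measurable (abs_poissonKer_le one_pos)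
    fun y hy => ?_
  have := poissonKer_add_le one_pos x (y - x)
  rw [add_sub_cancel] at this
  refine this.trans (mul_le_mul_of_nonneg_right ?_ (poissonKer_pos one_pos x).le)
  have h0 := norm_nonneg (y - x)
  calc (1 + ‖y - x‖ / 1) ^ 3 ≤ (1 + 1) ^ 3 := by gcongr; linarith
    _ = 8 := by norm_num

theorem le_mollify_poissonKer (hρ : ρ.rOut ≤ 1 / 12) :
    3 / 4 * poissonKer 1 x ≤ mollify ρ (poissonKer 1) x := by
  refine le_mollify (continuous_poissonKer one_pos).measurable (abs_poissonKer_le one_pos)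
    fun y hy => ?_
  have := poissonKer_add_le one_pos y (x - y)
  rw [add_sub_cancel, norm_sub_rev] at this
  have h0 := norm_nonneg (y - x)
  have h1 : (1 + ‖y - x‖ / 1) ^ 3 ≤ 4 / 3 := by
    calc (1 + ‖y - x‖ / 1) ^ 3 ≤ (1 + 1 / 12) ^ 3 :=
          pow_le_pow_left₀ (by positivity) (by linarith) 3
      _ ≤ 4 / 3 := by norm_num
  have h2 := mul_le_mul_of_nonneg_right h1 (poissonKer_pos one_pos y).le
  linarith

end mollify

/-! ### From Poisson quotients to the half-Laplacian. -/

namespace IsLayerPotential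

variable {V f : ℝ → ℝ} {Λ c : ℝ} (hV : IsLayerPotential V f Λ c)
include hV

/-- Far away v is small and f is nearly linear there, so it almost commutes with averaging, with an
error proportional to v and hence to P₁. On the rest P₁ is bounded below, and the modulus ω makes
the error small. -/
theorem mollify_comp_sub_le {a : ℝ} (ha : HasDerivAt f a 0) {M θ : ℝ} (hM : 0 < M) (hθ : 0 < θ) :
    ∃ ω : ℝ, 0 < ω ∧ ∀ (ρ : ContDiffBump (0 : EuclideanSpace ℝ (Fin 2)))
      (v : EuclideanSpace ℝ (Fin 2) → ℝ), ρ.rOut ≤ 1 → Measurable v → (∀ x, 0 ≤ v x) →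
      (∀ x, v x ≤ 1) → (∀ x, v x ≤ M * poissonKer 1 x) →
      (∀ x y, ‖x - y‖ ≤ 2 * ρ.rOut → |v x - v y| ≤ ω) → ∀ x,
      mollify ρ (fun y => f (v y)) x - f (mollify ρ v x) ≤ θ * poissonKer 1 x := by
  have hΛ := hV.pos_lip
  set θ' := θ / (16 * M) with hθ'
  have hθ'0 : 0 < θ' := by positivity
  have hfar : ∃ s₁ : ℝ, 0 < s₁ ∧ ∀ s, 0 ≤ s → s ≤ s₁ → |f s - a * s| ≤ θ' * s := by
    have h1 := (hasDerivAt_iff_isLittleO.1 ha).def hθ'0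
    simp only [sub_zero, hV.deriv_zero, smul_eq_mul] at h1
    obtain ⟨s₁, hs₁, h2⟩ := Metric.eventually_nhds_iff_ball.1 h1
    refine ⟨s₁ / 2, by positivity, fun s hs hs' => ?_⟩
    have := h2 s (by rw [Metric.mem_ball, dist_zero_right, Real.norm_of_nonneg hs]; linarith)
    rwa [Real.norm_of_nonneg hs, Real.norm_eq_abs, mul_comm s a] at this
  obtain ⟨s₁, hs₁, hs⟩ := hfar
  refine ⟨θ * (s₁ / (8 * M)) / Λ, by positivity, fun ρ v hρ hv h0 h1 hvM hmod x => ?_⟩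
  have hρ0 := ρ.rOut_pos
  have hvb : ∀ x, |v x| ≤ 1 := fun x => abs_le.2 ⟨by linarith [h0 x], h1 x⟩
  have hfm : Measurable fun y => f (v y) := hV.continuous_deriv.measurable.comp hv
  have hfb : ∀ y, |f (v y)| ≤ Λ := by
    intro y
    have := hV.lipschitz (v y) 0
    rw [hV.deriv_zero, sub_zero, sub_zero] at this
    nlinarith [hvb y]
  have hg := poissonKer_pos one_pos x
  have hgm := (continuous_poissonKer one_pos).measurable
  rcases le_or_gt (poissonKer 1 x) (s₁ / (8 * M)) with hx | hx
  · rw [le_div_iff₀ (by positivity)] at hx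
    have hvs : ∀ y, ‖y - x‖ ≤ ρ.rOut → v y ≤ s₁ := by
      intro y hy
      have := poissonKer_add_le one_pos x (y - x)
      rw [add_sub_cancel] at this
      have h3 : (1 + ‖y - x‖ / 1) ^ 3 ≤ 8 := by
        have h0 := norm_nonneg (y - x)
        calc (1 + ‖y - x‖ / 1) ^ 3 ≤ (1 + 1) ^ 3 := by gcongr; linarith
          _ = 8 := by norm_num
      have h4 := mul_le_mul_of_nonneg_right h3 hg.le
      have h5 : M * poissonKer 1 y ≤ M * (8 * poissonKer 1 x) := by gcongr; linarith
      linarith [hvM y]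
    have e1 : mollify ρ (fun y => f (v y)) x ≤ (a + θ') * mollify ρ v x := by
      rw [← mollify_const_mul]
      refine mollify_mono hfm hfb (hv.const_mul _) (D := |a + θ'|) (fun y => ?_) fun y hy => ?_
      · rw [abs_mul]; exact mul_le_of_le_one_right (abs_nonneg _) (hvb y)
      · have := (abs_le.1 (hs _ (h0 y) (hvs y hy))).2
        linarith
    have e2 := (abs_le.1 (hs _ (le_mollify hv hvb fun y _ => h0 y) (mollify_le hv hvb hvs))).1
    have e3 : mollify ρ v x ≤ M * (8 * poissonKer 1 x) := by
      refine le_trans ?_ (mul_le_mul_of_nonneg_left (mollify_poissonKer_le (x := x) hρ) hM.le)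
      rw [← mollify_const_mul]
      refine mollify_mono hv hvb (hgm.const_mul M) (D := M * (1 / (2 * Real.pi))) (fun y => ?_)
        fun y _ => hvM y
      have := abs_poissonKer_le one_pos y
      rw [abs_mul, abs_of_pos hM]
      refine mul_le_mul_of_nonneg_left (this.trans ?_) hM.le
      simp
    have e4 := mul_le_mul_of_nonneg_left e3 hθ'0.le
    have e5 : θ' * (M * (8 * poissonKer 1 x)) * 2 = θ * poissonKer 1 x := by
      rw [hθ']; field_simp; norm_num
    linarith
  · have e1 : mollify ρ (fun y => f (v y)) x ≤ f (mollify ρ v x) + θ * (s₁ / (8 * M)) := by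
      refine mollify_le hfm hfb fun y hy => ?_
      have e2 : |v y - mollify ρ v x| ≤ θ * (s₁ / (8 * M)) / Λ := by
        have h3 : ∀ y', ‖y' - x‖ ≤ ρ.rOut → |v y - v y'| ≤ θ * (s₁ / (8 * M)) / Λ := by
          intro y' hy'
          refine hmod _ _ ?_
          have := norm_sub_le_norm_sub_add_norm_sub y x y'
          rw [norm_sub_rev x y'] at this
          linarith
        rw [abs_le]
        constructor
        · have := mollify_le (ρ := ρ) (x := x) (a := v y + θ * (s₁ / (8 * M)) / Λ) hv hvb
            fun y' hy' => by linarith [(abs_le.1 (h3 y' hy')).1]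
          linarith
        · have := le_mollify (ρ := ρ) (x := x) (a := v y - θ * (s₁ / (8 * M)) / Λ) hv hvb
            fun y' hy' => by linarith [(abs_le.1 (h3 y' hy')).2]
          linarith
      have e3 := (abs_le.1 (hV.lipschitz (v y) (mollify ρ v x))).2
      have e4 := mul_le_mul_of_nonneg_left e2 hΛ.le
      rw [mul_div_cancel₀ _ hΛ.ne'] at e4
      linarith
    have := mul_le_mul_of_nonneg_left hx.le hθ.le
    linarith

/-- A smooth layer profile with a strict supersolution property for the half-Laplacian. -/
theorem exists_mollify_supersolution {κ : ℝ} (hκ : 0 < κ) {b s : ℝ} (hb : 0 < b) (hs : 0 < s)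
    (hs4 : s ≤ 1 / 4) (hfb : ∀ a, 0 ≤ a → a ≤ s → b * a ≤ f a) {a : ℝ} (ha : HasDerivAt f a 0) :
    ∃ (η M : ℝ) (ρ : ContDiffBump (0 : EuclideanSpace ℝ (Fin 2)))
      (v : EuclideanSpace ℝ (Fin 2) → ℝ), 0 < η ∧ 0 < M ∧ ρ.rOut ≤ 1 ∧ Measurable v ∧
      (∀ x, 0 ≤ v x) ∧ (∀ x, v x ≤ 1) ∧ (∀ x, ‖x‖ ≤ 5 → v x = 1) ∧
      (∀ x, v x ≤ M * poissonKer 1 x) ∧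
      ∀ x, κ * halfLap (mollify ρ v) x ≤ f (mollify ρ v x) - η * poissonKer 1 x := by
  have hpi := Real.pi_pos
  have hΛ := hV.pos_lip
  -- The factor 2π matches the normalisation P_ε(z) ≈ ε/(2π‖z‖³).
  obtain ⟨η, M, hη, hM, H⟩ := hV.exists_supersolution (k := 2 * Real.pi * κ) (by positivity) hb hs
    hs4 hfb
  -- The order of choices matters: ω, then r, then the bump, and only then ε. This is possible
  -- because η, M and r do not depend on ε.
  obtain ⟨ω, hω, hcomp⟩ := hV.mollify_comp_sub_le ha hM (θ := η / 8) (by positivity)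
  obtain ⟨r, ε₀, hr, hε₀, H⟩ := H ω hω
  set δ := min (1 / 12) (r / 2) with hδ
  have hδ0 : 0 < δ := lt_min (by norm_num) (by positivity)
  set ρ : ContDiffBump (0 : EuclideanSpace ℝ (Fin 2)) := ⟨δ / 2, δ, by positivity, by linarith⟩
  have hρ12 : ρ.rOut ≤ 1 / 12 := min_le_left _ _
  have hρr : 2 * ρ.rOut ≤ r := by
    have : ρ.rOut ≤ r / 2 := min_le_right _ _
    linarith
  have hρ1 : ρ.rOut ≤ 1 := by linarith
  obtain ⟨D, hD0, hD1, hD2⟩ := exists_secondDiff_mollify_le ρ hρ1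
  -- The number 27 = (1 + 2)³ is the Harnack factor for points at distance at most 2; the sum serves
  -- the global and the local bound at once.
  set C := D + 27 * D * M with hC
  have hC0 : 0 ≤ C := by positivity
  obtain ⟨ε, hεerr, hε, hεε₀⟩ : ∃ ε : ℝ,
      κ * (C * poissonErr ε + 27 * Real.pi * (8 * M) * ε ^ 2) < η / 8 ∧ 0 < ε ∧ ε ≤ ε₀ := by
    have h1 : Tendsto (fun ε => κ * (C * poissonErr ε + 27 * Real.pi * (8 * M) * ε ^ 2)) (𝓝[>] 0)
        (𝓝 (κ * (C * 0 + 27 * Real.pi * (8 * M) * 0 ^ 2))) :=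
      ((tendsto_poissonErr.const_mul C).add ((((continuous_pow 2).tendsto (0:ℝ)).mono_left
        nhdsWithin_le_nhds).const_mul _)).const_mul κ
    have h2 := h1.eventually_lt_const (u := η / 8) (by simp; positivity)
    obtain ⟨ε, h3, h4⟩ := (h2.and (Ioc_mem_nhdsGT hε₀)).exists
    exact ⟨ε, h3, h4.1, h4.2⟩
  obtain ⟨v, hv, h0, h1, h5, hvM, hsup, hmod⟩ := H ε hε hεε₀
  refine ⟨η / 2, M, ρ, v, by positivity, hM, hρ1, hv, h0, h1, h5, hvM, fun x => ?_⟩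
  have hvb : ∀ x, |v x| ≤ 1 := fun x => abs_le.2 ⟨by linarith [h0 x], h1 x⟩
  have hg := fun x => poissonKer_pos one_pos x
  have hfm : Measurable fun y => f (v y) := hV.continuous_deriv.measurable.comp hv
  have hgm := (continuous_poissonKer one_pos).measurable
  have hgb := abs_poissonKer_le one_pos
  have hfb : ∀ y, |f (v y)| ≤ Λ := by
    intro y
    have := hV.lipschitz (v y) 0
    rw [hV.deriv_zero, sub_zero, sub_zero] at this
    nlinarith [hvb y]
  have hPm := (continuous_poissonAvg hε hv hvb).measurable
  have hPb : ∀ x, |poissonAvg ε v x| ≤ 1 := abs_poissonAvg_le hε hvb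
  have hwM : ∀ x, mollify ρ v x ≤ 8 * M * poissonKer 1 x := by
    intro x
    have e1 := mul_le_mul_of_nonneg_left (mollify_poissonKer_le (x := x) hρ1) hM.le
    have e2 : mollify ρ v x ≤ mollify ρ (fun y => M * poissonKer 1 y) x := by
      refine mollify_mono hv hvb (hgm.const_mul M) (D := M * (1 / (2 * Real.pi * 1 ^ 2)))
        (fun y => ?_) fun y _ => hvM y
      rw [abs_mul, abs_of_pos hM]
      exact mul_le_mul_of_nonneg_left (hgb y) hM.le
    rw [mollify_const_mul] at e2
    linarith
  have key := halfLap_le_poissonAvg_add (w := mollify ρ v) (measurable_mollify hv hvb)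
    (fun x => le_mollify hv hvb fun y _ => h0 y) hwM (x := x) (C := C) (fun z => ?_)
    (fun z hz => ?_) hε
  -- The mollified source retains 3η/4; the commutator and the passage ε → 0 cost η/8 each, and η/2
  -- is left.
  · have e1 : 2 * Real.pi * κ / ε * (poissonAvg ε (mollify ρ v) x - mollify ρ v x) ≤
        mollify ρ (fun y => f (v y)) x - η * mollify ρ (poissonKer 1) x := by
      rw [poissonAvg_mollify hv hvb hε, ← mollify_sub hPm hPb hv hvb, ← mollify_const_mul,
        ← mollify_const_mul, ← mollify_sub hfm hfb (hgm.const_mul η)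
          (D := η * (1 / (2 * Real.pi * 1 ^ 2))) (fun y => by
          rw [abs_mul, abs_of_pos hη]; exact mul_le_mul_of_nonneg_left (hgb y) hη.le)]
      refine mollify_mono ((hPm.sub hv).const_mul _) (B := |2 * Real.pi * κ / ε| * 2)
        (fun y => ?_) (hfm.sub (hgm.const_mul η))
        (D := Λ + η * (1 / (2 * Real.pi * 1 ^ 2))) (fun y => ?_) fun y _ => hsup y
      · rw [abs_mul]
        refine mul_le_mul_of_nonneg_left ?_ (abs_nonneg _)
        linarith [abs_sub (poissonAvg ε v y) (v y), hPb y, hvb y]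
      · refine (abs_sub _ _).trans (add_le_add (hfb y) ?_)
        rw [abs_mul, abs_of_pos hη]; exact mul_le_mul_of_nonneg_left (hgb y) hη.le
    have e2 := hcomp ρ v hρ1 hv h0 h1 hvM (fun x y h => hmod x y (h.trans hρr)) x
    have e3 := mul_le_mul_of_nonneg_left (le_mollify_poissonKer (x := x) hρ12) hη.le
    have e4 := mul_le_mul_of_nonneg_left key hκ.le
    have e5 := mul_le_mul_of_nonneg_right hεerr.le (hg x).le
    have e6 : κ * (2 * Real.pi / ε * (poissonAvg ε (mollify ρ v) x - mollify ρ v x)) =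
      2 * Real.pi * κ / ε * (poissonAvg ε (mollify ρ v) x - mollify ρ v x) := by ring
    linarith
  · refine (hD2 v hv 1 hvb x z).trans ?_
    have : 0 ≤ 27 * D * M := by positivity
    gcongr
    linarith
  · refine (hD1 v hv 1 hvb x (27 * M * poissonKer 1 x) (fun y hy => ?_) z hz).trans ?_
    · have := poissonKer_add_le one_pos x (y - x)
      rw [add_sub_cancel] at this
      have h3 : (1 + ‖y - x‖ / 1) ^ 3 ≤ 27 := by
        have h0 := norm_nonneg (y - x)
        calc (1 + ‖y - x‖ / 1) ^ 3 ≤ (1 + 2) ^ 3 := by gcongr; linarith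
          _ = 27 := by norm_num
      have h4 := mul_le_mul_of_nonneg_right h3 (hg x).le
      rw [abs_of_nonneg (h0 y)]
      have h5 : M * poissonKer 1 y ≤ M * (27 * poissonKer 1 x) := by gcongr; linarith
      linarith [hvM y]
    · have := (hg x).le
      have : 0 ≤ D * (poissonKer 1 x * ‖z‖ ^ 2) := by positivity
      nlinarith

end IsLayerPotential

/-! ### Regularity classes of C² functions that are constant at infinity. -/

/-- Interpolation between exponent 0, which is boundedness, and exponent 1. -/
theorem LipschitzWith.holderWith_half_of_bounded {X Y : Type*} [PseudoMetricSpace X]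
    [SeminormedAddCommGroup Y] {f : X → Y} {L : ℝ≥0} (hf : LipschitzWith L f) {B : ℝ}
    (hB : ∀ x, ‖f x‖ ≤ B) : ∃ K, HolderWith K (1 / 2) f := by
  have h0 : HolderWith (2 * B).toNNReal 0 f := by
    intro x y
    simp only [NNReal.coe_zero, ENNReal.rpow_zero, mul_one]
    rw [edist_dist]
    refine ENNReal.ofReal_le_ofReal ?_
    rw [dist_eq_norm]
    linarith [_root_.norm_sub_le (f x) (f y), hB x, hB y]
  exact ⟨_, HolderWith.of_le_of_le h0 (holderWith_one.2 hf) (by simp)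
    (by rw [← NNReal.coe_le_coe]; norm_num)⟩

section regularity

variable {u : EuclideanSpace ℝ (Fin 2) → ℝ} {e : ℝ}

theorem isHolderClass_of_hasCompactSupport_sub (hu : ContDiff ℝ 2 u)
    (hc : HasCompactSupport fun x => u x - e) : IsHolderClass (1 / 2) u := by
  have hd : ContDiff ℝ 2 fun x => u x - e := hu.sub contDiff_const
  obtain ⟨B, hB⟩ := hc.exists_bound_of_continuous hd.continuous
  obtain ⟨L, hL⟩ := ContDiff.lipschitzWith_of_hasCompactSupport hc hd (by simp)
  have hb : ∀ x, |u x| ≤ B + |e| := by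
    intro x
    have := hB x
    rw [Real.norm_eq_abs] at this
    calc |u x| = |(u x - e) + e| := by ring_nf
      _ ≤ _ := (abs_add_le _ _).trans (by linarith)
  refine ⟨⟨_, hb⟩, LipschitzWith.holderWith_half_of_bounded (L := L) (fun x y => ?_) hb⟩
  have := hL x y
  rwa [edist_sub_right] at this

theorem isC1HolderOn_of_hasCompactSupport_sub (hu : ContDiff ℝ 2 u)
    (hc : HasCompactSupport fun x => u x - e) (S : Set (EuclideanSpace ℝ (Fin 2))) :
    IsC1HolderOn (1 / 2) u S := by
  obtain ⟨⟨B, hB⟩, -⟩ := isHolderClass_of_hasCompactSupport_sub hu hc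
  have hf : fderiv ℝ (fun x => u x - e) = fderiv ℝ u := by
    ext1 x; rw [fderiv_sub_const]
  have hc' : HasCompactSupport (fderiv ℝ u) := hf ▸ hc.fderiv (𝕜 := ℝ)
  have hd : ContDiff ℝ 1 (fderiv ℝ u) := hu.fderiv_right (m := 1) (by norm_num)
  obtain ⟨B', hB'⟩ := hc'.exists_bound_of_continuous hd.continuous
  obtain ⟨L, hL⟩ := ContDiff.lipschitzWith_of_hasCompactSupport hc' hd (by simp)
  obtain ⟨K, hK⟩ := hL.holderWith_half_of_bounded hB'
  exact ⟨fun x _ => hu.differentiable (by norm_num) x,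
    ⟨max B B', fun x _ => ⟨(hB x).trans (le_max_left _ _), (hB' x).trans (le_max_right _ _)⟩⟩,
    K, hK.holderOnWith S⟩

end regularity

/-! ### Consequences of the multi-well hypotheses. -/

namespace IsMultiWellPotential

variable {W : ℝ → ℝ} {α : ℝ≥0} (hW : IsMultiWellPotential W α)
include hW

theorem contDiff_deriv : ContDiff ℝ 1 (deriv W) :=
  ((contDiff_succ_iff_deriv (n := 1)).1 hW.contDiff).2.2

theorem differentiable : Differentiable ℝ W := hW.contDiff.differentiable (by norm_num)

theorem differentiable_deriv : Differentiable ℝ (deriv W) :=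
  hW.contDiff_deriv.differentiable (by norm_num)

theorem continuous_deriv_deriv : Continuous (deriv (deriv W)) :=
  hW.contDiff_deriv.continuous_deriv (by norm_num)

theorem periodic_deriv : Function.Periodic (deriv W) 1 := by
  intro x
  rw [← deriv_comp_add_const]
  congr 1; ext y; exact hW.periodic y

theorem periodic_deriv_deriv : Function.Periodic (deriv (deriv W)) 1 := by
  intro x
  rw [← deriv_comp_add_const]
  congr 1; ext y; exact hW.periodic_deriv y

theorem nonneg (s : ℝ) : 0 ≤ W s := by
  obtain ⟨c, hc, h⟩ := hW.coercive
  exact le_trans (by positivity) (h s)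

theorem deriv_zero : deriv W 0 = 0 :=
  IsLocalMin.deriv_eq_zero (Eventually.of_forall fun s => hW.map_zero.trans_le (hW.nonneg s))

theorem exists_sq_le : ∃ c : ℝ, 0 < c ∧ ∀ s ∈ Icc (0:ℝ) 1, c * min s (1 - s) ^ 2 ≤ W (-s) := by
  obtain ⟨c, hc, h⟩ := hW.coercive
  refine ⟨c, hc, fun s hs => le_trans ?_ (h (-s))⟩
  have h0 : 0 ≤ min s (1 - s) := le_min hs.1 (by linarith [hs.2])
  have h1 : min s (1 - s) ≤ Metric.infDist (-s) (range ((↑) : ℤ → ℝ)) := by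
    rw [Metric.le_infDist (range_nonempty _)]
    rintro _ ⟨n, rfl⟩
    rw [Real.dist_eq]
    rcases le_or_gt 0 n with hn | hn
    · have : (0:ℝ) ≤ n := by exact_mod_cast hn
      rw [abs_of_nonpos (by linarith [hs.1])]
      exact (min_le_left _ _).trans (by linarith)
    · have : (n:ℝ) ≤ -1 := by exact_mod_cast Int.le_sub_one_of_lt hn
      rw [abs_of_nonneg (by linarith [hs.2])]
      exact (min_le_right _ _).trans (by linarith)
  gcongr

/-- Otherwise (c/2)s² - W(s) would have positive second derivative at its critical point 0, so W ≤
(c/2)s² nearby, against the coercivity constant c. -/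
theorem deriv_deriv_zero_pos : 0 < deriv (deriv W) 0 := by
  by_contra! hneg
  obtain ⟨c, hc, h⟩ := hW.exists_sq_le
  set g : ℝ → ℝ := fun s => c / 2 * s ^ 2 - W s with hg
  have hg1 : deriv g = fun s => c * s - deriv W s := by
    ext s
    have := (((hasDerivAt_id s).pow 2).const_mul (c / 2)).sub (hW.differentiable s).hasDerivAt
    refine HasDerivAt.deriv (this.congr_deriv ?_)
    simp
    ring
  have hg2 : deriv (deriv g) 0 = c - deriv (deriv W) 0 := by
    rw [hg1]
    have := ((hasDerivAt_id (0:ℝ)).const_mul c).sub (hW.differentiable_deriv 0).hasDerivAt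
    rw [mul_one] at this
    exact this.deriv
  have hmin : IsLocalMin g 0 := by
    refine isLocalMin_of_deriv_deriv_pos (by rw [hg2]; linarith) ?_ ?_
    · rw [hg1]; simp [hW.deriv_zero]
    · exact Continuous.continuousAt (by have := hW.contDiff.continuous; fun_prop)
  obtain ⟨δ, hδ, hball⟩ := Metric.eventually_nhds_iff_ball.1 hmin
  set s := min (δ / 2) (1 / 2) with hs
  have hs0 : 0 < s := lt_min (by positivity) (by norm_num)
  have hs1 : s ≤ 1 / 2 := min_le_right _ _
  have hsδ : s ≤ δ / 2 := min_le_left _ _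
  have h1 := hball (-s) (by
    rw [Metric.mem_ball, dist_zero_right, norm_neg, Real.norm_of_nonneg hs0.le]; linarith)
  have h2 := h s ⟨hs0.le, by linarith⟩
  rw [min_eq_left (by linarith)] at h2
  simp only [hg, hW.map_zero] at h1
  nlinarith [mul_pos hc (pow_pos hs0 2)]

/-- Reflecting the potential turns the transition from `1` to `0` into a layer. -/
theorem exists_isLayerPotential : ∃ Λ c : ℝ,
    IsLayerPotential (fun s => W (-s)) (fun s => -deriv W (-s)) Λ c := by
  obtain ⟨c, hc, hcoer⟩ := hW.exists_sq_le
  obtain ⟨L, hL⟩ := (hW.periodic_deriv_deriv.isBounded_of_continuous one_ne_zero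
    hW.continuous_deriv_deriv).exists_norm_le
  have hL' : ∀ s, ‖deriv (deriv W) s‖ ≤ max L 1 := fun s =>
    (hL _ (mem_range_self s)).trans (le_max_left _ _)
  have h1 : deriv W (-1) = 0 := by
    have := hW.periodic_deriv (-1)
    rw [neg_add_cancel] at this
    rw [← this, hW.deriv_zero]
  refine ⟨max L 1, c, ⟨fun s => ?_, fun a b => ?_, by simp [hW.deriv_zero], by simp [h1],
    by simp [hW.map_zero], lt_max_of_lt_right one_pos, hc, hcoer⟩⟩
  · have := (hW.differentiable (-s)).hasDerivAt.comp s (hasDerivAt_neg s)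
    simpa [Function.comp_def] using this
  · have := convex_univ.norm_image_sub_le_of_norm_deriv_le (f := deriv W)
      (fun x _ => hW.differentiable_deriv x) (fun x _ => hL' x) (mem_univ (-a)) (mem_univ (-b))
    rw [Real.norm_eq_abs, Real.norm_eq_abs] at this
    rwa [show -deriv W (-a) - -deriv W (-b) = deriv W (-b) - deriv W (-a) by ring,
      show a - b = -b - -a by ring]

theorem hasDerivAt_neg_deriv_neg (s : ℝ) :
    HasDerivAt (fun s => -deriv W (-s)) (deriv (deriv W) (-s)) s := by
  have := ((hW.differentiable_deriv (-s)).hasDerivAt.comp s (hasDerivAt_neg s)).fun_neg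
  simpa [Function.comp_def] using this

theorem deriv_one_sub (s : ℝ) : deriv W (1 - s) = deriv W (-s) := by
  rw [← hW.periodic_deriv (-s)]; ring_nf

/-- Half of W''(0) serves as the linear rate near the well; it drives the decay of the layer. -/
theorem exists_mul_le : ∃ b s : ℝ, 0 < b ∧ 0 < s ∧ s ≤ 1 / 4 ∧
    ∀ a, 0 ≤ a → a ≤ s → b * a ≤ -deriv W (-a) := by
  have ha := hW.deriv_deriv_zero_pos
  have h1 := hW.hasDerivAt_neg_deriv_neg 0
  rw [neg_zero] at h1
  have h2 := (hasDerivAt_iff_isLittleO.1 h1).def (half_pos ha)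
  simp only [sub_zero, neg_zero, hW.deriv_zero, smul_eq_mul] at h2
  obtain ⟨δ, hδ, h3⟩ := Metric.eventually_nhds_iff_ball.1 h2
  refine ⟨deriv (deriv W) 0 / 2, min (δ / 2) (1 / 4), half_pos ha,
    lt_min (by positivity) (by norm_num), min_le_right _ _, fun a h0 has => ?_⟩
  have haδ : a ≤ δ / 2 := has.trans (min_le_left _ _)
  have := h3 a (by rw [Metric.mem_ball, dist_zero_right, Real.norm_of_nonneg h0]; linarith)
  rw [Real.norm_of_nonneg h0, Real.norm_eq_abs] at this
  linarith [(abs_le.1 this).1]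

/-- This is the mean value inequality, with Hölder continuity of W'' at 0 bounding the slope from
below. -/
theorem exists_mul_sub_le : ∃ K : ℝ, 0 ≤ K ∧ ∀ x d : ℝ, 0 ≤ x → 0 ≤ d →
    d * (deriv (deriv W) 0 - K * (x + d) ^ (α : ℝ)) ≤ -deriv W (-(x + d)) - -deriv W (-x) := by
  obtain ⟨K, hK⟩ := hW.holder
  refine ⟨K, K.2, fun x d hx hd => ?_⟩
  have := (convex_Icc x (x + d)).mul_sub_le_image_sub_of_le_deriv
    (f := fun s => -deriv W (-s)) (C := deriv (deriv W) 0 - K * (x + d) ^ (α : ℝ))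
    (fun s _ => (hW.hasDerivAt_neg_deriv_neg s).continuousAt.continuousWithinAt)
    (fun s _ => (hW.hasDerivAt_neg_deriv_neg s).differentiableAt.differentiableWithinAt)
    (fun s hs => ?_) x (left_mem_Icc.2 (by linarith)) (x + d) (right_mem_Icc.2 (by linarith))
    (by linarith)
  · linarith
  · rw [interior_Icc] at hs
    rw [(hW.hasDerivAt_neg_deriv_neg s).deriv]
    have h1 := hK.dist_le (-s) 0
    rw [Real.dist_eq, dist_zero_right, norm_neg, Real.norm_of_nonneg (by linarith [hs.1])] at h1
    have h2 : s ^ (α : ℝ) ≤ (x + d) ^ (α : ℝ) :=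
      Real.rpow_le_rpow (by linarith [hs.1]) hs.2.le α.2
    have h3 := mul_le_mul_of_nonneg_left h2 K.2
    have h4 := (abs_le.1 h1).1
    have h5 : (K : ℝ) * s ^ (α : ℝ) ≤ K * (x + d) ^ (α : ℝ) := h3
    linarith

end IsMultiWellPotential

/-! ### The cutoff and the barrier. -/

theorem poissonKer_one_le_inv_cube {r : ℝ} (hr : 0 < r) {x : EuclideanSpace ℝ (Fin 2)}
    (hx : r ≤ ‖x‖) : poissonKer 1 x ≤ 1 / r ^ 3 := by
  have hpi := Real.pi_gt_three
  have h1 : r ≤ √(1 ^ 2 + ‖x‖ ^ 2) := Real.le_sqrt_of_sq_le (by nlinarith)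
  have h2 : (1:ℝ) / (2 * Real.pi) ≤ 1 := by
    rw [div_le_one (by positivity)]; linarith
  unfold poissonKer
  rw [one_div (r ^ 3), ← one_mul (r ^ 3)⁻¹]
  gcongr

theorem poissonKer_one_le_inv_sq {x : EuclideanSpace ℝ (Fin 2)}
    (hx : 0 < ‖x‖) : poissonKer 1 x ≤ 1 / ‖x‖ ^ 2 := by
  have hpi := Real.pi_gt_three
  have h0 : ‖x‖ ≤ √(1 ^ 2 + ‖x‖ ^ 2) := Real.le_sqrt_of_sq_le (by nlinarith)
  have h1 : 1 ≤ √(1 ^ 2 + ‖x‖ ^ 2) := Real.le_sqrt_of_sq_le (by nlinarith)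
  have h2 : (1:ℝ) / (2 * Real.pi) ≤ 1 := by
    rw [div_le_one (by positivity)]; linarith
  unfold poissonKer
  rw [one_div (‖x‖ ^ 2), ← one_mul (‖x‖ ^ 2)⁻¹]
  have h3 : ‖x‖ ^ 2 ≤ √(1 ^ 2 + ‖x‖ ^ 2) ^ 3 := by
    calc ‖x‖ ^ 2 ≤ √(1 ^ 2 + ‖x‖ ^ 2) ^ 2 * 1 := by rw [mul_one]; gcongr
      _ ≤ √(1 ^ 2 + ‖x‖ ^ 2) ^ 2 * √(1 ^ 2 + ‖x‖ ^ 2) := by gcongr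
      _ = _ := by ring
  gcongr

theorem one_div_le_poissonKer_one {x : EuclideanSpace ℝ (Fin 2)}
    (hx : ‖x‖ ≤ 3) : 1 / (2 * Real.pi) * (√10 ^ 3)⁻¹ ≤ poissonKer 1 x := by
  unfold poissonKer
  have h0 : 0 < √(1 ^ 2 + ‖x‖ ^ 2) := Real.sqrt_pos.2 (by positivity)
  have h1 : 1 ^ 2 + ‖x‖ ^ 2 ≤ 10 := by nlinarith [norm_nonneg x]
  gcongr

/-- Cutting the layer profile off at distance `r` costs `O(r⁻³)`. -/
theorem IsLayerPotential.exists_cutoff_supersolution {V f : ℝ → ℝ} {Λ c : ℝ}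
    (hV : IsLayerPotential V f Λ c) {κ : ℝ} (hκ : 0 < κ) {b s : ℝ} (hb : 0 < b) (hs : 0 < s)
    (hs4 : s ≤ 1 / 4) (hfb : ∀ a, 0 ≤ a → a ≤ s → b * a ≤ f a) {a : ℝ} (ha : HasDerivAt f a 0) :
    ∃ η M C : ℝ, 0 < η ∧ 0 < M ∧ 0 ≤ C ∧ ∀ r : ℝ, 6 < r →
      ∃ w : EuclideanSpace ℝ (Fin 2) → ℝ, ContDiff ℝ 2 w ∧ HasCompactSupport w ∧
        (∀ x, 0 ≤ w x) ∧ (∀ x, ‖x‖ ≤ 3 → w x = 1) ∧ (∀ x, r ≤ ‖x‖ → w x = 0) ∧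
        (∀ x, w x ≤ M * poissonKer 1 x) ∧
        ∀ x, κ * halfLap w x ≤ f (w x) - η * poissonKer 1 x + C / r ^ 3 := by
  obtain ⟨η, M, ρ, v, hη, hM, hρ, hv, h0, h1, h5, hvM, hsup⟩ :=
    hV.exists_mollify_supersolution hκ hb hs hs4 hfb ha
  obtain ⟨D, hD0, -, hD⟩ := exists_secondDiff_mollify_le ρ hρ
  have hΛ := hV.pos_lip
  set I := ∫ z : EuclideanSpace ℝ (Fin 2), min (‖z‖ ^ 2) 1 / (2 * ‖z‖ ^ 3) with hI
  have hI0 : 0 ≤ I := integral_nonneg fun z => by positivity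
  refine ⟨η, 8 * M, 8 * M * (κ * D * I + Λ), hη, by positivity, by positivity, fun r hr => ?_⟩
  have hvb : ∀ x, |v x| ≤ 1 := fun x => abs_le.2 ⟨by linarith [h0 x], h1 x⟩
  -- The sharp cut is made before mollifying, so smoothness is free; a margin of 1 covers the bump
  -- radius.
  set S := Metric.ball (0 : EuclideanSpace ℝ (Fin 2)) (r - 1)
  set vin := S.indicator v
  set vout := Sᶜ.indicator v
  have hin : Measurable vin := hv.indicator measurableSet_ball
  have hout : Measurable vout := hv.indicator measurableSet_ball.compl
  have hin0 : ∀ x, 0 ≤ vin x := fun x => indicator_nonneg (fun x _ => h0 x) x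
  have hinv : ∀ x, vin x ≤ v x := fun x => indicator_le_self' (fun x _ => h0 x) x
  have hinb : ∀ x, |vin x| ≤ 1 := fun x =>
    abs_le.2 ⟨by linarith [hin0 x], (hinv x).trans (h1 x)⟩
  have hout0 : ∀ x, 0 ≤ vout x := fun x => indicator_nonneg (fun x _ => h0 x) x
  -- The discarded part lives on ‖x‖ ≥ r - 1 ≥ r/2, whence the factor 8 = 2³.
  set m := 8 * M / r ^ 3 with hm
  have hm0 : 0 ≤ m := by positivity
  have houtm : ∀ x, |vout x| ≤ m := by
    intro x
    rw [abs_of_nonneg (hout0 x)]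
    by_cases hx : x ∈ Sᶜ
    · rw [show vout x = v x from indicator_of_mem hx v]
      refine (hvM x).trans ?_
      have hx' : r - 1 ≤ ‖x‖ := by simpa [S] using hx
      have h2 : r / 2 ≤ ‖x‖ := by linarith
      have := mul_le_mul_of_nonneg_left (poissonKer_one_le_inv_cube (by linarith) h2) hM.le
      refine this.trans_eq ?_
      rw [hm]; field_simp; norm_num
    · rw [show vout x = 0 from indicator_of_notMem hx v]; exact hm0
  have hsplit : ∀ x, vin x + vout x = v x := fun x => congrFun (indicator_self_add_compl S v) x
  have hw : ∀ x, mollify ρ v x = mollify ρ vin x + mollify ρ vout x := by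
    intro x
    rw [← mollify_add hin hinb hout houtm]
    simp only [hsplit]
  have hzero : ∀ x, r ≤ ‖x‖ → mollify ρ vin x = 0 := by
    intro x hx
    refine mollify_eq_const fun y hy => indicator_of_notMem ?_ v
    have := norm_sub_norm_le x y
    rw [norm_sub_rev] at this
    simp only [S, mem_ball_zero_iff, not_lt]
    linarith
  refine ⟨mollify ρ vin, contDiff_mollify hin hinb, ?_, fun x => ?_, fun x hx => ?_, hzero,
    fun x => ?_, fun x => ?_⟩
  · refine HasCompactSupport.intro (isCompact_closedBall 0 r) fun x hx => hzero x ?_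
    rw [mem_closedBall_zero_iff, not_le] at hx
    exact hx.le
  · exact le_mollify hin hinb fun y _ => hin0 y
  · refine mollify_eq_const fun y hy => ?_
    have := norm_sub_norm_le y x
    have hy5 : ‖y‖ ≤ 5 := by linarith
    have hyS : y ∈ S := by simp only [S, mem_ball_zero_iff]; linarith
    rw [show vin y = v y from indicator_of_mem hyS v, h5 y hy5]
  · have e1 := mul_le_mul_of_nonneg_left (mollify_poissonKer_le (x := x) hρ) hM.le
    have e2 : mollify ρ vin x ≤ mollify ρ (fun y => M * poissonKer 1 y) x := by
      refine mollify_mono hin hinb ((continuous_poissonKer one_pos).measurable.const_mul M)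
        (D := M * (1 / (2 * Real.pi * 1 ^ 2))) (fun y => ?_) fun y _ => (hinv y).trans (hvM y)
      rw [abs_mul, abs_of_pos hM]
      exact mul_le_mul_of_nonneg_left (abs_poissonKer_le one_pos y) hM.le
    rw [mollify_const_mul] at e2
    linarith
  · have e1 : halfLap (mollify ρ v) x = halfLap (mollify ρ vin) x + halfLap (mollify ρ vout) x := by
      rw [← halfLap_add (measurable_mollify hin hinb) (measurable_mollify hout houtm)
        (hD vin hin 1 hinb x) (hD vout hout m houtm x)]
      congr 1
      ext y; exact hw y
    have e2 := mul_le_mul_of_nonneg_left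
      (abs_le.1 (abs_halfLap_le (hD vout hout m houtm x))).1 hκ.le
    have e3 := hsup x
    have e4 : f (mollify ρ v x) ≤ f (mollify ρ vin x) + Λ * m := by
      have h6 := (abs_le.1 (hV.lipschitz (mollify ρ v x) (mollify ρ vin x))).2
      have h7 : |mollify ρ v x - mollify ρ vin x| ≤ m := by
        rw [hw x, add_sub_cancel_left]
        exact abs_mollify_le hout houtm fun y _ => houtm y
      have := mul_le_mul_of_nonneg_left h7 hΛ.le
      linarith
    have e5 : 8 * M * (κ * D * I + Λ) / r ^ 3 = κ * (D * m * I) + Λ * m := by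
      rw [hm]; ring
    rw [e1] at e3
    rw [e5]
    linarith

/-- For t ≤ d the left side is of order d^(1+α). For t > d, α ≤ 1 gives d t^α ≤ d^α t, which the
strictness term η g absorbs when d₀ is small. -/
theorem mul_mul_add_rpow_le {K M η α d g t d₀ : ℝ} (hK : 0 ≤ K) (hM : 0 < M) (hα : 0 < α)
    (hα1 : α ≤ 1) (hd : 0 < d) (hdd : d ≤ d₀) (hd₀ : 2 * K * M * d₀ ^ α ≤ η) (ht : 0 ≤ t)
    (hg : 0 ≤ g) (htg : t ≤ M * g) :
    d * (K * (t + d) ^ α) ≤ 2 * K * d ^ (1 + α) + η * g := by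
  have hη : 0 ≤ η := le_trans (by have := hd.trans_le hdd; positivity) hd₀
  have h2 : (2:ℝ) ^ α ≤ 2 := by
    simpa using Real.rpow_le_rpow_of_exponent_le (one_le_two) hα1
  rcases le_or_gt t d with h | h
  · have e1 : (t + d) ^ α ≤ 2 * d ^ α := by
      calc (t + d) ^ α ≤ (2 * d) ^ α := Real.rpow_le_rpow (by linarith) (by linarith) hα.le
        _ = 2 ^ α * d ^ α := Real.mul_rpow (by norm_num) hd.le
        _ ≤ 2 * d ^ α := by gcongr
    rw [Real.rpow_add hd, Real.rpow_one]
    have e2 : d * (K * (t + d) ^ α) ≤ d * (K * (2 * d ^ α)) := by gcongr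
    have : 0 ≤ η * g := by positivity
    linarith
  · have ht0 : 0 < t := hd.trans h
    have e1 : (t + d) ^ α ≤ 2 * t ^ α := by
      calc (t + d) ^ α ≤ (2 * t) ^ α := Real.rpow_le_rpow (by linarith) (by linarith) hα.le
        _ = 2 ^ α * t ^ α := Real.mul_rpow (by norm_num) ht
        _ ≤ 2 * t ^ α := by gcongr
    have e3 : d ^ (1 - α) ≤ t ^ (1 - α) := Real.rpow_le_rpow hd.le h.le (by linarith)
    have e4 : d * t ^ α ≤ d ^ α * t := by
      calc d * t ^ α = d ^ α * d ^ (1 - α) * t ^ α := by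
            rw [← Real.rpow_add hd, add_sub_cancel, Real.rpow_one]
        _ ≤ d ^ α * t ^ (1 - α) * t ^ α := by gcongr
        _ = d ^ α * t := by
            rw [mul_assoc, ← Real.rpow_add ht0, sub_add_cancel, Real.rpow_one]
    have hd₀0 : 0 < d₀ := hd.trans_le hdd
    have e5 : d ^ α ≤ d₀ ^ α := Real.rpow_le_rpow hd.le hdd hα.le
    calc d * (K * (t + d) ^ α) ≤ d * (K * (2 * t ^ α)) := by gcongr
      _ = 2 * K * (d * t ^ α) := by ring
      _ ≤ 2 * K * (d₀ ^ α * (M * g)) :=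
          mul_le_mul_of_nonneg_left (e4.trans (mul_le_mul e5 htg ht (by positivity)))
            (by positivity)
      _ = 2 * K * M * d₀ ^ α * g := by ring
      _ ≤ η * g := by gcongr
      _ ≤ _ := by have : 0 ≤ 2 * K * d ^ (1 + α) := by positivity
                  linarith

/-- Barriers with boundary value `0` on the unit disc and value `1 - d` outside the disc of
radius `r`. -/
theorem IsMultiWellPotential.exists_barrier {W : ℝ → ℝ} {α : ℝ≥0} (hW : IsMultiWellPotential W α)
    (hα : 0 < α) (hα1 : α ≤ 1) {κ : ℝ} (hκ : 0 < κ) :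
    ∃ d₀ M C : ℝ, 0 < d₀ ∧ 0 < M ∧ 0 ≤ C ∧ ∀ d r : ℝ, 0 < d → d ≤ d₀ → 6 < r →
      ∃ u : EuclideanSpace ℝ (Fin 2) → ℝ, ContDiff ℝ 2 u ∧
        HasCompactSupport (fun x => u x - (1 - d)) ∧ (∀ x, ‖x‖ ≤ 1 → u x = 0) ∧
        (∀ x, r ≤ ‖x‖ → u x = 1 - d) ∧ (∀ x, 0 < ‖x‖ → 1 - d - M / ‖x‖ ^ 2 ≤ u x) ∧
        ∀ x, deriv (deriv W) 0 * d - C * d ^ (1 + (α : ℝ)) - C / r ^ 3 ≤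
          κ * halfLap u x - deriv W (u x) := by
  obtain ⟨Λ, c, hV⟩ := hW.exists_isLayerPotential
  obtain ⟨b, s, hb, hs, hs4, hfb⟩ := hW.exists_mul_le
  have hder := hW.hasDerivAt_neg_deriv_neg 0
  rw [neg_zero] at hder
  obtain ⟨η, M, C, hη, hM, hC, H⟩ := hV.exists_cutoff_supersolution hκ hb hs hs4 hfb hder
  obtain ⟨K, hK, hinc⟩ := hW.exists_mul_sub_le
  have ha := hW.deriv_deriv_zero_pos
  set a := deriv (deriv W) 0
  have hΛ := hV.pos_lip
  have hα' : 0 < (α : ℝ) := hα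
  have hα1' : (α : ℝ) ≤ 1 := hα1
  -- Since w = 1 on the disc of radius 3, adding dχ to 1 - d - w yields exactly 0 on the unit disc.
  set χ : ContDiffBump (0 : EuclideanSpace ℝ (Fin 2)) := ⟨1, 2, one_pos, one_lt_two⟩
  obtain ⟨B, hB0, hB⟩ := exists_secondDiff_le_of_hasCompactSupport χ.contDiff χ.hasCompactSupport
  set I := ∫ z : EuclideanSpace ℝ (Fin 2), min (‖z‖ ^ 2) 1 / (2 * ‖z‖ ^ 3) with hI
  have hI0 : 0 ≤ I := integral_nonneg fun z => by positivity
  set g₃ := 1 / (2 * Real.pi) * (√10 ^ 3)⁻¹ with hg₃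
  have hg₃0 : 0 < g₃ := by have := Real.pi_pos; positivity
  -- The first condition lets η P₁ beat every O(d) term for ‖x‖ ≤ 3; the second is for the Hölder
  -- error outside.
  obtain ⟨d₀, hd₀, hsm1, hsm2⟩ : ∃ d₀ : ℝ, 0 < d₀ ∧ (a + κ * (B * I) + Λ) * d₀ ≤ η * g₃ ∧
      2 * K * M * d₀ ^ (α : ℝ) ≤ η := by
    have t1 : Tendsto (fun d : ℝ => (a + κ * (B * I) + Λ) * d) (𝓝[>] 0)
        (𝓝 ((a + κ * (B * I) + Λ) * 0)) :=
      ((continuous_const.mul continuous_id).tendsto (0:ℝ)).mono_left nhdsWithin_le_nhds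
    have t2 : Tendsto (fun d : ℝ => 2 * K * M * d ^ (α : ℝ)) (𝓝[>] 0)
        (𝓝 (2 * K * M * 0 ^ (α : ℝ))) :=
      ((continuous_const.mul (Real.continuous_rpow_const hα'.le)).tendsto (0:ℝ)).mono_left
        nhdsWithin_le_nhds
    rw [mul_zero] at t1
    rw [Real.zero_rpow hα'.ne', mul_zero] at t2
    obtain ⟨d, ⟨h1, h2⟩, h3⟩ := (((t1.eventually_lt_const (by positivity : 0 < η * g₃)).and
      (t2.eventually_lt_const hη)).and self_mem_nhdsWithin).exists
    exact ⟨d, h3, h1.le, h2.le⟩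
  refine ⟨d₀, M, C + 2 * K, hd₀, hM, by positivity, fun d r hd hdd hr => ?_⟩
  obtain ⟨w, hw2, hwc, hw0, hw1, hwr, hwM, hsup⟩ := H r hr
  have hχ1 : ∀ x : EuclideanSpace ℝ (Fin 2), ‖x‖ ≤ 1 → χ x = 1 := fun x hx =>
    χ.one_of_mem_closedBall (by simpa using hx)
  have hχ0 : ∀ x : EuclideanSpace ℝ (Fin 2), 2 ≤ ‖x‖ → χ x = 0 := fun x hx =>
    χ.zero_of_le_dist (by simpa using hx)
  set q : EuclideanSpace ℝ (Fin 2) → ℝ := fun x => w x + -d * χ x with hq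
  obtain ⟨B', hB'0, hB'⟩ := exists_secondDiff_le_of_hasCompactSupport hw2 hwc
  have hχd : ∀ x z, |secondDiff (fun y => -d * χ y) x z| ≤ d * B * min (‖z‖ ^ 2) 1 := by
    intro x z
    have : secondDiff (fun y => -d * χ y) x z = -d * secondDiff χ x z := by
      unfold secondDiff; ring
    rw [this, abs_mul, abs_neg, abs_of_pos hd, mul_assoc]
    exact mul_le_mul_of_nonneg_left (hB x z) hd.le
  have hlap : ∀ x, halfLap (fun x => 1 - d - q x) x = - halfLap w x + d * halfLap χ x := by
    intro x
    rw [halfLap_const_sub, hq, halfLap_add hw2.continuous.measurable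
      (χ.continuous.measurable.const_mul _) (hB' x) (hχd x), halfLap_const_mul]
    ring
  have hq2 : ContDiff ℝ 2 q := hw2.add (contDiff_const.mul χ.contDiff)
  refine ⟨fun x => 1 - d - q x, contDiff_const.sub hq2, ?_, fun x hx => ?_, fun x hx => ?_,
    fun x hx => ?_, fun x => ?_⟩
  · refine HasCompactSupport.intro (isCompact_closedBall 0 r) fun x hx => ?_
    rw [mem_closedBall_zero_iff, not_le] at hx
    simp [hq, hwr x hx.le, hχ0 x (by linarith)]
  · simp only [hq, hw1 x (by linarith), hχ1 x hx]; ring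
  · simp only [hq, hwr x hx, hχ0 x (by linarith)]; ring
  · have h1 := mul_le_mul_of_nonneg_left (poissonKer_one_le_inv_sq hx) hM.le
    have h2 : 0 ≤ d * χ x := mul_nonneg hd.le χ.nonneg
    have h3 : M / ‖x‖ ^ 2 = M * (1 / ‖x‖ ^ 2) := by ring
    simp only [hq]
    linarith [hwM x]
  · have hr3 : C / r ^ 3 ≤ (C + 2 * K) / r ^ 3 := by
      have : 0 < r := by linarith
      gcongr; linarith
    have hCd : 2 * K * d ^ (1 + (α : ℝ)) ≤ (C + 2 * K) * d ^ (1 + (α : ℝ)) := by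
      gcongr; linarith
    have hCd0 : 0 ≤ 2 * K * d ^ (1 + (α : ℝ)) := by positivity
    have e1 : deriv W (1 - d - q x) = deriv W (-(w x + d * (1 - χ x))) := by
      rw [← hW.deriv_one_sub]; congr 1; simp only [hq]; ring
    have e2 := hsup x
    rw [e1, hlap]
    rcases le_total ‖x‖ 3 with hx | hx
    · have h1 := mul_le_mul_of_nonneg_left (one_div_le_poissonKer_one hx) hη.le
      have h2 := (abs_le.1 (hV.lipschitz (w x + d * (1 - χ x)) (w x))).1
      have h3 : |w x + d * (1 - χ x) - w x| ≤ d := by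
        have := χ.le_one (x := x)
        have := χ.nonneg (x := x)
        rw [add_sub_cancel_left, abs_of_nonneg (mul_nonneg hd.le (by linarith))]
        exact mul_le_of_le_one_right hd.le (by linarith)
      have h4 := mul_le_mul_of_nonneg_left h3 hΛ.le
      have h5 := mul_le_mul_of_nonneg_left
        (abs_le.1 (abs_halfLap_le (hB x))).1 (mul_pos hκ hd).le
      have h6 : (a + κ * (B * I) + Λ) * d ≤ (a + κ * (B * I) + Λ) * d₀ := by gcongr
      rw [← hg₃] at h1
      rw [← hI] at h5
      linarith
    -- Beyond the bump's support the half-Laplacian of χ is nonnegative and helps.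
    · have h1 := mul_nonneg (mul_pos hκ hd).le
        (halfLap_nonneg_of_eq_zero (fun y => χ.nonneg (x := y)) (hχ0 x (by linarith)))
      have h2 := hinc (w x) d (hw0 x) hd.le
      have h3 := mul_mul_add_rpow_le hK hM hα' hα1' hd hdd hsm2 (hw0 x)
        (poissonKer_pos one_pos x).le (hwM x)
      rw [hχ0 x (by linarith), sub_zero, mul_one]
      linarith

/-! ### Choice of the parameters. -/

theorem mainTheorem9
    (W : ℝ → ℝ) (α : ℝ≥0) (_hα₀ : 0 < α) (_hα₁ : α ≤ 1) (_hW : IsMultiWellPotential W α)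
    (κ : ℝ) (_hκ : 0 < κ)
    (ζ : ℝ) (_hζ₀ : 1 / 2 < ζ) (_hζ₁ : ζ ≤ 1) (_hζα : 2 * ζ ≤ 1 + (α : ℝ))
    (F : ℝ) (_hF : 0 < F) :
    ∃ C c l₀ : ℝ, 0 < C ∧ 0 < c ∧ 0 < l₀ ∧ ∀ l : ℝ, l₀ ≤ l →
      ∃ u : EuclideanSpace ℝ (Fin 2) → ℝ,
        -- regularity
        IsHolderClass (1 / 2) u ∧
        IsLocC1HolderOn (1 / 2) u (Metric.ball 0 2 \ closure (Metric.ball 0 1)) ∧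
        IsC1HolderOn (1 / 2) u (Metric.ball 0 (3 / 2))ᶜ ∧
        -- `u` vanishes on the unit ball and is a strict sub-solution off it;
        -- the value of the operator is finite off the closed unit ball
        (∀ x ∈ Metric.ball (0 : EuclideanSpace ℝ (Fin 2)) 1, u x = 0) ∧
        (∀ x ∈ (Metric.ball (0 : EuclideanSpace ℝ (Fin 2)) 1)ᶜ,
          ∃ a : EReal, HasHalfLaplacianAt κ u x a ∧
            (1 < ‖x‖ → a ≠ ⊤ ∧ a ≠ ⊥) ∧
            ((1 / l + F / l ^ (1 + ζ) : ℝ) : EReal) ≤ a - ((deriv W (u x) : ℝ) : EReal)) ∧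
        -- `u` is constant far away, with a controlled limit at infinity
        (∃ uInf : ℝ,
          (∀ x ∈ (Metric.ball (0 : EuclideanSpace ℝ (Fin 2)) (l ^ ζ / 3))ᶜ, u x = uInf) ∧
          Tendsto u (cocompact (EuclideanSpace ℝ (Fin 2))) (𝓝 uInf) ∧
          |uInf - (1 - 1 / (deriv (deriv W) 0 * l))| ≤ C / l ^ (2 * ζ)) ∧
        -- growth estimate
        (∀ x : EuclideanSpace ℝ (Fin 2), 0 < ‖x‖ → ‖x‖ ≤ l ^ ζ →
          1 - 1 / (deriv (deriv W) 0 * l) - c / ‖x‖ ^ 2 ≤ u x) := by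
  obtain ⟨d₀, M, C, hd₀, hM, hC, H⟩ := _hW.exists_barrier _hα₀ _hα₁ _hκ
  have ha := _hW.deriv_deriv_zero_pos
  set a := deriv (deriv W) 0
  -- The excess a C₁/l^(2ζ) pays three debts of at most this order: F/l^(1+ζ) by ζ ≤ 1, C d^(1+α) by
  -- 2ζ ≤ 1 + α, and the cutoff error 27C/l^(3ζ).
  set C₁ := (F + C * (2 / a) ^ (1 + (α : ℝ)) + 27 * C) / a with hC₁
  have hC₁0 : 0 < C₁ := by positivity
  -- The second condition, available since ζ > 1/2, makes the correction in d no larger than its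
  -- main term; the third gives d ≤ d₀; the last makes the cutoff radius l^ζ/3 exceed 6.
  obtain ⟨l₀, hl₀⟩ : ∃ l₀ : ℝ, ∀ l, l₀ ≤ l →
      1 ≤ l ∧ a * C₁ ≤ l ^ (2 * ζ - 1) ∧ 2 / (a * d₀) ≤ l ∧ 18 < l ^ ζ :=
    eventually_atTop.1 ((eventually_ge_atTop 1).and
      (((tendsto_rpow_atTop (by linarith)).eventually_ge_atTop _).and
      ((eventually_ge_atTop _).and ((tendsto_rpow_atTop (by linarith)).eventually_gt_atTop _))))
  -- The growth constant is C₁ + M because C₁/l^(2ζ) ≤ C₁/‖x‖² for ‖x‖ ≤ l^ζ.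
  refine ⟨C₁, C₁ + M, max l₀ 1, hC₁0, by positivity, lt_max_of_lt_right one_pos, fun l hl => ?_⟩
  obtain ⟨hl1, hl2, hl3, hl4⟩ := hl₀ l ((le_max_left _ _).trans hl)
  have hl0 : 0 < l := by linarith
  set P := l ^ (2 * ζ) with hP
  have hP0 : 0 < P := by positivity
  set d := 1 / (a * l) + C₁ / P with hd
  have hd0 : 0 < d := by positivity
  have hd2 : d ≤ 2 / a / l := by
    have h1 : P = l ^ (2 * ζ - 1) * l := by
      rw [← Real.rpow_add_one hl0.ne', sub_add_cancel]
    have h2 : C₁ / P ≤ 1 / (a * l) := by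
      rw [div_le_div_iff₀ hP0 (by positivity), h1]
      nlinarith
    have h3 : 2 / a / l = 1 / (a * l) + 1 / (a * l) := by field_simp; norm_num
    linarith
  have hdd : d ≤ d₀ := by
    refine hd2.trans ?_
    rw [div_le_iff₀ (by positivity)] at hl3
    rw [div_div, div_le_iff₀ (by positivity)]
    linarith
  obtain ⟨u, hu2, huc, hu1, hur, hug, hsub⟩ := H d (l ^ ζ / 3) hd0 hdd (by linarith)
  have hb := (isHolderClass_of_hasCompactSupport_sub hu2 huc).1
  obtain ⟨B, hB⟩ := hb
  refine ⟨u, isHolderClass_of_hasCompactSupport_sub hu2 huc,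
    fun S _ _ => isC1HolderOn_of_hasCompactSupport_sub hu2 huc S,
    isC1HolderOn_of_hasCompactSupport_sub hu2 huc _, fun x hx => hu1 x ?_, fun x hx => ?_,
    ⟨1 - d, fun x hx => hur x (by simpa using hx), ?_, ?_⟩, fun x hx hxl => ?_⟩
  · rw [mem_ball_zero_iff] at hx; exact hx.le
  · obtain ⟨D, -, hD⟩ := exists_secondDiff_le_of_hasCompactSupport
      (hu2.sub contDiff_const) huc
    refine ⟨((κ * halfLap u x : ℝ) : EReal), hasHalfLaplacianAt_of_secondDiff_le
      hu2.continuous.measurable hB (C := D) (fun z => ?_) κ,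
      fun _ => ⟨EReal.coe_ne_top _, EReal.coe_ne_bot _⟩, ?_⟩
    · refine le_of_eq_of_le ?_ (hD x z)
      unfold secondDiff
      congr 1; ring
    · rw [← EReal.coe_sub, EReal.coe_le_coe_iff]
      refine le_trans ?_ (hsub x)
      have e1 : a * d = 1 / l + a * C₁ / P := by rw [hd]; field_simp
      have e2 : a * C₁ / P = F / P + C * (2 / a) ^ (1 + (α : ℝ)) / P + 27 * C / P := by
        rw [hC₁]; field_simp
      have e3 : F / l ^ (1 + ζ) ≤ F / P := by
        have : P ≤ l ^ (1 + ζ) := Real.rpow_le_rpow_of_exponent_le hl1 (by linarith)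
        gcongr
      have e4 : C * d ^ (1 + (α : ℝ)) ≤ C * (2 / a) ^ (1 + (α : ℝ)) / P := by
        rw [mul_div_assoc]
        refine mul_le_mul_of_nonneg_left ?_ hC
        have : P ≤ l ^ (1 + (α : ℝ)) := Real.rpow_le_rpow_of_exponent_le hl1 _hζα
        calc d ^ (1 + (α : ℝ)) ≤ (2 / a / l) ^ (1 + (α : ℝ)) :=
              Real.rpow_le_rpow hd0.le hd2 (by positivity)
          _ = (2 / a) ^ (1 + (α : ℝ)) / l ^ (1 + (α : ℝ)) :=
              Real.div_rpow (by positivity) hl0.le _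
          _ ≤ _ := by gcongr
      have e5 : C / (l ^ ζ / 3) ^ 3 ≤ 27 * C / P := by
        have h1 : P = l ^ ζ * l ^ ζ := by rw [← Real.rpow_add hl0, ← two_mul]
        have h2 : 1 ≤ l ^ ζ := by linarith
        have h3 : C / (l ^ ζ / 3) ^ 3 = 27 * C / (P * l ^ ζ) := by
          rw [h1]; field_simp; norm_num
        rw [h3]
        gcongr
        exact le_mul_of_one_le_right hP0.le h2
      linarith
  · refine tendsto_const_nhds.congr' ?_
    have := huc.isCompact.compl_mem_cocompact
    filter_upwards [this] with x hx
    have := image_eq_zero_of_notMem_tsupport hx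
    linarith
  · rw [show 1 - d - (1 - 1 / (a * l)) = -(C₁ / P) by rw [hd]; ring, abs_neg,
      abs_of_pos (by positivity)]
  · have h1 : ‖x‖ ^ 2 ≤ P := by
      calc ‖x‖ ^ 2 ≤ (l ^ ζ) ^ 2 := by gcongr
        _ = P := by rw [hP, mul_comm, Real.rpow_mul hl0.le, Real.rpow_two]
    have h2 : C₁ / P ≤ C₁ / ‖x‖ ^ 2 := by gcongr
    have h3 : (C₁ + M) / ‖x‖ ^ 2 = C₁ / ‖x‖ ^ 2 + M / ‖x‖ ^ 2 := add_div _ _ _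
    have := hug x hx
    linarith
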